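/- Notation. $\langle u,\varphi\rangle$ denotes the sesquilinear bracket between $\mathcal S'$ and $\mathcal S$ extending $\int u\,\overline{\varphi}$. For $g\in\mathcal S(\mathbb R^n)\setminus\{0\}$ and $u\in\mathcal S'(\mathbb R^n)$ put $V_gu(x,\omega)=\langle u,\pi(x,\omega)g\rangle$, where $\pi(x,\omega)g(t)=e^{2\pi i t\cdot\omega}g(t-x)$. For $1\le p,q\le\infty$ let $M^{p,q}(\mathbb R^n)$ and $W(\mathcal FL^p,L^q)(\mathbb R^n)$ be the spaces of all $u\in\mathcal S'(\mathbb R^n)$ with finite norm $$\|u\|_{M^{p,q}}=\Big\|\,\omega\mapsto\|V_gu(\cdot,\omega)\|_{L^p}\Big\|_{L^q},\qquad \|u\|_{W(\mathcal FL^p,L^q)}=\Big\|\,x\mapsto\|V_gu(x,\cdot)\|_{L^p}\Big\|_{L^q},$$ respectively; here one non-zero Schwartz window is fixed on $\mathbb R^d$ and one on $\mathbb R^{2d}$. For a real $d\times d$ matrix $T$, the Cohen-type matrix is $$A=A_T=\begin{pmatrix} I & T\\ I & -(I-T)\end{pmatrix}\in \mathrm{GL}(2d,\mathbb R),$$ and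 $\mathcal B_A(f,g)(x,\omega)=\int_{\mathbb R^d}e^{-2\pi i\,y\cdot\omega}f(x+Ty)\,\overline{g(x-(I-T)y)}\,dy$ for $f,g\in\mathcal S(\mathbb R^d)$. For $\sigma\in\mathcal S'(\mathbb R^{2d})$ the operator $\mathrm{op}_A(\sigma)$ is defined by $$\langle \mathrm{op}_A(\sigma)f,g\rangle=\langle\sigma,\mathcal B_A(g,f)\rangle,\qquad f,g\in\mathcal S(\mathbb R^d).$$ Theorem. For every real $d\times d$ matrix $T$, with $A=A_T$, there is a constant $C_A>0$ (depending only on $A$ and on the two fixed windows, not on $\sigma,p,q$) such that for every $\sigma\in M^{\infty,1}(\mathbb R^{2d})$ and all $1\le p,q\le\infty$ the operator $\mathrm{op}_A(\sigma)$ is bounded on $W(\mathcal FL^p,L^q)(\mathbb R^d)$ with $$\|\mathrm{op}_A(\sigma)\|_{W(\mathcal FL^p,L^q)\to W(\mathcal FL^p,L^q)}\le C_A\,\|\sigma\|_{M^{\infty,1}}.$$ Precisely: $\mathcal S(\mathbb R^d)\subset W(\mathcal FL^p,L^q)(\mathbb R^d)$, and there is a linear operator $L$ on $W(\mathcal FL^p,L^q)(\mathbb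 R^d)$ such that $Lf=\mathrm{op}_A(\sigma)f$ for all $f\in\mathcal S(\mathbb R^d)$; $L$ is continuous on norm-bounded subsets of $W(\mathcal FL^p,L^q)(\mathbb R^d)$ for the topology of pointwise convergence in $\mathcal S'(\mathbb R^d)$ (which is needed to single out the extension when $p=\infty$ or $q=\infty$); and $\|Lu\|_{W(\mathcal FL^p,L^q)}\le C_A\|\sigma\|_{M^{\infty,1}}\|u\|_{W(\mathcal FL^p,L^q)}$ for all $u$. -/

import Mathlib

open MeasureTheory
open scoped SchwartzMap FourierTransform ENNReal NNReal ComplexConjugate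

noncomputable section
namespace MatrixWigner

section General

variable {V : Type*} [NormedAddCommGroup V] [InnerProductSpace ℝ V]

theorem hasTemperateGrowth_expI :
    Function.HasTemperateGrowth (fun t : ℝ => Complex.exp (2 * Real.pi * Complex.I * t)) := by
  refine ⟨((contDiff_const.mul Complex.ofRealCLM.contDiff).cexp), fun n => ⟨0, (2 * Real.pi) ^ n, fun t => ?_⟩⟩
  rw [norm_iteratedFDeriv_eq_norm_iteratedDeriv]
  have h : iteratedDeriv n (fun t : ℝ => Complex.exp (2 * Real.pi * Complex.I * t)) =
      fun t : ℝ => (2 * Real.pi * Complex.I) ^ n * Complex.exp (2 * Real.pi * Complex.I * t) := by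
    induction n with
    | zero => simp
    | succ k ih =>
      rw [iteratedDeriv_succ, ih]
      ext t
      have h1 : HasDerivAt (fun t : ℝ => Complex.exp (2 * Real.pi * Complex.I * t))
          (Complex.exp (2 * Real.pi * Complex.I * t) * (2 * Real.pi * Complex.I)) t := by
        have := (((hasDerivAt_id (t : ℂ)).const_mul (2 * Real.pi * Complex.I)).cexp).comp_ofReal
        simpa using this
      rw [(h1.const_mul _).deriv]
      ring
  rw [h]
  have : ‖Complex.exp (2 * Real.pi * Complex.I * t)‖ = 1 := by
    rw [Complex.norm_exp]; simp
  simp [this, abs_of_pos Real.pi_pos]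

/-- The character `t ↦ exp (2 π i t·ω)`. -/
def character (ω : V) (t : V) : ℂ := Complex.exp (2 * Real.pi * Complex.I * (inner ℝ t ω : ℝ))

theorem hasTemperateGrowth_character (ω : V) : (character ω).HasTemperateGrowth :=
  hasTemperateGrowth_expI.comp (Function.hasTemperateGrowth_inner_left ω)

/-- The time-frequency shift `π(x,ω)φ = M_ω T_x φ` of a Schwartz function:
`t ↦ exp (2 π i t·ω) φ (t - x)`. -/
def timeFreqShift (x ω : V) (φ : 𝓢(V, ℂ)) : 𝓢(V, ℂ) :=
  SchwartzMap.smulLeftCLM ℂ (character ω) (φ.compSubConstCLM ℂ x)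

theorem timeFreqShift_apply (x ω : V) (φ : 𝓢(V, ℂ)) (t : V) :
    timeFreqShift x ω φ t =
      Complex.exp (2 * Real.pi * Complex.I * (inner ℝ t ω : ℝ)) * φ (t - x) := by
  simp [timeFreqShift, SchwartzMap.smulLeftCLM_apply_apply (hasTemperateGrowth_character ω),
    character]

/-- Pointwise complex conjugation on the Schwartz space. -/
def conjSchwartz : 𝓢(V, ℂ) →L[ℝ] 𝓢(V, ℂ) :=
  SchwartzMap.postcompCLM (Complex.conjCLE : ℂ →L[ℝ] ℂ)

theorem conjSchwartz_apply (φ : 𝓢(V, ℂ)) (t : V) : conjSchwartz φ t = conj (φ t) := rfl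

/-- The sesquilinear bracket `⟨u, φ⟩` between tempered distributions and Schwartz functions
which extends the inner product `∫ u(t) conj (φ t) dt`. -/
def bracket (u : 𝓢'(V, ℂ)) (φ : 𝓢(V, ℂ)) : ℂ := u (conjSchwartz φ)

/-- The short-time Fourier transform `V_g u (x, ω) = ⟨u, π(x,ω) g⟩`. -/
def stft (g : 𝓢(V, ℂ)) (u : 𝓢'(V, ℂ)) (x ω : V) : ℂ := bracket u (timeFreqShift x ω g)

theorem stft_add (g : 𝓢(V, ℂ)) (u v : 𝓢'(V, ℂ)) (x ω : V) :
    stft g (u + v) x ω = stft g u x ω + stft g v x ω := rfl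

theorem stft_smul (g : 𝓢(V, ℂ)) (c : ℂ) (u : 𝓢'(V, ℂ)) (x ω : V) :
    stft g (c • u) x ω = c * stft g u x ω := rfl

theorem stft_zero (g : 𝓢(V, ℂ)) (x ω : V) : stft g 0 x ω = 0 := rfl

theorem continuous_translation (φ : 𝓢(V, ℂ)) :
    Continuous fun x : V => φ.compSubConstCLM ℂ x := by
  have key : ∀ (k n : ℕ) (ψ : 𝓢(V, ℂ)), ∃ C : ℝ, 0 ≤ C ∧ ∀ x : V, ‖x‖ ≤ 1 →
      SchwartzMap.seminorm ℝ k n (ψ.compSubConstCLM ℂ x - ψ) ≤ C * ‖x‖ := by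
    intro k n ψ
    set C : ℝ := 2 ^ k * (2 ^ k * (Finset.Iic (k, n + 1)).sup
      (fun m => SchwartzMap.seminorm ℝ m.1 m.2) ψ) with hC
    have hC0 : 0 ≤ C := by positivity
    refine ⟨C, hC0, fun x hx => ?_⟩
    refine SchwartzMap.seminorm_le_bound ℝ k n _ (by positivity) fun z => ?_
    have h1 : iteratedFDeriv ℝ n (⇑(ψ.compSubConstCLM ℂ x - ψ)) z =
        iteratedFDeriv ℝ n ψ (z - x) - iteratedFDeriv ℝ n ψ z := by
      have : (⇑(ψ.compSubConstCLM ℂ x - ψ)) = (fun t => ψ (t - x)) - ⇑ψ := by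
        ext t; simp
      rw [this, iteratedFDeriv_sub_apply, iteratedFDeriv_comp_sub]
      · have := ψ.smooth n
        exact (this.comp (contDiff_id.sub contDiff_const)).contDiffAt
      · exact (ψ.smooth n).contDiffAt
    rw [h1]
    have hseg : ∀ y ∈ Metric.closedBall z ‖x‖,
        ‖fderiv ℝ (iteratedFDeriv ℝ n ψ) y‖ ≤ C / (1 + ‖z‖) ^ k := by
      intro y hy
      rw [norm_fderiv_iteratedFDeriv]
      have h2 := SchwartzMap.one_add_le_sup_seminorm_apply (𝕜 := ℝ) (m := (k, n + 1))
        le_rfl le_rfl ψ y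
      rw [le_div_iff₀ (by positivity)]
      have h3 : 1 + ‖z‖ ≤ 2 * (1 + ‖y‖) := by
        have : ‖z‖ ≤ ‖y‖ + 1 := by
          have h4 : ‖z - y‖ ≤ 1 := by
            rw [← dist_eq_norm, dist_comm]; exact (Metric.mem_closedBall.1 hy).trans hx
          calc ‖z‖ = ‖y + (z - y)‖ := by congr 1; abel
            _ ≤ ‖y‖ + ‖z - y‖ := norm_add_le _ _
            _ ≤ _ := by linarith
        linarith [norm_nonneg y]
      calc ‖iteratedFDeriv ℝ (n + 1) ψ y‖ * (1 + ‖z‖) ^ k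
          ≤ ‖iteratedFDeriv ℝ (n + 1) ψ y‖ * (2 * (1 + ‖y‖)) ^ k := by gcongr
        _ = 2 ^ k * ((1 + ‖y‖) ^ k * ‖iteratedFDeriv ℝ (n + 1) ψ y‖) := by
            rw [mul_pow]; ring
        _ ≤ C := by rw [hC]; gcongr
    have hdiff : ∀ y ∈ Metric.closedBall z ‖x‖, DifferentiableAt ℝ (iteratedFDeriv ℝ n ψ) y :=
      fun y _ => ((ψ.smooth ⊤).differentiable_iteratedFDeriv
        (by exact_mod_cast WithTop.coe_lt_top (n : ℕ))) y
    have h5 := (convex_closedBall z ‖x‖).norm_image_sub_le_of_norm_fderiv_le hdiff hseg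
      (Metric.mem_closedBall_self (norm_nonneg x))
      (show z - x ∈ Metric.closedBall z ‖x‖ by simp)
    have h6 : ‖z - x - z‖ = ‖x‖ := by simp
    rw [h6] at h5
    calc ‖z‖ ^ k * ‖iteratedFDeriv ℝ n ψ (z - x) - iteratedFDeriv ℝ n ψ z‖
        ≤ (1 + ‖z‖) ^ k * (C / (1 + ‖z‖) ^ k * ‖x‖) := by
          gcongr
          linarith
      _ = C * ‖x‖ := by
          have : (1 + ‖z‖) ^ k ≠ 0 := by positivity
          field_simp
  rw [continuous_iff_continuousAt]
  intro a
  rw [ContinuousAt, (schwartz_withSeminorms ℝ V ℂ).tendsto_nhds]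
  rintro ⟨k, n⟩ ε hε
  obtain ⟨C, hC, h⟩ := key k n (φ.compSubConstCLM ℂ a)
  have hlim : Filter.Tendsto (fun x : V => C * ‖x - a‖) (nhds a) (nhds 0) := by
    have : Continuous fun x : V => C * ‖x - a‖ := by fun_prop
    simpa using this.tendsto a
  filter_upwards [hlim.eventually_lt_const hε, Metric.closedBall_mem_nhds a one_pos] with x hx hx1
  have hx' : ‖x - a‖ ≤ 1 := by simpa [dist_eq_norm] using hx1
  refine lt_of_le_of_lt ?_ hx
  have := h (x - a) hx'
  rwa [SchwartzMap.compSubConstCLM_comp, add_sub_cancel] at this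

theorem continuous_stft_left (g : 𝓢(V, ℂ)) (u : 𝓢'(V, ℂ)) (ω : V) :
    Continuous fun x => stft g u x ω :=
  (ContinuousLinearMap.continuous (M₁ := 𝓢(V, ℂ)) (M₂ := ℂ) u).comp
    (conjSchwartz.continuous.comp
      ((SchwartzMap.smulLeftCLM ℂ (character ω)).continuous.comp (continuous_translation g)))

variable [FiniteDimensional ℝ V] [MeasurableSpace V] [BorelSpace V]

theorem fourier_modulation (ω : V) (φ : 𝓢(V, ℂ)) :
    𝓕 (SchwartzMap.smulLeftCLM ℂ (character ω) φ) = (𝓕 φ).compSubConstCLM ℂ ω := by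
  ext ξ
  rw [SchwartzMap.compSubConstCLM_apply]
  simp only [SchwartzMap.fourier_coe, Real.fourier_eq']
  congr 1
  ext t
  rw [SchwartzMap.smulLeftCLM_apply_apply (hasTemperateGrowth_character ω), character,
    inner_sub_right, smul_eq_mul, smul_eq_mul, smul_eq_mul, ← mul_assoc, ← Complex.exp_add]
  congr 2
  push_cast
  ring

theorem continuous_modulation (φ : 𝓢(V, ℂ)) :
    Continuous fun ω : V => SchwartzMap.smulLeftCLM ℂ (character ω) φ := by
  have h : (fun ω : V => SchwartzMap.smulLeftCLM ℂ (character ω) φ) =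
      fun ω => 𝓕⁻ ((𝓕 φ).compSubConstCLM ℂ ω) := by
    ext1 ω
    rw [← fourier_modulation, FourierTransform.fourierInv_fourier_eq]
  rw [h]
  exact (FourierTransform.fourierInvCLM ℂ 𝓢(V, ℂ)).continuous.comp (continuous_translation _)

theorem continuous_stft_right (g : 𝓢(V, ℂ)) (u : 𝓢'(V, ℂ)) (x : V) :
    Continuous fun ω => stft g u x ω :=
  (ContinuousLinearMap.continuous (M₁ := 𝓢(V, ℂ)) (M₂ := ℂ) u).comp
    (conjSchwartz.continuous.comp (continuous_modulation _))


/-- The mixed Lebesgue norm: the `L^p` norm in the first variable, followed by the `L^q` norm in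
the second variable. -/
def mixedNorm (p q : ℝ≥0∞) (F : V → V → ℂ) : ℝ≥0∞ :=
  eLpNorm (fun y => eLpNorm (fun x => F x y) p volume) q volume

theorem measurable_uncurry_of_separately_continuous {F : V → V → ℂ}
    (h1 : ∀ y, Continuous fun x => F x y) (h2 : ∀ x, Continuous fun y => F x y) :
    Measurable (Function.uncurry F) :=
  measurable_uncurry_of_continuous_of_measurable h1 fun x => (h2 x).measurable

theorem measurable_inner_norm {F : V → V → ℂ}
    (h1 : ∀ y, Continuous fun x => F x y) (h2 : ∀ x, Continuous fun y => F x y) (p : ℝ≥0∞) :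
    Measurable fun y => eLpNorm (fun x => F x y) p volume := by
  have hF := measurable_uncurry_of_separately_continuous h1 h2
  by_cases hp0 : p = 0
  · simp [hp0]
  by_cases hp : p = ∞
  · subst hp
    refine measurable_of_Iic fun c => ?_
    have hs : MeasurableSet {z : V × V | c < ‖F z.2 z.1‖ₑ} :=
      measurableSet_lt measurable_const (hF.comp measurable_swap).enorm
    have hm := measurable_measure_prodMk_left (ν := (volume : Measure V)) hs
    convert! hm (measurableSet_singleton 0) using 1
    ext y
    simp only [Set.mem_preimage, Set.mem_Iic, Set.mem_singleton_iff, eLpNorm_exponent_top]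
    constructor
    · intro h
      have := ae_le_eLpNormEssSup (f := fun x => F x y) (μ := (volume : Measure V))
      have h3 : ∀ᵐ x : V, ‖F x y‖ₑ ≤ c := this.mono fun x hx => hx.trans h
      rw [ae_iff] at h3
      simpa using h3
    · intro h
      refine essSup_le_of_ae_le c ?_
      change ∀ᵐ x : V, ‖F x y‖ₑ ≤ c
      rw [ae_iff]
      simpa using h
  · simp_rw [eLpNorm_eq_lintegral_rpow_enorm_toReal hp0 hp]
    refine Measurable.pow_const ?_ _
    exact Measurable.lintegral_prod_right' (f := fun z : V × V => ‖F z.2 z.1‖ₑ ^ p.toReal)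
      ((hF.comp measurable_swap).enorm.pow_const _)

theorem mixedNorm_add_le {p q : ℝ≥0∞} (hp : 1 ≤ p) (hq : 1 ≤ q) {F G : V → V → ℂ}
    (hF1 : ∀ y, Continuous fun x => F x y) (hF2 : ∀ x, Continuous fun y => F x y)
    (hG1 : ∀ y, Continuous fun x => G x y) (hG2 : ∀ x, Continuous fun y => G x y) :
    mixedNorm p q (fun x y => F x y + G x y) ≤ mixedNorm p q F + mixedNorm p q G := by
  refine le_trans (eLpNorm_mono_enorm (g := (fun y => eLpNorm (fun x => F x y) p volume) +
    fun y => eLpNorm (fun x => G x y) p volume) fun y => ?_)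
    (eLpNorm_add_le (measurable_inner_norm hF1 hF2 p).aestronglyMeasurable
      (measurable_inner_norm hG1 hG2 p).aestronglyMeasurable hq)
  simp only [enorm_eq_self, Pi.add_apply]
  exact eLpNorm_add_le (hF1 y).aestronglyMeasurable (hG1 y).aestronglyMeasurable hp

theorem mixedNorm_const_mul_le (p q : ℝ≥0∞) (c : ℂ) (F : V → V → ℂ) :
    mixedNorm p q (fun x y => c * F x y) ≤ ‖c‖ₑ * mixedNorm p q F := by
  refine eLpNorm_le_mul_eLpNorm_of_ae_le_mul' (c := ‖c‖₊) (Filter.Eventually.of_forall fun y => ?_) q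
  simp only [enorm_eq_self]
  exact eLpNorm_const_smul_le (c := c) (f := fun x => F x y)

theorem mixedNorm_zero (p q : ℝ≥0∞) : mixedNorm p q (fun _ _ : V => (0 : ℂ)) = 0 := by
  simp [mixedNorm]

/-- The norm of the modulation space `M^{p,q}`, computed with the window `g`. -/
def modulationNorm (g : 𝓢(V, ℂ)) (p q : ℝ≥0∞) (u : 𝓢'(V, ℂ)) : ℝ≥0∞ :=
  mixedNorm p q fun x ω => stft g u x ω

/-- The norm of the space `W(FL^p, L^q)`, computed with the window `g`. -/
def wienerNorm (g : 𝓢(V, ℂ)) (p q : ℝ≥0∞) (u : 𝓢'(V, ℂ)) : ℝ≥0∞ :=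
  mixedNorm p q fun ω x => stft g u x ω

/-- The modulation space `M^{p,q}` of all tempered distributions `u` with `V_g u ∈ L^{p,q}`. -/
def modulationSpace (g : 𝓢(V, ℂ)) (p q : ℝ≥0∞) [Fact (1 ≤ p)] [Fact (1 ≤ q)] :
    Submodule ℂ 𝓢'(V, ℂ) where
  carrier := {u | modulationNorm g p q u < ∞}
  add_mem' {u v} hu hv := by
    simp only [Set.mem_ofPred_eq, modulationNorm, stft_add] at hu hv ⊢
    exact (mixedNorm_add_le Fact.out Fact.out (continuous_stft_left g u)
      (continuous_stft_right g u) (continuous_stft_left g v)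
      (continuous_stft_right g v)).trans_lt (ENNReal.add_lt_top.2 ⟨hu, hv⟩)
  zero_mem' := by
    simp [modulationNorm, stft_zero, mixedNorm_zero]
  smul_mem' c u hu := by
    simp only [Set.mem_ofPred_eq, modulationNorm, stft_smul] at hu ⊢
    exact (mixedNorm_const_mul_le p q c _).trans_lt (ENNReal.mul_lt_top enorm_lt_top hu)

/-- The space `W(FL^p, L^q)` of all tempered distributions `u` for which the `L^p` norm of
`ω ↦ V_g u (x, ω)` is an `L^q` function of `x`. -/
def wienerSpace (g : 𝓢(V, ℂ)) (p q : ℝ≥0∞) [Fact (1 ≤ p)] [Fact (1 ≤ q)] :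
    Submodule ℂ 𝓢'(V, ℂ) where
  carrier := {u | wienerNorm g p q u < ∞}
  add_mem' {u v} hu hv := by
    simp only [Set.mem_ofPred_eq, wienerNorm, stft_add] at hu hv ⊢
    exact (mixedNorm_add_le Fact.out Fact.out (continuous_stft_right g u)
      (continuous_stft_left g u) (continuous_stft_right g v)
      (continuous_stft_left g v)).trans_lt (ENNReal.add_lt_top.2 ⟨hu, hv⟩)
  zero_mem' := by
    simp [wienerNorm, stft_zero, mixedNorm_zero]
  smul_mem' c u hu := by
    simp only [Set.mem_ofPred_eq, wienerNorm, stft_smul] at hu ⊢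
    exact (mixedNorm_const_mul_le p q c _).trans_lt (ENNReal.mul_lt_top enorm_lt_top hu)

end General
section Tensor

variable {E F : Type*} [NormedAddCommGroup E] [NormedSpace ℝ E]
  [NormedAddCommGroup F] [NormedSpace ℝ F]

theorem decay_tensor_aux (φ : 𝓢(E, ℂ)) (ψ : 𝓢(F, ℂ)) (k n : ℕ) :
    ∃ C : ℝ, ∀ z : E × F, ‖z‖ ^ k * ‖iteratedFDeriv ℝ n (fun z : E × F => φ z.1 * ψ z.2) z‖ ≤ C := by
  have hφ : ∀ (i : ℕ) (z : E × F),
      ‖iteratedFDeriv ℝ i (fun z : E × F => φ z.1) z‖ ≤ ‖iteratedFDeriv ℝ i φ z.1‖ := by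
    intro i z
    have h := (ContinuousLinearMap.fst ℝ E F).iteratedFDeriv_comp_right (φ.smooth ⊤) z (i := i)
      (by exact_mod_cast le_top)
    change iteratedFDeriv ℝ i (fun z : E × F => φ z.1) z = _ at h
    rw [h]
    refine (ContinuousMultilinearMap.norm_compContinuousLinearMap_le _ _).trans ?_
    refine mul_le_of_le_one_right (norm_nonneg _) ?_
    exact Finset.prod_le_one (fun _ _ => norm_nonneg _)
      fun _ _ => ContinuousLinearMap.norm_fst_le ℝ E F
  have hψ : ∀ (i : ℕ) (z : E × F),
      ‖iteratedFDeriv ℝ i (fun z : E × F => ψ z.2) z‖ ≤ ‖iteratedFDeriv ℝ i ψ z.2‖ := by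
    intro i z
    have h := (ContinuousLinearMap.snd ℝ E F).iteratedFDeriv_comp_right (ψ.smooth ⊤) z (i := i)
      (by exact_mod_cast le_top)
    change iteratedFDeriv ℝ i (fun z : E × F => ψ z.2) z = _ at h
    rw [h]
    refine (ContinuousMultilinearMap.norm_compContinuousLinearMap_le _ _).trans ?_
    refine mul_le_of_le_one_right (norm_nonneg _) ?_
    exact Finset.prod_le_one (fun _ _ => norm_nonneg _)
      fun _ _ => ContinuousLinearMap.norm_snd_le ℝ E F
  refine ⟨∑ i ∈ Finset.range (n + 1), (n.choose i : ℝ) *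
    (SchwartzMap.seminorm ℝ k i φ * SchwartzMap.seminorm ℝ 0 (n - i) ψ +
      SchwartzMap.seminorm ℝ 0 i φ * SchwartzMap.seminorm ℝ k (n - i) ψ), fun z => ?_⟩
  have h1 := norm_iteratedFDeriv_mul_le (𝕜 := ℝ) (N := (⊤ : ℕ∞)) (n := n)
    (f := fun z : E × F => φ z.1) (g := fun z : E × F => ψ z.2)
    ((φ.smooth ⊤).comp contDiff_fst) ((ψ.smooth ⊤).comp contDiff_snd) z
    (by exact_mod_cast le_top)
  refine (mul_le_mul_of_nonneg_left h1 (by positivity)).trans ?_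
  rw [Finset.mul_sum]
  refine Finset.sum_le_sum fun i _ => ?_
  have hz : ‖z‖ ^ k ≤ ‖z.1‖ ^ k + ‖z.2‖ ^ k := by
    rw [Prod.norm_def]
    rcases max_cases ‖z.1‖ ‖z.2‖ with ⟨h, _⟩ | ⟨h, _⟩ <;> rw [h]
    · linarith [pow_nonneg (norm_nonneg z.2) k]
    · linarith [pow_nonneg (norm_nonneg z.1) k]
  have a1 := φ.le_seminorm ℝ k i z.1
  have a2 := φ.norm_iteratedFDeriv_le_seminorm ℝ i z.1
  have b1 := ψ.le_seminorm ℝ k (n - i) z.2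
  have b2 := ψ.norm_iteratedFDeriv_le_seminorm ℝ (n - i) z.2
  calc ‖z‖ ^ k * ((n.choose i : ℝ) * ‖iteratedFDeriv ℝ i (fun z : E × F => φ z.1) z‖ *
        ‖iteratedFDeriv ℝ (n - i) (fun z : E × F => ψ z.2) z‖)
      ≤ (‖z.1‖ ^ k + ‖z.2‖ ^ k) * ((n.choose i : ℝ) * ‖iteratedFDeriv ℝ i φ z.1‖ *
        ‖iteratedFDeriv ℝ (n - i) ψ z.2‖) := by
        gcongr
        · exact hφ i z
        · exact hψ _ z
    _ = (n.choose i : ℝ) * ((‖z.1‖ ^ k * ‖iteratedFDeriv ℝ i φ z.1‖) *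
          ‖iteratedFDeriv ℝ (n - i) ψ z.2‖ + ‖iteratedFDeriv ℝ i φ z.1‖ *
          (‖z.2‖ ^ k * ‖iteratedFDeriv ℝ (n - i) ψ z.2‖)) := by ring
    _ ≤ _ := by gcongr

/-- The tensor product `(φ ⊗ ψ)(x, y) = φ x * ψ y` of Schwartz functions. -/
def tensor (φ : 𝓢(E, ℂ)) (ψ : 𝓢(F, ℂ)) : 𝓢(E × F, ℂ) where
  toFun z := φ z.1 * ψ z.2
  smooth' := ((φ.smooth ⊤).comp contDiff_fst).mul ((ψ.smooth ⊤).comp contDiff_snd)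
  decay' := decay_tensor_aux φ ψ

end Tensor

section PartialFourier

variable {E : Type} [NormedAddCommGroup E] [InnerProductSpace ℝ E]

theorem norm_exp_phase (y w : E) :
    ‖Complex.exp (-(2 * Real.pi * Complex.I * (inner ℝ y w : ℝ)))‖ = 1 := by
  rw [Complex.norm_exp]; simp

variable {V : Type} [NormedAddCommGroup V] [NormedSpace ℂ V]

theorem continuous_integrand (Ψ : 𝓢(E × E, V)) (z : E × E) : Continuous fun y : E =>
    Complex.exp (-(2 * Real.pi * Complex.I * (inner ℝ y z.2 : ℝ))) • Ψ (z.1, y) :=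
  (by fun_prop : Continuous fun y : E =>
    Complex.exp (-(2 * Real.pi * Complex.I * (inner ℝ y z.2 : ℝ)))).smul
      (Ψ.continuous.comp (by fun_prop))

/-- The section `y ↦ Ψ (x, y)` of a Schwartz function. -/
def schwartzSection (Ψ : 𝓢(E × E, V)) (x : E) : 𝓢(E, V) :=
  SchwartzMap.compCLMOfAntilipschitz ℂ (K := 1) (g := fun y : E => (x, y))
    (by
      have h1 : Function.HasTemperateGrowth (fun y : E => ContinuousLinearMap.inr ℝ E E y) :=
        (ContinuousLinearMap.inr ℝ E E).hasTemperateGrowth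
      have h2 := (Function.HasTemperateGrowth.const (E := E) ((x, 0) : E × E)).add h1
      convert! h2 using 1
      ext y <;> simp)
    (by
      refine AntilipschitzWith.of_le_mul_dist fun y y' => ?_
      simp [Prod.dist_eq]) Ψ

theorem schwartzSection_apply (Ψ : 𝓢(E × E, V)) (x y : E) : schwartzSection Ψ x y = Ψ (x, y) := rfl

/-- The Schwartz function whose partial Fourier transform is the derivative of that of `Ψ`. -/
def derivSymbol (Ψ : 𝓢(E × E, V)) : 𝓢(E × E, E × E →L[ℝ] V) :=
  SchwartzMap.postcompCLM
      ((ContinuousLinearMap.compL ℝ (E × E) (E × E) V).flip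
        ((ContinuousLinearMap.inl ℝ E E).comp (ContinuousLinearMap.fst ℝ E E)))
      (SchwartzMap.fderivCLM ℝ (E × E) V Ψ) -
    (2 * Real.pi * Complex.I) • SchwartzMap.smulRightCLM ℂ V
      (((ContinuousLinearMap.compL ℝ (E × E) E ℝ).flip (ContinuousLinearMap.snd ℝ E E)).comp
        ((innerSL ℝ).comp (ContinuousLinearMap.snd ℝ E E))) Ψ

theorem derivSymbol_apply (Ψ : 𝓢(E × E, V)) (p v : E × E) :
    derivSymbol Ψ p v = fderiv ℝ Ψ p (v.1, 0) -
      (2 * Real.pi * Complex.I : ℂ) • ((inner ℝ p.2 v.2 : ℝ) • Ψ p) := rfl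

variable [FiniteDimensional ℝ E] [MeasurableSpace E] [BorelSpace E]

/-- The integral defining the partial Fourier transform in the second variable. -/
def partialFourierFun (Ψ : E × E → V) (z : E × E) : V :=
  ∫ y : E, Complex.exp (-(2 * Real.pi * Complex.I * (inner ℝ y z.2 : ℝ))) • Ψ (z.1, y)

theorem partialFourierFun_eq (Ψ : 𝓢(E × E, V)) (z : E × E) :
    partialFourierFun Ψ z = 𝓕 (schwartzSection Ψ z.1) z.2 := by
  rw [SchwartzMap.fourier_coe, Real.fourier_eq']
  simp only [partialFourierFun, schwartzSection_apply]
  congr 1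
  ext y
  congr 2
  push_cast
  ring

theorem exists_uniform_bound (Ψ : 𝓢(E × E, V)) :
    ∃ b : E → ℝ, Integrable b volume ∧ ∀ x y, ‖Ψ (x, y)‖ ≤ b y := by
  set N := (volume : Measure E).integrablePower with hN
  set C : ℝ := 2 ^ N * (Finset.Iic (N, 0)).sup (fun m => SchwartzMap.seminorm ℝ m.1 m.2) Ψ with hC
  refine ⟨fun y => C * (1 + ‖y‖) ^ (-(N : ℝ)),
    (Measure.integrable_pow_neg_integrablePower volume).const_mul C, fun x y => ?_⟩
  have h := SchwartzMap.one_add_le_sup_seminorm_apply (𝕜 := ℝ) (m := (N, 0)) le_rfl le_rfl Ψ (x, y)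
  rw [norm_iteratedFDeriv_zero] at h
  simp only [Real.rpow_neg (add_nonneg zero_le_one (norm_nonneg y)), Real.rpow_natCast]
  rw [← div_eq_mul_inv,
    le_div_iff₀ (by positivity)]
  have : ‖y‖ ≤ ‖((x, y) : E × E)‖ := norm_snd_le (x, y)
  calc ‖Ψ (x, y)‖ * (1 + ‖y‖) ^ N ≤ ‖Ψ (x, y)‖ * (1 + ‖((x, y) : E × E)‖) ^ N := by gcongr
    _ ≤ C := by rw [mul_comm]; exact h

theorem integrable_partialFourier (Ψ : 𝓢(E × E, V)) (z : E × E) : Integrable fun y : E =>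
    Complex.exp (-(2 * Real.pi * Complex.I * (inner ℝ y z.2 : ℝ))) • Ψ (z.1, y) := by
  obtain ⟨b, hb, h⟩ := exists_uniform_bound Ψ
  refine hb.mono' (continuous_integrand Ψ z).aestronglyMeasurable
    (Filter.Eventually.of_forall fun y => ?_)
  rw [norm_smul, norm_exp_phase, one_mul]
  exact h _ _

theorem bounded_partialFourierFun (Ψ : 𝓢(E × E, V)) : ∃ C, ∀ z, ‖partialFourierFun Ψ z‖ ≤ C := by
  obtain ⟨b, hb, h⟩ := exists_uniform_bound Ψ
  refine ⟨∫ y, b y, fun z => ?_⟩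
  refine norm_integral_le_of_norm_le hb (Filter.Eventually.of_forall fun y => ?_)
  rw [norm_smul, norm_exp_phase, one_mul]
  exact h _ _

set_option maxRecDepth 2000 in
theorem hasFDerivAt_partialFourierFun (Ψ : 𝓢(E × E, V)) (z : E × E) :
    HasFDerivAt (partialFourierFun Ψ) (partialFourierFun (derivSymbol Ψ) z) z := by
  obtain ⟨b, hb, h⟩ := exists_uniform_bound (V := E × E →L[ℝ] V) (derivSymbol Ψ)
  have hmeas := (integrable_partialFourier (V := E × E →L[ℝ] V) (derivSymbol Ψ) z).1
  refine hasFDerivAt_integral_of_dominated_of_fderiv_le (s := Set.univ) (bound := b)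
    (F := fun z y => Complex.exp (-(2 * Real.pi * Complex.I * (inner ℝ y z.2 : ℝ))) • Ψ (z.1, y))
    (F' := fun z y => Complex.exp (-(2 * Real.pi * Complex.I * (inner ℝ y z.2 : ℝ))) •
      derivSymbol Ψ (z.1, y)) Filter.univ_mem ?_ ?_ ?_ ?_ hb ?_
  · exact Filter.Eventually.of_forall fun w => (continuous_integrand Ψ w).aestronglyMeasurable
  · exact integrable_partialFourier Ψ z
  · exact hmeas
  · refine Filter.Eventually.of_forall fun y w _ => ?_
    rw [norm_smul, norm_exp_phase, one_mul]
    exact h _ _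
  · refine Filter.Eventually.of_forall fun y w _ => ?_
    have hlin : HasFDerivAt (fun w : E × E => (inner ℝ y w.2 : ℝ))
        ((innerSL ℝ y).comp (ContinuousLinearMap.snd ℝ E E)) w :=
      ((innerSL ℝ y).comp (ContinuousLinearMap.snd ℝ E E)).hasFDerivAt
    have hexp : HasFDerivAt (fun w : E × E =>
        Complex.exp (-(2 * Real.pi * Complex.I * (inner ℝ y w.2 : ℝ))))
        (Complex.exp (-(2 * Real.pi * Complex.I * (inner ℝ y w.2 : ℝ))) •
          (-((2 * Real.pi * Complex.I) • Complex.ofRealCLM.comp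
            ((innerSL ℝ y).comp (ContinuousLinearMap.snd ℝ E E))))) w :=
      (((Complex.ofRealCLM.hasFDerivAt.comp w hlin).const_mul (2 * Real.pi * Complex.I)).neg).cexp
    have hΨ : HasFDerivAt (fun w : E × E => Ψ (w.1, y))
        ((fderiv ℝ Ψ (w.1, y)).comp
          ((ContinuousLinearMap.inl ℝ E E).comp (ContinuousLinearMap.fst ℝ E E))) w := by
      refine HasFDerivAt.comp w (Ψ.differentiableAt.hasFDerivAt) ?_
      have := (hasFDerivAt_fst (𝕜 := ℝ) (p := w)).prodMk (hasFDerivAt_const y w)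
      convert! this using 1
    convert! hexp.smul hΨ using 1
    refine ContinuousLinearMap.ext fun v => ?_
    set c : ℂ := Complex.exp (-(2 * Real.pi * Complex.I * (inner ℝ y w.2 : ℝ)))
    change c • derivSymbol Ψ (w.1, y) v = c • fderiv ℝ Ψ (w.1, y) (v.1, 0) +
      (c • -((2 * Real.pi * Complex.I) • ((inner ℝ y v.2 : ℝ) : ℂ))) • Ψ (w.1, y)
    rw [derivSymbol_apply]
    generalize (2 * Real.pi * Complex.I : ℂ) = k
    rw [smul_sub, sub_eq_add_neg, smul_eq_mul, smul_eq_mul, mul_neg, neg_smul, mul_smul, mul_smul,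
      Complex.coe_smul]

theorem contDiff_partialFourierFun (n : ℕ) :
    ∀ {V : Type} [NormedAddCommGroup V] [NormedSpace ℂ V] [CompleteSpace V] (Ψ : 𝓢(E × E, V)),
      ContDiff ℝ n (partialFourierFun Ψ) := by
  induction n with
  | zero =>
    intro V _ _ _ Ψ
    refine contDiff_zero.2 (continuous_iff_continuousAt.2 fun z => ?_)
    exact (hasFDerivAt_partialFourierFun Ψ z).continuousAt
  | succ n ih =>
    intro V _ _ _ Ψ
    refine (contDiff_succ_iff_hasFDerivAt (n := n)).2 ⟨_, ih (V := E × E →L[ℝ] V) (derivSymbol Ψ), fun z => ?_⟩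
    exact hasFDerivAt_partialFourierFun Ψ z

theorem decay_partialFourierFun (k : ℕ) :
    ∀ {V : Type} [NormedAddCommGroup V] [NormedSpace ℂ V] [CompleteSpace V] (Ψ : 𝓢(E × E, V)),
      ∃ C, ∀ z, ‖z‖ ^ k * ‖partialFourierFun Ψ z‖ ≤ C := by
  induction k with
  | zero =>
    intro V _ _ _ Ψ
    simpa using bounded_partialFourierFun Ψ
  | succ k ih =>
    intro V _ _ _ Ψ
    -- multiplication by the first variable
    set Ψ₁ : 𝓢(E × E, E →L[ℝ] V) :=
      SchwartzMap.smulRightCLM ℂ V ((innerSL ℝ).comp (ContinuousLinearMap.fst ℝ E E)) Ψ with hΨ₁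
    -- derivative in the second variable
    set Ψ₂ : 𝓢(E × E, E →L[ℝ] V) := SchwartzMap.postcompCLM
      ((ContinuousLinearMap.compL ℝ E (E × E) V).flip (ContinuousLinearMap.inr ℝ E E))
      (SchwartzMap.fderivCLM ℝ (E × E) V Ψ) with hΨ₂
    have h1 : ∀ z, ‖z.1‖ * ‖partialFourierFun Ψ z‖ = ‖partialFourierFun Ψ₁ z‖ := by
      intro z
      have : partialFourierFun Ψ₁ z = (innerSL ℝ z.1).smulRight (partialFourierFun Ψ z) := by
        have hL := (ContinuousLinearMap.smulRightL ℝ E V (innerSL ℝ z.1)).integral_comp_comm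
          (integrable_partialFourier Ψ z)
        rw [ContinuousLinearMap.smulRightL_apply_apply] at hL
        rw [partialFourierFun, partialFourierFun, ← hL]
        congr 1
        ext y v
        exact smul_comm (Complex.exp (-(2 * Real.pi * Complex.I * (inner ℝ y z.2 : ℝ)))) (inner ℝ z.1 v) (Ψ (z.1, y))
      rw [this, ContinuousLinearMap.norm_smulRight_apply, innerSL_apply_norm]
    have h2 : ∀ z, ‖z.2‖ * ‖partialFourierFun Ψ z‖ ≤ ‖partialFourierFun Ψ₂ z‖ := by
      intro z
      have hsec : schwartzSection Ψ₂ z.1 =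
          SchwartzMap.fderivCLM ℂ E V (schwartzSection Ψ z.1) := by
        ext y v
        have hd : HasFDerivAt (fun y : E => Ψ (z.1, y))
            ((fderiv ℝ Ψ (z.1, y)).comp (ContinuousLinearMap.inr ℝ E E)) y := by
          refine HasFDerivAt.comp y (Ψ.differentiableAt.hasFDerivAt) ?_
          have := (hasFDerivAt_const (𝕜 := ℝ) z.1 y).prodMk (hasFDerivAt_id y)
          convert! this using 1
        change (fderiv ℝ Ψ (z.1, y)) (0, v) = fderiv ℝ (fun y : E => Ψ (z.1, y)) y v
        rw [hd.fderiv]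
        simp
      rw [partialFourierFun_eq Ψ₂, hsec, SchwartzMap.fourier_fderivCLM_eq, partialFourierFun_eq]
      rw [smul_apply, SchwartzMap.smulRightCLM_apply_apply, norm_smul,
        ContinuousLinearMap.norm_smulRight_apply, innerSL_apply_norm]
      have : (1 : ℝ) ≤ ‖(2 * Real.pi * Complex.I : ℂ)‖ := by
        simp [abs_of_pos Real.pi_pos]
        linarith [Real.pi_gt_three]
      exact le_mul_of_one_le_left (by positivity) this
    obtain ⟨C₁, hC₁⟩ := ih Ψ₁
    obtain ⟨C₂, hC₂⟩ := ih Ψ₂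
    refine ⟨C₁ + C₂, fun z => ?_⟩
    have hz : ‖z‖ ≤ ‖z.1‖ + ‖z.2‖ := by
      rw [Prod.norm_def]
      exact max_le (by linarith [norm_nonneg z.2]) (by linarith [norm_nonneg z.1])
    calc ‖z‖ ^ (k + 1) * ‖partialFourierFun Ψ z‖
        = ‖z‖ ^ k * (‖z‖ * ‖partialFourierFun Ψ z‖) := by ring
      _ ≤ ‖z‖ ^ k * ((‖z.1‖ + ‖z.2‖) * ‖partialFourierFun Ψ z‖) := by gcongr
      _ = ‖z‖ ^ k * (‖z.1‖ * ‖partialFourierFun Ψ z‖) +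
          ‖z‖ ^ k * (‖z.2‖ * ‖partialFourierFun Ψ z‖) := by ring
      _ ≤ ‖z‖ ^ k * ‖partialFourierFun Ψ₁ z‖ + ‖z‖ ^ k * ‖partialFourierFun Ψ₂ z‖ := by
          rw [h1]
          gcongr
          exact h2 z
      _ ≤ C₁ + C₂ := add_le_add (hC₁ z) (hC₂ z)

theorem decay_iteratedFDeriv_partialFourierFun (k n : ℕ) :
    ∀ {V : Type} [NormedAddCommGroup V] [NormedSpace ℂ V] [CompleteSpace V] (Ψ : 𝓢(E × E, V)),
      ∃ C, ∀ z, ‖z‖ ^ k * ‖iteratedFDeriv ℝ n (partialFourierFun Ψ) z‖ ≤ C := by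
  induction n with
  | zero =>
    intro V _ _ _ Ψ
    simpa using decay_partialFourierFun k Ψ
  | succ n ih =>
    intro V _ _ _ Ψ
    obtain ⟨C, hC⟩ := ih (V := E × E →L[ℝ] V) (derivSymbol Ψ)
    refine ⟨C, fun z => ?_⟩
    have : fderiv ℝ (partialFourierFun Ψ) = partialFourierFun (derivSymbol Ψ) := by
      ext1 w
      exact (hasFDerivAt_partialFourierFun Ψ w).fderiv
    rw [← norm_iteratedFDeriv_fderiv, this]
    exact hC z

/-- The partial Fourier transform in the second variable,
`(F₂ Ψ)(x, ω) = ∫ exp (-2 π i y·ω) Ψ (x, y) dy`, on the Schwartz space. -/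
def partialFourier (Ψ : 𝓢(E × E, ℂ)) : 𝓢(E × E, ℂ) where
  toFun := partialFourierFun Ψ
  smooth' := contDiff_infty.2 fun n => contDiff_partialFourierFun n Ψ
  decay' k n := decay_iteratedFDeriv_partialFourierFun k n Ψ

end PartialFourier

section MatrixWigner

variable {d : ℕ}

/-- `ℝ^d` with its Euclidean structure. -/
abbrev Rd (d : ℕ) : Type := EuclideanSpace ℝ (Fin d)

/-- `ℝ^{2d}` with its Euclidean structure; the coordinates `Sum.inl` are those of `x`, and the
coordinates `Sum.inr` are those of `ω` in `z = (x, ω)`. -/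
abbrev R2d (d : ℕ) : Type := EuclideanSpace ℝ (Fin d ⊕ Fin d)

/-- The linear isomorphism of `ℝ^{2d}` given by an invertible matrix. -/
def matrixEquiv (A : GL (Fin d ⊕ Fin d) ℝ) : R2d d ≃L[ℝ] R2d d :=
  ContinuousLinearEquiv.equivOfInverse
    (Matrix.toEuclideanCLM (n := Fin d ⊕ Fin d) (𝕜 := ℝ) A.val)
    (Matrix.toEuclideanCLM (n := Fin d ⊕ Fin d) (𝕜 := ℝ) A.inv)
    (fun z => by rw [← mul_apply_eq_comp, ← map_mul, A.inv_val, map_one]; rfl)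
    (fun z => by rw [← mul_apply_eq_comp, ← map_mul, A.val_inv, map_one]; rfl)

/-- The matrix-Wigner distribution `B_A(f, g) = F₂ T_A (f ⊗ conj g)`, where
`T_A F (z) = F (A z)` and `F₂` is the partial Fourier transform in the second variable. -/
def matrixWigner (A : GL (Fin d ⊕ Fin d) ℝ) (f g : 𝓢(Rd d, ℂ)) : 𝓢(R2d d, ℂ) :=
  SchwartzMap.compCLMOfContinuousLinearEquiv ℂ EuclideanSpace.sumEquivProd
    (partialFourier (SchwartzMap.compCLMOfContinuousLinearEquiv ℂ
      ((EuclideanSpace.sumEquivProd.symm.trans (matrixEquiv A)).trans EuclideanSpace.sumEquivProd)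
      (tensor f (conjSchwartz g))))

/-- The component `x` of `z = (x, ω)`. -/
def fstPart (z : R2d d) : Rd d := WithLp.toLp 2 fun i => z (Sum.inl i)

/-- The component `ω` of `z = (x, ω)`. -/
def sndPart (z : R2d d) : Rd d := WithLp.toLp 2 fun i => z (Sum.inr i)

theorem matrixEquiv_parts (A : GL (Fin d ⊕ Fin d) ℝ) (x y : Rd d) :
    EuclideanSpace.sumEquivProd (matrixEquiv A (EuclideanSpace.sumEquivProd.symm (x, y))) =
      (Matrix.toEuclideanLin A.val.toBlocks₁₁ x + Matrix.toEuclideanLin A.val.toBlocks₁₂ y,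
        Matrix.toEuclideanLin A.val.toBlocks₂₁ x + Matrix.toEuclideanLin A.val.toBlocks₂₂ y) := by
  have h : ∀ k : Fin d ⊕ Fin d,
      (matrixEquiv A (EuclideanSpace.sumEquivProd.symm (x, y))) k =
        (∑ j, A.val k (Sum.inl j) * x j) + ∑ j, A.val k (Sum.inr j) * y j := by
    intro k
    change (A.val.mulVec (EuclideanSpace.sumEquivProd.symm (x, y)).ofLp) k = _
    simp only [Matrix.mulVec, dotProduct, Fintype.sum_sum_type]
    rfl
  refine Prod.ext ?_ ?_
  · ext i
    exact h (Sum.inl i)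
  · ext i
    exact h (Sum.inr i)

/-- The explicit formula
`B_A(f, g)(x, ω) = ∫ exp (-2 π i y·ω) f (A₁₁ x + A₁₂ y) conj (g (A₂₁ x + A₂₂ y)) dy`. -/
theorem matrixWigner_apply (A : GL (Fin d ⊕ Fin d) ℝ) (f g : 𝓢(Rd d, ℂ)) (z : R2d d) :
    matrixWigner A f g z = ∫ y : Rd d,
      Complex.exp (-(2 * Real.pi * Complex.I * (inner ℝ y (sndPart z) : ℝ))) *
        (f (Matrix.toEuclideanLin A.val.toBlocks₁₁ (fstPart z) +
            Matrix.toEuclideanLin A.val.toBlocks₁₂ y) *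
          conj (g (Matrix.toEuclideanLin A.val.toBlocks₂₁ (fstPart z) +
            Matrix.toEuclideanLin A.val.toBlocks₂₂ y))) := by
  change partialFourierFun _ (EuclideanSpace.sumEquivProd z) = _
  rw [partialFourierFun]
  congr 1
  ext y
  have h := matrixEquiv_parts A (fstPart z) y
  have h1 := congrArg Prod.fst h
  have h2 := congrArg Prod.snd h
  simp only at h1 h2
  rw [← h1, ← h2]
  rfl

/-- The Cohen-type matrix `A_T`, with blocks `I, T` in the first row and `I, -(I - T)` in the
second row. -/
def cohenMatrix (T : Matrix (Fin d) (Fin d) ℝ) : GL (Fin d ⊕ Fin d) ℝ where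
  val := Matrix.fromBlocks 1 T 1 (-(1 - T))
  inv := Matrix.fromBlocks (1 - T) T 1 (-1)
  val_inv := by simp [Matrix.fromBlocks_multiply]
  inv_val := by
    have h : (1 - T) * T + T * (T - 1) = 0 := by noncomm_ring
    simp [Matrix.fromBlocks_multiply, h]

/-- The defining property of `u = op_A(σ) f`, for a Schwartz function `f`:
`⟨op_A(σ) f, g⟩ = ⟨σ, B_A(g, f)⟩` for all Schwartz functions `g`. -/
def IsPseudoDiff (A : GL (Fin d ⊕ Fin d) ℝ) (σ : 𝓢'(R2d d, ℂ)) (f : 𝓢(Rd d, ℂ))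
    (u : 𝓢'(Rd d, ℂ)) : Prop :=
  ∀ g : 𝓢(Rd d, ℂ), bracket u g = bracket σ (matrixWigner A g f)

end MatrixWigner

end MatrixWigner

end

/-! The operator is studied on phase space. Write `W(φ, f)` for the Cohen-type Wigner distribution.
By the inversion formula `integral_stft_mul_stftDual` on `ℝ^{2d}`, `⟨σ, W(φ, f)⟩` is an integral of
`V_G σ` against the short-time Fourier transform of `W(φ, f)` with window `W(g, g)`. By covariance
(`cohenWigner_timeFreqShift`) every shift of `W(g, g)` is, up to a phase, `W(π(w)g, π(z)g)`, so the
orthogonality relations (`exists_moyal`) split that transform into a factor `V_g f(z)` and a factor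
depending on `φ` and `w`. After the linear change of variables from the shift `(P, Q)` to `(z, w)`,
`op_A(σ)` becomes an integral operator whose kernel `k(z, w)` is a bounded factor times `V_G σ(P,
Q)`.

The decisive point is that `Q` is a symplectic rotation of `w - z`, whatever `T` is; `T` enters only
`P` and the phases. Taking the supremum over `P` gives `|k(z, w)| ≤ H(w - z)`, with `∫ H` a constant
multiple of the `M^{∞,1}` norm of `σ` (`exists_phaseSpace_kernel`). The given window `G` may be
orthogonal to `W(g, g)`, so the latter is first shifted to avoid this.

Consequently `|V_g(Lu)|` is at most an average of translates of `|V_g u|`, with total mass `∫ H`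
times the `L^1` norm of `V_g g`. Minkowski's inequality in each variable (`eLpNorm_lintegral_le`)
and translation invariance bound every mixed norm, uniformly in `p` and `q`.

At the endpoints Schwartz functions need not be norm dense, so `L` is not built by extension:
`exists_kernelOperator` defines it on the whole space by the kernel pairing, which converges because
`V_g u` is bounded. For weak continuity, the pairing cut off to bounded `z` is the evaluation of `u`
at one fixed Schwartz function, since distributions commute with Schwartz-valued integrals
(`apply_schwartzIntegral`), and the remainder is small uniformly on norm-bounded sets. -/

open MeasureTheory
open scoped SchwartzMap FourierTransform ENNReal NNReal ComplexConjugate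

noncomputable section
namespace MatrixWigner

/-! ### Integrals of families of Schwartz functions -/

section SchwartzIntegral

variable {V : Type*} [NormedAddCommGroup V] [NormedSpace ℝ V]

variable (V) in
/-- The fibre of the bundle of `n`-th derivatives of complex functions on `V`. -/
def JetFiber (n : ℕ) : Type _ := V [×n]→L[ℝ] ℂ

instance (n : ℕ) : NormedAddCommGroup (JetFiber V n) :=
  inferInstanceAs (NormedAddCommGroup (V [×n]→L[ℝ] ℂ))

/-- Derivatives are real-multilinear, but their values are complex. This complex structure makes
`weightedDeriv` complex linear, so that Hahn–Banach over `ℂ` applies to it. -/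
instance (n : ℕ) : NormedSpace ℂ (JetFiber V n) :=
  inferInstanceAs (NormedSpace ℂ (V [×n]→L[ℝ] ℂ))

instance (n : ℕ) : CompleteSpace (JetFiber V n) :=
  inferInstanceAs (CompleteSpace (V [×n]→L[ℝ] ℂ))

/-- The `n`-th derivative, with values in `JetFiber V n`. -/
def jet (n : ℕ) (φ : 𝓢(V, ℂ)) (x : V) : JetFiber V n := iteratedFDeriv ℝ n φ x

theorem norm_jet (n : ℕ) (φ : 𝓢(V, ℂ)) (x : V) : ‖jet n φ x‖ = ‖iteratedFDeriv ℝ n φ x‖ := rfl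

theorem jet_add (n : ℕ) (φ ψ : 𝓢(V, ℂ)) (x : V) : jet n (φ + ψ) x = jet n φ x + jet n ψ x :=
  iteratedFDeriv_add_apply (φ.smooth n).contDiffAt (ψ.smooth n).contDiffAt

theorem jet_smul (n : ℕ) (a : ℂ) (φ : 𝓢(V, ℂ)) (x : V) : jet n (a • φ) x = a • jet n φ x :=
  iteratedFDeriv_const_smul_apply (φ.smooth n).contDiffAt

theorem continuous_jet (n : ℕ) (φ : 𝓢(V, ℂ)) : Continuous (jet n φ) :=
  (φ.smooth n).continuous_iteratedFDeriv le_rfl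

/-- The weighted iterated derivative `x ↦ ‖x‖ ^ k • D^n φ x` of a Schwartz function, as a bounded
continuous function. -/
def weightedDeriv (k n : ℕ) : 𝓢(V, ℂ) →L[ℂ] BoundedContinuousFunction V (JetFiber V n) :=
  SchwartzMap.mkCLMtoNormedSpace
    (fun φ => BoundedContinuousFunction.ofNormedAddCommGroup
      (fun x => ((‖x‖ ^ k : ℝ) : ℂ) • jet n φ x)
      (by have := continuous_jet n φ; fun_prop)
      (SchwartzMap.seminorm ℂ k n φ)
      fun x => by
        rw [norm_smul, Complex.norm_real, norm_pow, norm_norm]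
        exact φ.le_seminorm ℂ k n x)
    (fun φ ψ => by
      ext1 x
      exact (congrArg _ (jet_add n φ ψ x)).trans (smul_add _ _ _))
    (fun a φ => by
      ext1 x
      exact (congrArg _ (jet_smul n a φ x)).trans (smul_comm _ _ _))
    ⟨{(k, n)}, 1, zero_le_one, fun φ => by
      rw [Finset.sup_singleton, one_mul]
      exact BoundedContinuousFunction.norm_ofNormedAddCommGroup_le _ (apply_nonneg _ _) _⟩

theorem weightedDeriv_apply (k n : ℕ) (φ : 𝓢(V, ℂ)) (x : V) :
    weightedDeriv k n φ x = ((‖x‖ ^ k : ℝ) : ℂ) • jet n φ x := rfl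

theorem norm_weightedDeriv_apply (k n : ℕ) (φ : 𝓢(V, ℂ)) (x : V) :
    ‖weightedDeriv k n φ x‖ = ‖x‖ ^ k * ‖iteratedFDeriv ℝ n φ x‖ := by
  rw [weightedDeriv_apply, norm_smul, Complex.norm_real, norm_pow, norm_norm, norm_jet]

/-- The Schwartz topology is thus the one induced by these maps into Banach spaces, where the
Bochner integral is available. -/
theorem norm_weightedDeriv (k n : ℕ) (φ : 𝓢(V, ℂ)) :
    ‖weightedDeriv k n φ‖ = SchwartzMap.seminorm ℝ k n φ := by
  refine le_antisymm ?_ (SchwartzMap.seminorm_le_bound ℝ k n φ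
    (norm_nonneg (weightedDeriv k n φ)) fun x => ?_)
  · refine (BoundedContinuousFunction.norm_le (apply_nonneg _ _)).2 fun x => ?_
    rw [norm_weightedDeriv_apply]
    exact φ.le_seminorm ℝ k n x
  · have := (weightedDeriv k n φ).norm_coe_le_norm x
    rwa [norm_weightedDeriv_apply] at this

variable {X : Type*} [MeasurableSpace X] {μ : Measure X} {F : X → 𝓢(V, ℂ)}

theorem integrable_weightedDeriv (hF : AEStronglyMeasurable F μ)
    (hint : ∀ k n, Integrable (fun x => SchwartzMap.seminorm ℝ k n (F x)) μ) (k n : ℕ) :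
    Integrable (fun x => weightedDeriv k n (F x)) μ :=
  (hint k n).mono' ((weightedDeriv k n).continuous.comp_aestronglyMeasurable hF)
    (Filter.Eventually.of_forall fun x => (norm_weightedDeriv k n (F x)).le)

theorem integrable_jet (hF : AEStronglyMeasurable F μ)
    (hint : ∀ k n, Integrable (fun x => SchwartzMap.seminorm ℝ k n (F x)) μ) (n : ℕ) (t : V) :
    Integrable (fun x => jet n (F x) t) μ := by
  -- With weight exponent `0` the factor is `1`, so evaluation at `t` returns the jet itself.
  have h := (BoundedContinuousFunction.evalCLM ℂ t).integrable_comp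
    (integrable_weightedDeriv hF hint 0 n)
  refine h.congr (Filter.Eventually.of_forall fun x => ?_)
  change ((‖t‖ ^ 0 : ℝ) : ℂ) • jet n (F x) t = _
  rw [pow_zero, Complex.ofReal_one, one_smul]

/-- Differentiation under the integral sign: the seminorm of order `(0, n + 1)` dominates the next
derivative at all points at once, and is integrable by assumption. -/
theorem hasFDerivAt_integral_iteratedFDeriv (hF : AEStronglyMeasurable F μ)
    (hint : ∀ k n, Integrable (fun x => SchwartzMap.seminorm ℝ k n (F x)) μ) (n : ℕ) (t : V) :
    HasFDerivAt (fun t => ∫ x, iteratedFDeriv ℝ n (F x) t ∂μ)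
      (∫ x, fderiv ℝ (iteratedFDeriv ℝ n (F x)) t ∂μ) t := by
  have hI := fun t => integrable_jet hF hint n t
  have hfd : ∀ x t, fderiv ℝ (iteratedFDeriv ℝ n (F x)) t =
      continuousMultilinearCurryLeftEquiv ℝ (fun _ : Fin (n + 1) => V) ℂ
        (iteratedFDeriv ℝ (n + 1) (F x) t) := by
    intro x t
    rw [iteratedFDeriv_succ_eq_comp_left]
    simp
  refine hasFDerivAt_integral_of_dominated_of_fderiv_le (𝕜 := ℝ) (s := Set.univ)
    (F := fun t x => iteratedFDeriv ℝ n (F x) t)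
    (F' := fun t x => fderiv ℝ (iteratedFDeriv ℝ n (F x)) t)
    (bound := fun x => SchwartzMap.seminorm ℝ 0 (n + 1) (F x)) Filter.univ_mem
    (Filter.Eventually.of_forall fun t => (hI t).1) (hI t) ?_ ?_ (hint 0 (n + 1)) ?_
  · simp_rw [hfd]
    exact (continuousMultilinearCurryLeftEquiv ℝ (fun _ : Fin (n + 1) =>
      V) ℂ).continuous.comp_aestronglyMeasurable (integrable_jet hF hint (n + 1) t).1
  · refine Filter.Eventually.of_forall fun x t _ => ?_
    rw [norm_fderiv_iteratedFDeriv]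
    exact (F x).norm_iteratedFDeriv_le_seminorm ℝ (n + 1) t
  · refine Filter.Eventually.of_forall fun x t _ => ?_
    exact (((F x).smooth ⊤).differentiable_iteratedFDeriv
      (by exact_mod_cast WithTop.coe_lt_top (n : ℕ)) t).hasFDerivAt

theorem iteratedFDeriv_integral (hF : AEStronglyMeasurable F μ)
    (hint : ∀ k n, Integrable (fun x => SchwartzMap.seminorm ℝ k n (F x)) μ) (n : ℕ) :
    iteratedFDeriv ℝ n (fun t => ∫ x, F x t ∂μ) =
      fun t => ∫ x, iteratedFDeriv ℝ n (F x) t ∂μ := by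
  induction n with
  | zero =>
    ext1 t
    have h := (continuousMultilinearCurryFin0 ℝ V ℂ).symm.toLinearIsometry.integral_comp_comm
      (μ := μ) (fun x => F x t)
    exact h.symm
  | succ n ih =>
    ext1 t
    rw [iteratedFDeriv_succ_eq_comp_left, ih, Function.comp_apply,
      (hasFDerivAt_integral_iteratedFDeriv hF hint n t).fderiv]
    -- Currying is a linear isometry and therefore commutes with the integral.
    let e := (continuousMultilinearCurryLeftEquiv ℝ (fun _ : Fin (n + 1) => V) ℂ).symm
    have h := LinearIsometry.integral_comp_comm (𝕜 := ℝ) (E := V →L[ℝ] V [×n]→L[ℝ] ℂ)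
      (F := V [×(n + 1)]→L[ℝ] ℂ) e.toLinearIsometry
      (μ := μ) (fun x => fderiv ℝ (iteratedFDeriv ℝ n (F x)) t)
    exact h.symm

/-- The integral of an integrable family of Schwartz functions. -/
def schwartzIntegral (hF : AEStronglyMeasurable F μ)
    (hint : ∀ k n, Integrable (fun x => SchwartzMap.seminorm ℝ k n (F x)) μ) : 𝓢(V, ℂ) where
  toFun t := ∫ x, F x t ∂μ
  smooth' := by
    refine contDiff_of_differentiable_iteratedFDeriv fun n _ => ?_
    rw [iteratedFDeriv_integral hF hint]
    exact fun t => (hasFDerivAt_integral_iteratedFDeriv hF hint n t).differentiableAt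
  decay' k n := by
    refine ⟨∫ x, SchwartzMap.seminorm ℝ k n (F x) ∂μ, fun t => ?_⟩
    rw [iteratedFDeriv_integral hF hint]
    calc ‖t‖ ^ k * ‖∫ x, iteratedFDeriv ℝ n (F x) t ∂μ‖
        = ‖∫ x, ‖t‖ ^ k • iteratedFDeriv ℝ n (F x) t ∂μ‖ := by
          rw [integral_smul, norm_smul, norm_pow, norm_norm]
      _ ≤ _ := by
          refine norm_integral_le_of_norm_le (hint k n) (Filter.Eventually.of_forall fun x => ?_)
          rw [norm_smul, norm_pow, norm_norm]
          exact (F x).le_seminorm ℝ k n t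

theorem schwartzIntegral_apply (hF : AEStronglyMeasurable F μ)
    (hint : ∀ k n, Integrable (fun x => SchwartzMap.seminorm ℝ k n (F x)) μ) (t : V) :
    schwartzIntegral hF hint t = ∫ x, F x t ∂μ := rfl

/-- The right side is a Bochner integral of bounded continuous functions. Evaluations are continuous
and linear, so the identity can be tested pointwise, where it is differentiation under the integral.
-/
theorem weightedDeriv_schwartzIntegral (hF : AEStronglyMeasurable F μ)
    (hint : ∀ k n, Integrable (fun x => SchwartzMap.seminorm ℝ k n (F x)) μ) (k n : ℕ) :
    weightedDeriv k n (schwartzIntegral hF hint) = ∫ x, weightedDeriv k n (F x) ∂μ := by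
  ext1 t
  have h := (BoundedContinuousFunction.evalCLM ℂ t).integral_comp_comm
    (integrable_weightedDeriv hF hint k n)
  refine Eq.trans ?_ h
  change ((‖t‖ ^ k : ℝ) : ℂ) • jet n (schwartzIntegral hF hint) t =
    ∫ x, ((‖t‖ ^ k : ℝ) : ℂ) • jet n (F x) t ∂μ
  rw [integral_smul]
  exact congrArg _ (congrFun (iteratedFDeriv_integral hF hint n) t)

/-- A continuous linear functional on the Schwartz space factors through finitely many weighted
derivatives. -/
theorem exists_factor_weightedDeriv (u : 𝓢'(V, ℂ)) : ∃ s : Finset (ℕ × ℕ),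
    ∃ L : (∀ m : s, BoundedContinuousFunction V (JetFiber V m.1.2)) →L[ℂ] ℂ,
      ∀ φ, u φ = L fun m => weightedDeriv m.1.1 m.1.2 φ := by
  -- Continuity of `u` means a bound by finitely many Schwartz seminorms; their indices form `s`.
  obtain ⟨s, C, hC, hb⟩ := Seminorm.bound_of_continuous (schwartz_withSeminorms ℂ V ℂ)
    ((normSeminorm ℂ ℂ).comp (u : 𝓢(V, ℂ) →ₗ[ℂ] ℂ))
    (continuous_norm.comp (ContinuousLinearMap.continuous (M₁ := 𝓢(V, ℂ)) (M₂ := ℂ) u))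
  refine ⟨s, ?_⟩
  let J : 𝓢(V, ℂ) →ₗ[ℂ] (∀ m : s, BoundedContinuousFunction V (JetFiber V m.1.2)) :=
    LinearMap.pi fun m => (weightedDeriv (V := V) m.1.1 m.1.2).toLinearMap
  have hJ : ∀ φ, ‖u φ‖ ≤ C * ‖J φ‖ := by
    intro φ
    refine (hb φ).trans ?_
    change (C : ℝ) * s.sup (schwartzSeminormFamily ℂ V ℂ) φ ≤ C * ‖J φ‖
    refine mul_le_mul_of_nonneg_left ?_ C.2
    refine Seminorm.finset_sup_apply_le (norm_nonneg _) fun m hm => ?_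
    have := norm_le_pi_norm (J φ) ⟨m, hm⟩
    refine le_trans (le_of_eq ?_) this
    exact (norm_weightedDeriv m.1 m.2 φ).symm
  have hker : LinearMap.ker J ≤ LinearMap.ker (u : 𝓢(V, ℂ) →ₗ[ℂ] ℂ) := by
    intro φ hφ
    have h := hJ φ
    rw [LinearMap.mem_ker.1 hφ, norm_zero, mul_zero] at h
    exact norm_le_zero_iff.1 h
  -- The bound shows that `u` vanishes on the kernel of `J`, so it descends to a bounded functional
  -- on the range of `J`, which Hahn–Banach then extends to the whole product.
  let f₀ : LinearMap.range J →ₗ[ℂ] ℂ :=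
    ((LinearMap.ker J).liftQ (u : 𝓢(V, ℂ) →ₗ[ℂ] ℂ) hker).comp
      (J.quotKerEquivRange.symm : LinearMap.range J →ₗ[ℂ] _)
  have hf₀ : ∀ φ, f₀ ⟨J φ, LinearMap.mem_range_self J φ⟩ = u φ := by
    intro φ
    have : J.quotKerEquivRange.symm ⟨J φ, LinearMap.mem_range_self J φ⟩ =
        (LinearMap.ker J).mkQ φ := J.quotKerEquivRange_symm_apply_image φ _
    change ((LinearMap.ker J).liftQ (u : 𝓢(V, ℂ) →ₗ[ℂ] ℂ) hker) (J.quotKerEquivRange.symm _) = _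
    rw [this]
    rfl
  let f : StrongDual ℂ (LinearMap.range J) := f₀.mkContinuous C (by
    rintro ⟨_, φ, rfl⟩
    rw [hf₀]
    exact hJ φ)
  obtain ⟨L, hL, _⟩ := exists_extension_norm_eq (LinearMap.range J) f
  exact ⟨L, fun φ => ((hL ⟨J φ, LinearMap.mem_range_self J φ⟩).trans (hf₀ φ)).symm⟩

/-- A tempered distribution commutes with integrals of Schwartz functions. -/
theorem apply_schwartzIntegral (hF : AEStronglyMeasurable F μ)
    (hint : ∀ k n, Integrable (fun x => SchwartzMap.seminorm ℝ k n (F x)) μ) (u : 𝓢'(V, ℂ)) :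
    u (schwartzIntegral hF hint) = ∫ x, u (F x) ∂μ := by
  obtain ⟨s, L, hL⟩ := exists_factor_weightedDeriv u
  -- After factoring, the claim is about a continuous functional on a Banach space, which commutes
  -- with the Bochner integral.
  have hI : Integrable (fun x => fun m : s => weightedDeriv m.1.1 m.1.2 (F x)) μ :=
    Integrable.of_eval fun m => integrable_weightedDeriv hF hint m.1.1 m.1.2
  simp_rw [hL]
  rw [L.integral_comp_comm hI]
  congr 1
  ext1 m
  rw [eval_integral fun m => integrable_weightedDeriv hF hint m.1.1 m.1.2,
    weightedDeriv_schwartzIntegral]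

end SchwartzIntegral

/-! ### Seminorms of time-frequency shifts and decay of short-time Fourier transforms -/

section TimeFrequency

/-- Submultiplicativity of the weight, by which polynomial factors are exchanged between `t`, `x`
and `t - x`. -/
theorem one_add_norm_le_mul {V : Type*} [NormedAddCommGroup V] (t x : V) :
    1 + ‖t‖ ≤ (1 + ‖x‖) * (1 + ‖t - x‖) := by
  have : ‖t‖ ≤ ‖x‖ + ‖t - x‖ := by
    calc ‖t‖ = ‖x + (t - x)‖ := by congr 1; abel
      _ ≤ _ := norm_add_le _ _
  nlinarith [norm_nonneg x, norm_nonneg (t - x)]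

theorem one_add_norm_le_mul' {V : Type*} [NormedAddCommGroup V] (t x : V) :
    1 + ‖x‖ ≤ (1 + ‖t‖) * (1 + ‖t - x‖) := by
  have := one_add_norm_le_mul x t
  rwa [norm_sub_rev] at this

variable {V : Type*} [NormedAddCommGroup V] [InnerProductSpace ℝ V]

/-- A weighted sum of Schwartz seminorms, controlling `(1 + ‖x‖) ^ k * ‖D^n φ x‖`
for `(k, n) ≤ m`. -/
def seminormSum (m : ℕ × ℕ) (φ : 𝓢(V, ℂ)) : ℝ :=
  2 ^ m.1 * ∑ i ∈ Finset.Iic m, SchwartzMap.seminorm ℝ i.1 i.2 φ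

theorem seminormSum_nonneg (m : ℕ × ℕ) (φ : 𝓢(V, ℂ)) : 0 ≤ seminormSum m φ :=
  mul_nonneg (by positivity) (Finset.sum_nonneg fun _ _ => apply_nonneg _ _)

theorem seminormSum_zero (m : ℕ × ℕ) : seminormSum m (0 : 𝓢(V, ℂ)) = 0 := by
  simp [seminormSum]

theorem continuous_seminormSum (m : ℕ × ℕ) : Continuous (seminormSum m : 𝓢(V, ℂ) → ℝ) :=
  continuous_const.mul (continuous_finsetSum _ fun i _ =>
    (schwartz_withSeminorms ℝ V ℂ).continuous_seminorm i)

theorem one_add_norm_pow_mul_le_seminormSum {m : ℕ × ℕ} {k n : ℕ} (hk : k ≤ m.1) (hn : n ≤ m.2)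
    (φ : 𝓢(V, ℂ)) (x : V) :
    (1 + ‖x‖) ^ k * ‖iteratedFDeriv ℝ n φ x‖ ≤ seminormSum m φ := by
  refine (SchwartzMap.one_add_le_sup_seminorm_apply (𝕜 := ℝ) hk hn φ x).trans ?_
  refine mul_le_mul_of_nonneg_left ?_ (by positivity)
  refine Seminorm.finset_sup_apply_le (Finset.sum_nonneg fun _ _ => apply_nonneg _ _) fun i hi => ?_
  exact Finset.single_le_sum (f := fun i : ℕ × ℕ => SchwartzMap.seminorm ℝ i.1 i.2 φ)
    (fun _ _ => apply_nonneg _ _) hi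

/-- The character is `s ↦ exp (2πis)` composed with a linear form of norm `‖ω‖`; each derivative
contributes one factor `2π` and one copy of the form. -/
theorem norm_iteratedFDeriv_character_le (ω : V) (n : ℕ) (t : V) :
    ‖iteratedFDeriv ℝ n (character ω) t‖ ≤ (2 * Real.pi * ‖ω‖) ^ n := by
  have hsm : ContDiff ℝ (⊤ : ℕ∞) (fun s : ℝ => Complex.exp (2 * Real.pi * Complex.I * s)) :=
    hasTemperateGrowth_expI.1
  have hd : ∀ n, iteratedDeriv n (fun t : ℝ => Complex.exp (2 * Real.pi * Complex.I * t)) =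
      fun t : ℝ => (2 * Real.pi * Complex.I) ^ n * Complex.exp (2 * Real.pi * Complex.I * t) := by
    intro n
    induction n with
    | zero => simp
    | succ k ih =>
      rw [iteratedDeriv_succ, ih]
      ext t
      have h1 : HasDerivAt (fun t : ℝ => Complex.exp (2 * Real.pi * Complex.I * t))
          (Complex.exp (2 * Real.pi * Complex.I * t) * (2 * Real.pi * Complex.I)) t := by
        have := (((hasDerivAt_id (t : ℂ)).const_mul (2 * Real.pi * Complex.I)).cexp).comp_ofReal
        simpa using this
      rw [(h1.const_mul _).deriv]
      ring
  have h := (innerSL ℝ ω).iteratedFDeriv_comp_right hsm t (i := n) (by exact_mod_cast le_top)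
  have hc : character ω = (fun s : ℝ => Complex.exp (2 * Real.pi * Complex.I * s)) ∘
      (innerSL ℝ ω) := by
    ext t
    simp [character, real_inner_comm]
  rw [hc, h]
  refine (ContinuousMultilinearMap.norm_compContinuousLinearMap_le _ _).trans ?_
  rw [norm_iteratedFDeriv_eq_norm_iteratedDeriv, hd, Finset.prod_const, Finset.card_univ,
    Fintype.card_fin, innerSL_apply_norm, mul_pow (2 * Real.pi)]
  have : ‖Complex.exp (2 * Real.pi * Complex.I * ((innerSL ℝ ω t : ℝ) : ℂ))‖ = 1 := by
    rw [Complex.norm_exp]; simp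
  rw [norm_mul, this]
  simp [abs_of_pos Real.pi_pos]

theorem iteratedFDeriv_translate (φ : 𝓢(V, ℂ)) (x t : V) (n : ℕ) :
    iteratedFDeriv ℝ n (φ.compSubConstCLM ℂ x) t = iteratedFDeriv ℝ n φ (t - x) :=
  iteratedFDeriv_comp_sub _ _ _

/-- By Leibniz, derivatives of the character cost powers of `ω`, and recentring the weight costs
powers of `x`. The growth is only polynomial, so rapidly decaying superpositions of shifts converge
in the Schwartz space. -/
theorem seminorm_timeFreqShift_le (φ : 𝓢(V, ℂ)) (k n : ℕ) : ∃ C : ℝ, 0 ≤ C ∧ ∀ x ω : V,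
    SchwartzMap.seminorm ℝ k n (timeFreqShift x ω φ) ≤ C * ((1 + ‖x‖) ^ k * (1 + ‖ω‖) ^ n) := by
  refine ⟨∑ i ∈ Finset.range (n + 1), (n.choose i : ℝ) * (2 * Real.pi) ^ i * seminormSum (k, n) φ,
    Finset.sum_nonneg fun i _ => by have := seminormSum_nonneg (k, n) φ; positivity,
    fun x ω => ?_⟩
  have h0 := seminormSum_nonneg (k, n) φ
  refine SchwartzMap.seminorm_le_bound ℝ k n _ (mul_nonneg (Finset.sum_nonneg fun i _ => by
    positivity) (by positivity)) fun t => ?_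
  have hco : ⇑(timeFreqShift x ω φ) = fun t => character ω t * (φ.compSubConstCLM ℂ x) t := by
    ext t
    rw [timeFreqShift_apply]
    rfl
  rw [hco]
  have h1 := norm_iteratedFDeriv_mul_le (𝕜 := ℝ) (N := (⊤ : ℕ∞)) (n := n)
    (f := character ω) (g := φ.compSubConstCLM ℂ x)
    (hasTemperateGrowth_character ω).1 ((φ.compSubConstCLM ℂ x).smooth ⊤) t
    (by exact_mod_cast le_top)
  refine (mul_le_mul_of_nonneg_left h1 (by positivity)).trans ?_
  rw [Finset.mul_sum, Finset.sum_mul]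
  refine Finset.sum_le_sum fun i hi => ?_
  have hin : i ≤ n := Nat.lt_succ_iff.1 (Finset.mem_range.1 hi)
  rw [iteratedFDeriv_translate]
  have h2 := one_add_norm_pow_mul_le_seminormSum (m := (k, n)) (k := k) (n := n - i) le_rfl
    (Nat.sub_le n i) φ (t - x)
  have h3 : ‖t‖ ^ k ≤ (1 + ‖x‖) ^ k * (1 + ‖t - x‖) ^ k := by
    rw [← mul_pow]
    gcongr
    linarith [one_add_norm_le_mul t x]
  have h4 : (2 * Real.pi * ‖ω‖) ^ i ≤ (2 * Real.pi) ^ i * (1 + ‖ω‖) ^ n := by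
    rw [mul_pow]
    gcongr
    calc ‖ω‖ ^ i ≤ (1 + ‖ω‖) ^ i := by gcongr; linarith
      _ ≤ (1 + ‖ω‖) ^ n := pow_le_pow_right₀ (by linarith [norm_nonneg ω]) hin
  calc ‖t‖ ^ k * ((n.choose i : ℝ) * ‖iteratedFDeriv ℝ i (character ω) t‖ *
        ‖iteratedFDeriv ℝ (n - i) φ (t - x)‖)
      ≤ ((1 + ‖x‖) ^ k * (1 + ‖t - x‖) ^ k) *
        ((n.choose i : ℝ) * ((2 * Real.pi) ^ i * (1 + ‖ω‖) ^ n) *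
        ‖iteratedFDeriv ℝ (n - i) φ (t - x)‖) := by
        gcongr
        exact (norm_iteratedFDeriv_character_le ω i t).trans h4
    _ = (n.choose i : ℝ) * (2 * Real.pi) ^ i *
        ((1 + ‖t - x‖) ^ k * ‖iteratedFDeriv ℝ (n - i) φ (t - x)‖) *
          ((1 + ‖x‖) ^ k * (1 + ‖ω‖) ^ n) := by ring
    _ ≤ _ := by gcongr

/-- The product `t ↦ g (t - x) * φ t`. -/
def windowed (g : 𝓢(V, ℂ)) (x : V) : 𝓢(V, ℂ) →L[ℂ] 𝓢(V, ℂ) :=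
  SchwartzMap.smulLeftCLM ℂ (g.compSubConstCLM ℂ x)

theorem windowed_apply (g : 𝓢(V, ℂ)) (x : V) (φ : 𝓢(V, ℂ)) (t : V) :
    windowed g x φ t = g (t - x) * φ t := by
  rw [windowed, SchwartzMap.smulLeftCLM_apply_apply (SchwartzMap.hasTemperateGrowth _)]
  rfl

/-- When `x` is large, `t` or `t - x` is large, so `φ(t)` or `g(t - x)` supplies the decay in `x`.
The bound is continuous in `φ` and vanishes at `0`, which later yields continuity of distributions.
-/
theorem seminorm_windowed_le (g : 𝓢(V, ℂ)) (N k n : ℕ) : ∃ q : 𝓢(V, ℂ) → ℝ,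
    Continuous q ∧ q 0 = 0 ∧ ∀ φ x,
      (1 + ‖x‖) ^ N * SchwartzMap.seminorm ℝ k n (windowed g x φ) ≤ q φ := by
  refine ⟨fun φ => (∑ i ∈ Finset.range (n + 1), (n.choose i : ℝ) * seminormSum (N, n) g) *
    seminormSum (N + k, n) φ, continuous_const.mul (continuous_seminormSum _),
    by simp [seminormSum_zero], fun φ x => ?_⟩
  have h0 := seminormSum_nonneg (N, n) g
  have h0' := seminormSum_nonneg (N + k, n) φ
  rw [mul_comm, ← le_div_iff₀ (by positivity)]
  refine SchwartzMap.seminorm_le_bound ℝ k n _ (div_nonneg (mul_nonneg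
    (Finset.sum_nonneg fun i _ => by positivity) h0') (by positivity)) fun t => ?_
  rw [le_div_iff₀ (by positivity)]
  have hco : ⇑(windowed g x φ) = fun t => (g.compSubConstCLM ℂ x) t * φ t := by
    ext t
    rw [windowed_apply]
    rfl
  rw [hco]
  have h1 := norm_iteratedFDeriv_mul_le (𝕜 := ℝ) (N := (⊤ : ℕ∞)) (n := n)
    (f := g.compSubConstCLM ℂ x) (g := φ) ((g.compSubConstCLM ℂ x).smooth ⊤)
    (φ.smooth ⊤) t (by exact_mod_cast le_top)
  refine (mul_le_mul_of_nonneg_right (mul_le_mul_of_nonneg_left h1 (by positivity))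
    (by positivity)).trans ?_
  beta_reduce
  rw [Finset.mul_sum, Finset.sum_mul, Finset.sum_mul]
  refine Finset.sum_le_sum fun i hi => ?_
  have hin : i ≤ n := Nat.lt_succ_iff.1 (Finset.mem_range.1 hi)
  rw [iteratedFDeriv_translate]
  have h2 := one_add_norm_pow_mul_le_seminormSum (m := (N, n)) (k := N) le_rfl hin g (t - x)
  have h3 := one_add_norm_pow_mul_le_seminormSum (m := (N + k, n)) (k := N + k) (n := n - i) le_rfl
    (Nat.sub_le n i) φ t
  have h4 : (1 + ‖x‖) ^ N ≤ (1 + ‖t‖) ^ N * (1 + ‖t - x‖) ^ N := by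
    rw [← mul_pow]
    gcongr
    exact one_add_norm_le_mul' t x
  have h5 : ‖t‖ ^ k ≤ (1 + ‖t‖) ^ k := by gcongr; linarith
  calc ‖t‖ ^ k * ((n.choose i : ℝ) * ‖iteratedFDeriv ℝ i g (t - x)‖ *
        ‖iteratedFDeriv ℝ (n - i) φ t‖) * (1 + ‖x‖) ^ N
      ≤ (1 + ‖t‖) ^ k * ((n.choose i : ℝ) * ‖iteratedFDeriv ℝ i g (t - x)‖ *
        ‖iteratedFDeriv ℝ (n - i) φ t‖) * ((1 + ‖t‖) ^ N * (1 + ‖t - x‖) ^ N) := by gcongr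
    _ = (n.choose i : ℝ) * ((1 + ‖t - x‖) ^ N * ‖iteratedFDeriv ℝ i g (t - x)‖) *
        ((1 + ‖t‖) ^ (N + k) * ‖iteratedFDeriv ℝ (n - i) φ t‖) := by rw [pow_add]; ring
    _ ≤ _ := by gcongr

/-- Stated for an arbitrary continuous seminorm in order to be applied to Schwartz seminorms of the
inverse Fourier transform. -/
theorem continuous_seminorm_windowed_le (g : 𝓢(V, ℂ)) (N : ℕ) (r : Seminorm ℝ 𝓢(V, ℂ))
    (hr : Continuous r) : ∃ q : 𝓢(V, ℂ) → ℝ, Continuous q ∧ q 0 = 0 ∧ ∀ φ x,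
      (1 + ‖x‖) ^ N * r (windowed g x φ) ≤ q φ := by
  obtain ⟨s, C, _, hb⟩ := Seminorm.bound_of_continuous (schwartz_withSeminorms ℝ V ℂ) r hr
  choose q hq hq0 hle using fun m : ℕ × ℕ => seminorm_windowed_le g N m.1 m.2
  refine ⟨fun φ => C * ∑ m ∈ s, q m φ,
    continuous_const.mul (continuous_finsetSum _ fun m _ => hq m), by simp [hq0], fun φ x => ?_⟩
  calc (1 + ‖x‖) ^ N * r (windowed g x φ)
      ≤ (1 + ‖x‖) ^ N * (C * ∑ m ∈ s, SchwartzMap.seminorm ℝ m.1 m.2 (windowed g x φ)) := by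
        gcongr
        refine (hb _).trans ?_
        change (C : ℝ) * s.sup (schwartzSeminormFamily ℝ V ℂ) _ ≤ _
        gcongr
        refine Seminorm.finset_sup_apply_le (Finset.sum_nonneg fun _ _ => apply_nonneg _ _)
          fun i hi => ?_
        exact Finset.single_le_sum (f := fun i : ℕ × ℕ =>
          SchwartzMap.seminorm ℝ i.1 i.2 (windowed g x φ)) (fun _ _ => apply_nonneg _ _) hi
    _ = C * ∑ m ∈ s, (1 + ‖x‖) ^ N * SchwartzMap.seminorm ℝ m.1 m.2 (windowed g x φ) := by
        rw [Finset.mul_sum, Finset.mul_sum, Finset.mul_sum]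
        exact Finset.sum_congr rfl fun _ _ => by ring
    _ ≤ _ := mul_le_mul_of_nonneg_left (Finset.sum_le_sum fun m _ => hle m φ x) C.2

variable [MeasurableSpace V] [BorelSpace V] [FiniteDimensional ℝ V]

/-- The bilinear pairing `∫ φ(t) (π(x,ω)g)(t) dt`. -/
def stftDual (g φ : 𝓢(V, ℂ)) (x ω : V) : ℂ := ∫ t, φ t * timeFreqShift x ω g t

theorem stftDual_eq_fourierInv (g φ : 𝓢(V, ℂ)) (x ω : V) :
    stftDual g φ x ω = 𝓕⁻ (windowed g x φ) ω := by
  rw [SchwartzMap.fourierInv_coe, Real.fourierInv_eq']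
  refine integral_congr_ae (Filter.Eventually.of_forall fun t => ?_)
  simp only [timeFreqShift_apply, windowed_apply, smul_eq_mul]
  rw [show (((2 * Real.pi * inner ℝ t ω : ℝ) : ℂ) * Complex.I) =
    2 * Real.pi * Complex.I * (inner ℝ t ω : ℝ) by push_cast; ring]
  ring

/-- For fixed `x` the pairing is an inverse Fourier transform in `ω` of the windowed function. Its
Schwartz seminorms give the decay in `ω`, and they decay in `x` by the preceding estimate. -/
theorem stftDual_decay (g : 𝓢(V, ℂ)) (N : ℕ) : ∃ q : 𝓢(V, ℂ) → ℝ, Continuous q ∧ q 0 = 0 ∧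
    ∀ φ x ω, (1 + ‖x‖) ^ N * (1 + ‖ω‖) ^ N * ‖stftDual g φ x ω‖ ≤ q φ := by
  let r : ℕ × ℕ → Seminorm ℝ 𝓢(V, ℂ) := fun i =>
    (SchwartzMap.seminorm ℝ i.1 i.2 : Seminorm ℝ 𝓢(V, ℂ)).comp
      (FourierTransform.fourierInvCLM ℝ 𝓢(V, ℂ)).toLinearMap
  have hr : ∀ i, Continuous (r i) := fun i =>
    ((schwartz_withSeminorms ℝ V ℂ).continuous_seminorm i).comp
      (FourierTransform.fourierInvCLM ℝ 𝓢(V, ℂ)).continuous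
  choose q hq hq0 h using fun i : ℕ × ℕ => continuous_seminorm_windowed_le g N (r i) (hr i)
  refine ⟨fun φ => 2 ^ N * ∑ i ∈ Finset.Iic (N, 0), q i φ,
    continuous_const.mul (continuous_finsetSum _ fun i _ => hq i), by simp [hq0], fun φ x ω => ?_⟩
  have h1 := one_add_norm_pow_mul_le_seminormSum (m := (N, 0)) le_rfl le_rfl
    (𝓕⁻ (windowed g x φ)) ω
  rw [norm_iteratedFDeriv_zero] at h1
  calc (1 + ‖x‖) ^ N * (1 + ‖ω‖) ^ N * ‖stftDual g φ x ω‖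
      ≤ (1 + ‖x‖) ^ N * seminormSum (N, 0) (𝓕⁻ (windowed g x φ)) := by
        rw [mul_assoc, stftDual_eq_fourierInv]
        gcongr
    _ = 2 ^ N * ∑ i ∈ Finset.Iic (N, 0), (1 + ‖x‖) ^ N *
          SchwartzMap.seminorm ℝ i.1 i.2 (𝓕⁻ (windowed g x φ)) := by
        rw [seminormSum, ← Finset.mul_sum]
        ring
    _ ≤ _ := mul_le_mul_of_nonneg_left (Finset.sum_le_sum fun i _ => h i φ x) (by positivity)

end TimeFrequency

/-! ### The inversion formula for the short-time Fourier transform -/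

section Inversion

/-- The weight `(1 + ‖x‖) ^ (-N)` on phase space. -/
def phaseWeight {V : Type*} [NormedAddCommGroup V] (N : ℕ) (z : V × V) : ℝ :=
  ((1 + ‖z.1‖) ^ N)⁻¹ * ((1 + ‖z.2‖) ^ N)⁻¹

theorem phaseWeight_pos {V : Type*} [NormedAddCommGroup V] (N : ℕ) (z : V × V) :
    0 < phaseWeight N z := by
  rw [phaseWeight]; positivity

variable {V : Type*} [NormedAddCommGroup V] [InnerProductSpace ℝ V]

theorem conjSchwartz_timeFreqShift (x ω : V) (g : 𝓢(V, ℂ)) :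
    conjSchwartz (timeFreqShift x ω g) = timeFreqShift x (-ω) (conjSchwartz g) := by
  ext t
  rw [conjSchwartz_apply, timeFreqShift_apply, timeFreqShift_apply, conjSchwartz_apply, map_mul,
    ← Complex.exp_conj, inner_neg_right]
  congr 2
  simp [map_ofNat (starRingEnd ℂ) 2]

theorem conjSchwartz_conjSchwartz (φ : 𝓢(V, ℂ)) : conjSchwartz (conjSchwartz φ) = φ := by
  ext t
  simp [conjSchwartz_apply]

theorem norm_timeFreqShift_apply (x ω : V) (φ : 𝓢(V, ℂ)) (t : V) :
    ‖timeFreqShift x ω φ t‖ = ‖φ (t - x)‖ := by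
  rw [timeFreqShift_apply, norm_mul, Complex.norm_exp]
  simp

theorem continuous_timeFreqShift_left (g : 𝓢(V, ℂ)) (ω : V) :
    Continuous fun x => timeFreqShift x ω g :=
  (SchwartzMap.smulLeftCLM ℂ (character ω)).continuous.comp (continuous_translation g)

/-- Countably many seminorms generate the topology; the resulting metrizability is what strong
measurability into the Schwartz space rests on. -/
instance : (uniformity 𝓢(V, ℂ)).IsCountablyGenerated :=
  IsUniformAddGroup.uniformity_countably_generated

variable [FiniteDimensional ℝ V] [MeasurableSpace V] [BorelSpace V]

/-- Separate continuity in `x` and in `ω` suffices for joint measurability. -/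
theorem stronglyMeasurable_timeFreqShift (g : 𝓢(V, ℂ)) :
    StronglyMeasurable fun z : V × V => timeFreqShift z.1 z.2 g :=
  stronglyMeasurable_uncurry_of_continuous_of_stronglyMeasurable
    (u := fun x ω => timeFreqShift x ω g) (fun ω => continuous_timeFreqShift_left g ω)
    fun _ => (continuous_modulation _).stronglyMeasurable

theorem measurable_stft (g : 𝓢(V, ℂ)) (u : 𝓢'(V, ℂ)) :
    Measurable fun z : V × V => stft g u z.1 z.2 :=
  measurable_uncurry_of_separately_continuous (F := fun x ω => stft g u x ω)
    (continuous_stft_left g u) (continuous_stft_right g u)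

theorem stftDual_eq_apply (g φ : 𝓢(V, ℂ)) (x ω : V) :
    stftDual g φ x ω = (φ : 𝓢'(V, ℂ)) (timeFreqShift x ω g) := by
  rw [SchwartzMap.coe_apply, stftDual]
  simp_rw [smul_eq_mul, mul_comm]

theorem bracket_coe (φ ψ : 𝓢(V, ℂ)) : bracket (φ : 𝓢'(V, ℂ)) ψ = ∫ t, φ t * conj (ψ t) := by
  rw [bracket, SchwartzMap.coe_apply]
  simp_rw [conjSchwartz_apply, smul_eq_mul, mul_comm]

theorem stft_coe (g φ : 𝓢(V, ℂ)) (x ω : V) :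
    stft g (φ : 𝓢'(V, ℂ)) x ω = ∫ t, φ t * conj (timeFreqShift x ω g t) := bracket_coe _ _

theorem stft_coe_eq_stftDual (g φ : 𝓢(V, ℂ)) (x ω : V) :
    stft g (φ : 𝓢'(V, ℂ)) x ω = stftDual (conjSchwartz g) φ x (-ω) := by
  rw [stftDual_eq_apply, ← conjSchwartz_timeFreqShift]
  rfl

theorem stftDual_eq_stft (g φ : 𝓢(V, ℂ)) (x ω : V) :
    stftDual g φ x ω = stft (conjSchwartz g) (φ : 𝓢'(V, ℂ)) x (-ω) := by
  rw [stft_coe_eq_stftDual, conjSchwartz_conjSchwartz, neg_neg]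

theorem measurable_stftDual (g φ : 𝓢(V, ℂ)) :
    Measurable fun z : V × V => stftDual g φ z.1 z.2 := by
  have h : Measurable fun z : V × V => (z.1, -z.2) := measurable_fst.prodMk measurable_snd.neg
  have h1 : (fun z : V × V => stftDual g φ z.1 z.2) =
      (fun z : V × V => stft (conjSchwartz g) (φ : 𝓢'(V, ℂ)) z.1 z.2) ∘ fun z => (z.1, -z.2) :=
    funext fun z => stftDual_eq_stft g φ z.1 z.2
  rw [h1]
  exact Measurable.comp (measurable_stft _ _) h

variable (V) in
/-- An exponent for which `(1 + ‖x‖) ^ (-N)` is integrable. -/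
def decayExponent : ℕ := (volume : Measure V).integrablePower

theorem integrable_weight :
    Integrable fun x : V => ((1 + ‖x‖) ^ decayExponent V)⁻¹ := by
  refine (Measure.integrable_pow_neg_integrablePower (volume : Measure V)).congr
    (Filter.Eventually.of_forall fun x => ?_)
  simp only [decayExponent]
  rw [Real.rpow_neg (by positivity), Real.rpow_natCast]

theorem integrable_phaseWeight : Integrable (phaseWeight (decayExponent V) : V × V → ℝ) :=
  integrable_weight.mul_prod integrable_weight

theorem norm_stftDual_le_phaseWeight (g : 𝓢(V, ℂ)) (N : ℕ) : ∃ q : 𝓢(V, ℂ) → ℝ,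
    Continuous q ∧ q 0 = 0 ∧ ∀ φ z, ‖stftDual g φ z.1 z.2‖ ≤ q φ * phaseWeight N z := by
  obtain ⟨q, hq, hq0, h⟩ := stftDual_decay g N
  refine ⟨q, hq, hq0, fun φ z => ?_⟩
  rw [phaseWeight, ← mul_inv, ← div_eq_mul_inv, le_div_iff₀ (by positivity), mul_comm]
  exact h φ z.1 z.2

theorem norm_stft_coe_le_phaseWeight (g φ : 𝓢(V, ℂ)) (N : ℕ) : ∃ C : ℝ, 0 ≤ C ∧
    ∀ z : V × V, ‖stft g (φ : 𝓢'(V, ℂ)) z.1 z.2‖ ≤ C * phaseWeight N z := by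
  obtain ⟨q, hq, hq0, h⟩ := norm_stftDual_le_phaseWeight (conjSchwartz g) N
  have h' : ∀ z : V × V, ‖stft g (φ : 𝓢'(V, ℂ)) z.1 z.2‖ ≤ q φ * phaseWeight N z := by
    intro z
    have := h φ (z.1, -z.2)
    rw [← stft_coe_eq_stftDual] at this
    simpa [phaseWeight] using this
  refine ⟨q φ, ?_, h'⟩
  exact nonneg_of_mul_nonneg_left ((norm_nonneg _).trans (h' 0)) (phaseWeight_pos N 0)

theorem integrable_stftDual (g φ : 𝓢(V, ℂ)) :
    Integrable fun z : V × V => stftDual g φ z.1 z.2 := by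
  obtain ⟨q, -, -, h⟩ := norm_stftDual_le_phaseWeight g (decayExponent V)
  exact (integrable_phaseWeight.const_mul (q φ)).mono' (measurable_stftDual g φ).aestronglyMeasurable
    (Filter.Eventually.of_forall (h φ))

/-- Shifts have polynomially bounded seminorms, so finite moments of the coefficient `w` are all
that `schwartzIntegral` needs. The map `ζ` is left general to cover both the identity and the
projection from pairs of phase-space points. -/
theorem integrable_seminorm_timeFreqShift {X : Type*} [MeasurableSpace X] {μ : Measure X}
    {w : X → ℂ} {ζ : X → V × V} (g : 𝓢(V, ℂ)) (hw : AEStronglyMeasurable w μ) (hζ : Measurable ζ)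
    (hint : ∀ k n : ℕ, Integrable (fun x => ‖w x‖ * ((1 + ‖(ζ x).1‖) ^ k * (1 + ‖(ζ x).2‖) ^ n)) μ) :
    AEStronglyMeasurable (fun x => w x • conjSchwartz (timeFreqShift (ζ x).1 (ζ x).2 g)) μ ∧
    ∀ k n : ℕ, Integrable (fun x => SchwartzMap.seminorm ℝ k n
      (w x • conjSchwartz (timeFreqShift (ζ x).1 (ζ x).2 g))) μ := by
  have hm : AEStronglyMeasurable
      (fun x => w x • conjSchwartz (timeFreqShift (ζ x).1 (ζ x).2 g)) μ :=
    hw.smul (conjSchwartz.continuous.comp_aestronglyMeasurable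
      ((stronglyMeasurable_timeFreqShift g).comp_measurable hζ).aestronglyMeasurable)
  refine ⟨hm, fun k n => ?_⟩
  obtain ⟨C, hC, h⟩ := seminorm_timeFreqShift_le (conjSchwartz g) k n
  refine ((hint k n).const_mul C).mono'
    (((schwartz_withSeminorms ℝ V ℂ).continuous_seminorm (k, n)).comp_aestronglyMeasurable hm)
    (Filter.Eventually.of_forall fun x => ?_)
  rw [Real.norm_of_nonneg (apply_nonneg _ _), conjSchwartz_timeFreqShift]
  have h1 := h (ζ x).1 (-(ζ x).2)
  rw [norm_neg] at h1
  have h2 : SchwartzMap.seminorm ℝ k n (w x • timeFreqShift (ζ x).1 (-(ζ x).2) (conjSchwartz g)) =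
      ‖w x‖ * SchwartzMap.seminorm ℝ k n (timeFreqShift (ζ x).1 (-(ζ x).2) (conjSchwartz g)) :=
    map_smul_eq_mul (SchwartzMap.seminorm ℂ k n) (w x) _
  rw [h2]
  calc _ ≤ ‖w x‖ * (C * ((1 + ‖(ζ x).1‖) ^ k * (1 + ‖(ζ x).2‖) ^ n)) := by gcongr
    _ = _ := by ring

theorem integrable_stftDual_mul_pow (g φ : 𝓢(V, ℂ)) (k n : ℕ) : Integrable fun z : V × V =>
    ‖stftDual g φ z.1 z.2‖ * ((1 + ‖z.1‖) ^ k * (1 + ‖z.2‖) ^ n) := by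
  obtain ⟨q, -, -, h⟩ := norm_stftDual_le_phaseWeight g (decayExponent V + (k + n))
  refine (integrable_phaseWeight.const_mul (q φ)).mono'
    ((measurable_stftDual g φ).norm.mul (by fun_prop)).aestronglyMeasurable
    (Filter.Eventually.of_forall fun z => ?_)
  rw [Real.norm_of_nonneg (by positivity)]
  have h0 : 0 ≤ q φ :=
    nonneg_of_mul_nonneg_left ((norm_nonneg _).trans (h φ 0)) (phaseWeight_pos _ 0)
  have hk : (1 + ‖z.1‖) ^ k ≤ (1 + ‖z.1‖) ^ (k + n) :=
    pow_le_pow_right₀ (by linarith [norm_nonneg z.1]) (by omega)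
  have hn : (1 + ‖z.2‖) ^ n ≤ (1 + ‖z.2‖) ^ (k + n) :=
    pow_le_pow_right₀ (by linarith [norm_nonneg z.2]) (by omega)
  calc ‖stftDual g φ z.1 z.2‖ * ((1 + ‖z.1‖) ^ k * (1 + ‖z.2‖) ^ n)
      ≤ q φ * phaseWeight (decayExponent V + (k + n)) z *
        ((1 + ‖z.1‖) ^ (k + n) * (1 + ‖z.2‖) ^ (k + n)) := by
        have := (phaseWeight_pos (decayExponent V + (k + n)) z).le
        gcongr
        exact h φ z
    _ = q φ * phaseWeight (decayExponent V) z := by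
        simp only [phaseWeight, pow_add]
        have h1 : (1 + ‖z.1‖) ≠ 0 := by positivity
        have h2 : (1 + ‖z.2‖) ≠ 0 := by positivity
        field_simp

/-- For fixed `x`, Fourier inversion in `ω` returns `γ(t - x) ψ(t)`, multiplied by `conj (G(t -
x))`. Integrating over `x` and substituting `s = t - x` leaves the inner product of the windows
times `ψ(t)`. -/
theorem integral_stftDual_mul_conj (G γ ψ : 𝓢(V, ℂ)) (t : V) :
    ∫ z : V × V, stftDual γ ψ z.1 z.2 * conj (timeFreqShift z.1 z.2 G t) =
      (∫ s, γ s * conj (G s)) * ψ t := by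
  have hint : Integrable fun z : V × V =>
      stftDual γ ψ z.1 z.2 * conj (timeFreqShift z.1 z.2 G t) := by
    refine (integrable_stftDual γ ψ).mul_bdd (c := SchwartzMap.seminorm ℝ 0 0 G) ?_ ?_
    · refine Measurable.aestronglyMeasurable (Complex.continuous_conj.measurable.comp ?_)
      simp_rw [timeFreqShift_apply]
      exact Measurable.mul (by fun_prop)
        (G.continuous.measurable.comp (measurable_const.sub measurable_fst))
    · refine Filter.Eventually.of_forall fun z => ?_
      rw [RCLike.norm_conj, norm_timeFreqShift_apply]
      exact G.norm_le_seminorm ℝ _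
  rw [Measure.volume_eq_prod, integral_prod _ (by rwa [Measure.volume_eq_prod] at hint)]
  have hω : ∀ x : V, ∫ ω : V, stftDual γ ψ x ω * conj (timeFreqShift x ω G t) =
      γ (t - x) * conj (G (t - x)) * ψ t := by
    intro x
    have h1 : 𝓕 (𝓕⁻ (windowed γ x ψ)) t = γ (t - x) * ψ t := by
      rw [FourierTransform.fourier_fourierInv_eq, windowed_apply]
    rw [SchwartzMap.fourier_coe, Real.fourier_eq'] at h1
    rw [mul_right_comm, ← h1, ← integral_mul_const]
    refine integral_congr_ae (Filter.Eventually.of_forall fun ω => ?_)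
    simp only [smul_eq_mul]
    rw [stftDual_eq_fourierInv, timeFreqShift_apply, map_mul, ← Complex.exp_conj, real_inner_comm]
    have : (starRingEnd ℂ) (2 * Real.pi * Complex.I * (inner ℝ ω t : ℝ)) =
        ((-2 * Real.pi * inner ℝ ω t : ℝ) : ℂ) * Complex.I := by
      simp [map_ofNat (starRingEnd ℂ) 2]
      ring
    rw [this]
    ring
  simp_rw [hω]
  rw [integral_mul_const]
  congr 1
  exact integral_sub_left_eq_self (fun s => γ s * conj (G s)) volume t

/-- The inversion formula for the short-time Fourier transform of a tempered distribution. -/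
theorem integral_stft_mul_stftDual (u : 𝓢'(V, ℂ)) (G γ ψ : 𝓢(V, ℂ)) :
    ∫ z : V × V, stft G u z.1 z.2 * stftDual γ ψ z.1 z.2 = (∫ s, γ s * conj (G s)) * u ψ := by
  -- The pointwise formula writes a multiple of `ψ` as a Schwartz-valued integral of conjugated
  -- shifts of `G`; `u` is moved inside that integral.
  obtain ⟨hm, hi⟩ := integrable_seminorm_timeFreqShift G
    (measurable_stftDual γ ψ).aestronglyMeasurable measurable_id (integrable_stftDual_mul_pow γ ψ)
  have h := apply_schwartzIntegral hm hi u
  have hS : schwartzIntegral hm hi = (∫ s, γ s * conj (G s)) • ψ := by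
    ext t
    rw [schwartzIntegral_apply]
    exact integral_stftDual_mul_conj G γ ψ t
  rw [hS, map_smul, smul_eq_mul] at h
  rw [h]
  refine integral_congr_ae (Filter.Eventually.of_forall fun z => ?_)
  simp only [map_smul, smul_eq_mul, stft, bracket, id]
  ring

theorem integral_mul_conj_ne_zero {g : 𝓢(V, ℂ)} (hg : g ≠ 0) : ∫ s, g s * conj (g s) ≠ 0 := by
  simp_rw [Complex.mul_conj, Complex.normSq_eq_norm_sq]
  rw [integral_complex_ofReal, Complex.ofReal_ne_zero]
  obtain ⟨t, ht⟩ : ∃ t, g t ≠ 0 := by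
    by_contra! h
    exact hg (SchwartzMap.ext h)
  have hi : Integrable fun s => ‖g s‖ ^ 2 := (g.memLp 2).integrable_norm_pow (by norm_num)
  exact (integral_pos_of_integrable_nonneg_nonzero (x := t) (g.continuous.norm.pow 2) hi
    (fun s => pow_nonneg (norm_nonneg _) 2) (by simpa using ht)).ne'

end Inversion

/-! ### Linear changes of variables -/

section LinearChange

variable {E F : Type*} [NormedAddCommGroup E] [NormedSpace ℝ E]
  [MeasurableSpace E] [BorelSpace E] [NormedAddCommGroup F] [NormedSpace ℝ F]
  [MeasurableSpace F] [BorelSpace F]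

/-- Uniqueness of Haar measure. Only the positivity of the constant matters below, so no determinant
is computed. -/
theorem exists_map_eq_smul [FiniteDimensional ℝ F] (e : E ≃L[ℝ] F) (μ : Measure E)
    [μ.IsAddHaarMeasure] (ν : Measure F)
    [ν.IsAddHaarMeasure] : ∃ c : ℝ≥0, 0 < c ∧ μ.map e = c • ν := by
  have := e.isAddHaarMeasure_map μ
  have : SecondCountableTopology F := by
    have := FiniteDimensional.proper_real F
    infer_instance
  exact ⟨_, Measure.addHaarScalarFactor_pos_of_isAddHaarMeasure (μ.map e) ν,
    Measure.isAddLeftInvariant_eq_smul (μ.map e) ν⟩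

theorem integral_comp_equiv {e : E ≃L[ℝ] F} {μ : Measure E} {ν : Measure F} {c : ℝ≥0}
    (h : μ.map e = c • ν) (f : F → ℂ) : ∫ x, f (e x) ∂μ = c * ∫ y, f y ∂ν := by
  have h1 := integral_map_equiv (μ := μ) e.toHomeomorph.toMeasurableEquiv f
  change ∫ y, f y ∂(μ.map e) = ∫ x, f (e x) ∂μ at h1
  rw [← h1, h, integral_smul_nnreal_measure]
  rfl

theorem lintegral_comp_equiv {e : E ≃L[ℝ] F} {μ : Measure E} {ν : Measure F} {c : ℝ≥0}
    (h : μ.map e = c • ν) (f : F → ℝ≥0∞) : ∫⁻ x, f (e x) ∂μ = c * ∫⁻ y, f y ∂ν := by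
  have h1 := lintegral_map_equiv (μ := μ) f e.toHomeomorph.toMeasurableEquiv
  change ∫⁻ y, f y ∂(μ.map e) = ∫⁻ x, f (e x) ∂μ at h1
  rw [← h1, h, lintegral_smul_measure]
  rfl

end LinearChange

/-! ### Covariance and orthogonality of Cohen-type Wigner distributions -/

section CohenWigner

variable {d : ℕ}

/-- The point `(x, ω)` of `ℝ^{2d}`. -/
def pairPoint (x ω : Rd d) : R2d d := EuclideanSpace.sumEquivProd.symm (x, ω)

theorem inner_pairPoint (ζ : R2d d) (x ω : Rd d) :
    (inner ℝ ζ (pairPoint x ω) : ℝ) = inner ℝ (fstPart ζ) x + inner ℝ (sndPart ζ) ω := by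
  simp only [PiLp.inner_apply, Fintype.sum_sum_type]
  rfl

theorem fstPart_sub_pairPoint (ζ : R2d d) (x ω : Rd d) :
    fstPart (ζ - pairPoint x ω) = fstPart ζ - x := rfl

theorem sndPart_sub_pairPoint (ζ : R2d d) (x ω : Rd d) :
    sndPart (ζ - pairPoint x ω) = sndPart ζ - ω := rfl

/-- The operator `y ↦ T y` on `ℝ^d`. -/
abbrev matrixOp (T : Matrix (Fin d) (Fin d) ℝ) : Rd d →L[ℝ] Rd d :=
  Matrix.toEuclideanCLM (n := Fin d) (𝕜 := ℝ) T

theorem cohenWigner_apply (T : Matrix (Fin d) (Fin d) ℝ) (f g : 𝓢(Rd d, ℂ)) (ζ : R2d d) :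
    matrixWigner (cohenMatrix T) f g ζ = ∫ y : Rd d,
      Complex.exp (-(2 * Real.pi * Complex.I * (inner ℝ y (sndPart ζ) : ℝ))) *
        (f (fstPart ζ + matrixOp T y) * conj (g (fstPart ζ - (y - matrixOp T y)))) := by
  rw [matrixWigner_apply]
  have h1 : ∀ x y : Rd d, Matrix.toEuclideanLin (cohenMatrix T).val.toBlocks₁₁ x +
      Matrix.toEuclideanLin (cohenMatrix T).val.toBlocks₁₂ y = x + matrixOp T y := by
    intro x y
    simp only [cohenMatrix, Matrix.toBlocks_fromBlocks₁₁, Matrix.toBlocks_fromBlocks₁₂]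
    rw [← Matrix.coe_toEuclideanCLM_eq_toEuclideanLin, ← Matrix.coe_toEuclideanCLM_eq_toEuclideanLin,
      map_one]
    rfl
  have h2 : ∀ x y : Rd d, Matrix.toEuclideanLin (cohenMatrix T).val.toBlocks₂₁ x +
      Matrix.toEuclideanLin (cohenMatrix T).val.toBlocks₂₂ y = x - (y - matrixOp T y) := by
    intro x y
    simp only [cohenMatrix, Matrix.toBlocks_fromBlocks₂₁, Matrix.toBlocks_fromBlocks₂₂]
    rw [← Matrix.coe_toEuclideanCLM_eq_toEuclideanLin, ← Matrix.coe_toEuclideanCLM_eq_toEuclideanLin,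
      map_one, map_neg, map_sub, map_one, sub_eq_add_neg]
    rfl
  simp_rw [h1, h2]

/-- The covariance of the Cohen-type Wigner distributions under time-frequency shifts. -/
theorem cohenWigner_timeFreqShift (T : Matrix (Fin d) (Fin d) ℝ) (f g : 𝓢(Rd d, ℂ))
    (a α b β : Rd d) (ζ : R2d d) :
    matrixWigner (cohenMatrix T) (timeFreqShift b β f) (timeFreqShift a α g) ζ =
      Complex.exp (2 * Real.pi * Complex.I *
        (inner ℝ (b - a) (α + (matrixOp T).adjoint (β - α)) : ℝ)) *
      timeFreqShift (pairPoint (b + matrixOp T (a - b)) (α + (matrixOp T).adjoint (β - α)))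
        (pairPoint (β - α) (a - b)) (matrixWigner (cohenMatrix T) f g) ζ := by
  -- The substitution `y ↦ y + (b - a)` turns the arguments of both `f` and `g` into those of the
  -- unshifted distribution at the translated point.
  rw [timeFreqShift_apply, cohenWigner_apply, cohenWigner_apply, fstPart_sub_pairPoint,
    sndPart_sub_pairPoint, inner_pairPoint, ← mul_assoc, ← Complex.exp_add, ← integral_const_mul,
    ← integral_add_right_eq_self _ (b - a)]
  refine integral_congr_ae (Filter.Eventually.of_forall fun y => ?_)
  simp only [timeFreqShift_apply]
  rw [map_mul, ← Complex.exp_conj]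
  set x := fstPart ζ
  set ω := sndPart ζ
  set τ := matrixOp T
  have e1 : x + τ (y + (b - a)) - b = x - (b + τ (a - b)) + τ y := by
    simp only [map_add, map_sub]; abel
  have e2 : x - (y + (b - a) - τ (y + (b - a))) - a =
      x - (b + τ (a - b)) - (y - τ y) := by
    simp only [map_add, map_sub]; abel
  rw [e1, e2]
  have hexp : ∀ A B C D F : ℂ, Complex.exp A * (Complex.exp B * F * (Complex.exp C * D)) =
      Complex.exp (A + B + C) * (F * D) := by
    intro A B C D F
    rw [Complex.exp_add, Complex.exp_add]; ring
  rw [hexp, ← mul_assoc (Complex.exp _) (Complex.exp _), ← Complex.exp_add]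
  congr 2
  have hc : (starRingEnd ℂ) (2 * Real.pi * Complex.I *
      (inner ℝ (x - (y + (b - a) - τ (y + (b - a)))) α : ℝ)) =
      -(2 * Real.pi * Complex.I * (inner ℝ (x - (y + (b - a) - τ (y + (b - a)))) α : ℝ)) := by
    simp [map_ofNat (starRingEnd ℂ) 2]
  -- What remains is an identity between real phases; moving `T` across the inner product produces
  -- its adjoint.
  have key : -(inner ℝ (y + (b - a)) ω : ℝ) + inner ℝ (x + τ (y + (b - a))) β -
      inner ℝ (x - (y + (b - a) - τ (y + (b - a)))) α =
      inner ℝ (b - a) (α + τ.adjoint (β - α)) + (inner ℝ x (β - α) + inner ℝ ω (a - b)) -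
        inner ℝ y (ω - (α + τ.adjoint (β - α))) := by
    simp only [inner_add_right, inner_sub_right, ContinuousLinearMap.adjoint_inner_right,
      inner_add_left, inner_sub_left, map_add, map_sub]
    rw [real_inner_comm a ω, real_inner_comm b ω]
    ring
  rw [hc]
  calc _ = 2 * Real.pi * Complex.I * ((-(inner ℝ (y + (b - a)) ω : ℝ) +
        inner ℝ (x + τ (y + (b - a))) β -
        inner ℝ (x - (y + (b - a) - τ (y + (b - a)))) α : ℝ) : ℂ) := by push_cast; ring
    _ = _ := by rw [key]; push_cast; ring

/-- Plancherel on each slice of fixed first variable, then Fubini. -/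
theorem integral_partialFourier_mul_conj {E : Type} [NormedAddCommGroup E] [InnerProductSpace ℝ E]
    [FiniteDimensional ℝ E] [MeasurableSpace E] [BorelSpace E] (Ψ₁ Ψ₂ : 𝓢(E × E, ℂ)) :
    ∫ z, partialFourier Ψ₁ z * conj (partialFourier Ψ₂ z) = ∫ z, Ψ₁ z * conj (Ψ₂ z) := by
  have hint : ∀ Φ₁ Φ₂ : 𝓢(E × E, ℂ), Integrable (fun z => Φ₁ z * conj (Φ₂ z))
      ((volume : Measure E).prod volume) := by
    intro Φ₁ Φ₂
    refine Φ₁.integrable.mul_bdd (c := SchwartzMap.seminorm ℝ 0 0 Φ₂)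
      (Complex.continuous_conj.comp Φ₂.continuous).aestronglyMeasurable
      (Filter.Eventually.of_forall fun z => ?_)
    rw [RCLike.norm_conj]
    exact Φ₂.norm_le_seminorm ℝ z
  rw [Measure.volume_eq_prod, integral_prod _ (hint _ _), integral_prod _ (hint _ _)]
  refine integral_congr_ae (Filter.Eventually.of_forall fun x => ?_)
  have h := SchwartzMap.integral_sesq_fourier_fourier (schwartzSection Ψ₂ x) (schwartzSection Ψ₁ x)
    (innerSL ℂ)
  simp only [innerSL_apply_apply, RCLike.inner_apply] at h
  refine Eq.trans ?_ h
  refine integral_congr_ae (Filter.Eventually.of_forall fun ω => ?_)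
  change partialFourierFun Ψ₁ (x, ω) * conj (partialFourierFun Ψ₂ (x, ω)) = _
  rw [partialFourierFun_eq, partialFourierFun_eq]

/-- The orthogonality relations for the matrix-Wigner distributions, up to a constant. -/
theorem exists_moyal (A : GL (Fin d ⊕ Fin d) ℝ) : ∃ c : ℝ≥0, 0 < c ∧
    ∀ f₁ g₁ f₂ g₂ : 𝓢(Rd d, ℂ),
      ∫ ζ, matrixWigner A f₁ g₁ ζ * conj (matrixWigner A f₂ g₂ ζ) =
        c * ((∫ t, f₁ t * conj (f₂ t)) * conj (∫ t, g₁ t * conj (g₂ t))) := by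
  let e₁ : R2d d ≃L[ℝ] Rd d × Rd d := EuclideanSpace.sumEquivProd
  let e₂ : (Rd d × Rd d) ≃L[ℝ] Rd d × Rd d :=
    (EuclideanSpace.sumEquivProd.symm.trans (matrixEquiv A)).trans EuclideanSpace.sumEquivProd
  obtain ⟨c₁, hc₁, h₁⟩ := exists_map_eq_smul e₁ volume ((volume : Measure (Rd d)).prod volume)
  obtain ⟨c₂, hc₂, h₂⟩ := exists_map_eq_smul e₂ ((volume : Measure (Rd d)).prod volume)
    ((volume : Measure (Rd d)).prod volume)
  refine ⟨c₁ * c₂, mul_pos hc₁ hc₂, fun f₁ g₁ f₂ g₂ => ?_⟩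
  have hW : ∀ f g : 𝓢(Rd d, ℂ), ∀ ζ, matrixWigner A f g ζ = partialFourier
      (SchwartzMap.compCLMOfContinuousLinearEquiv ℂ e₂ (tensor f (conjSchwartz g))) (e₁ ζ) :=
    fun f g ζ => rfl
  simp_rw [hW]
  -- The coordinate change, the partial Fourier transform and the matrix substitution preserve the
  -- inner product up to constants, which leaves an inner product of tensors; it factors.
  rw [integral_comp_equiv h₁ (fun z => partialFourier
      (SchwartzMap.compCLMOfContinuousLinearEquiv ℂ e₂ (tensor f₁ (conjSchwartz g₁))) z *
      conj (partialFourier (SchwartzMap.compCLMOfContinuousLinearEquiv ℂ e₂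
        (tensor f₂ (conjSchwartz g₂))) z)), ← Measure.volume_eq_prod,
    integral_partialFourier_mul_conj]
  have h3 := integral_comp_equiv h₂ (fun z => tensor f₁ (conjSchwartz g₁) z *
    conj (tensor f₂ (conjSchwartz g₂) z))
  rw [← Measure.volume_eq_prod] at h3
  refine (congrArg _ h3).trans ?_
  have h4 := integral_prod_mul (μ := (volume : Measure (Rd d))) (ν := (volume : Measure (Rd d)))
    (fun t => f₁ t * conj (f₂ t)) (fun t => conj (g₁ t) * g₂ t)
  have h5 : conj (∫ t, g₁ t * conj (g₂ t)) = ∫ t, conj (g₁ t) * g₂ t := by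
    rw [← integral_conj]
    simp
  rw [h5, ← h4, NNReal.coe_mul, Complex.ofReal_mul, mul_assoc]
  congr 2
  refine integral_congr_ae (Filter.Eventually.of_forall fun z => ?_)
  change f₁ z.1 * conj (g₁ z.2) * conj (f₂ z.1 * conj (g₂ z.2)) = _
  simp only [map_mul, Complex.conj_conj]
  ring

end CohenWigner

/-! ### The operator as an integral operator on phase space -/

section Kernel

section Shift

variable {V : Type*} [NormedAddCommGroup V] [InnerProductSpace ℝ V]

theorem timeFreqShift_timeFreqShift (x ω x₀ ω₀ : V) (φ : 𝓢(V, ℂ)) (t : V) :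
    timeFreqShift x ω (timeFreqShift x₀ ω₀ φ) t =
      Complex.exp (-(2 * Real.pi * Complex.I * (inner ℝ x ω₀ : ℝ))) *
        timeFreqShift (x + x₀) (ω + ω₀) φ t := by
  simp only [timeFreqShift_apply]
  rw [← mul_assoc, ← mul_assoc, ← Complex.exp_add, ← Complex.exp_add, sub_sub, inner_sub_left,
    inner_add_right]
  congr 2
  push_cast
  ring

variable [FiniteDimensional ℝ V] [MeasurableSpace V] [BorelSpace V]

/-- Shifting the window merely translates the phase-space variable, up to a phase; hence replacing a
window by one of its shifts is harmless. -/
theorem stftDual_timeFreqShift (x ω x₀ ω₀ : V) (γ ψ : 𝓢(V, ℂ)) :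
    stftDual (timeFreqShift x₀ ω₀ γ) ψ x ω =
      Complex.exp (-(2 * Real.pi * Complex.I * (inner ℝ x ω₀ : ℝ))) *
        stftDual γ ψ (x + x₀) (ω + ω₀) := by
  rw [stftDual, stftDual, ← integral_const_mul]
  simp_rw [timeFreqShift_timeFreqShift]
  refine integral_congr_ae (Filter.Eventually.of_forall fun t => ?_)
  ring

/-- If `G` were orthogonal to all shifts of `Φ`, the inversion formula would give `‖Φ‖² ‖G‖² = 0`.
This makes inversion usable for an arbitrary prescribed window `G`. -/
theorem exists_integral_timeFreqShift_ne_zero {Φ G : 𝓢(V, ℂ)} (hΦ : Φ ≠ 0) (hG : G ≠ 0) :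
    ∃ z : V × V, ∫ s, timeFreqShift z.1 z.2 Φ s * conj (G s) ≠ 0 := by
  by_contra! h
  have h1 := integral_stft_mul_stftDual (G : 𝓢'(V, ℂ)) Φ Φ (conjSchwartz G)
  have h2 : ∀ z : V × V, stftDual Φ (conjSchwartz G) z.1 z.2 = 0 := by
    intro z
    rw [← h z, stftDual]
    simp_rw [conjSchwartz_apply, mul_comm]
  simp_rw [h2, mul_zero, integral_zero] at h1
  have h3 : (G : 𝓢'(V, ℂ)) (conjSchwartz G) = ∫ s, G s * conj (G s) := bracket_coe G G
  rw [h3] at h1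
  exact mul_ne_zero (integral_mul_conj_ne_zero hΦ) (integral_mul_conj_ne_zero hG) h1.symm

/-- A bound valid almost everywhere holds on a dense set, and by continuity that set is closed. The
kernel is thereby dominated at every point. -/
theorem enorm_le_eLpNorm_top {f : V → ℂ} (hf : Continuous f) (x : V) :
    ‖f x‖ₑ ≤ eLpNorm f ∞ volume := by
  have h := ae_le_eLpNormEssSup (f := f) (μ := (volume : Measure V))
  rw [eLpNorm_exponent_top]
  have hd : Dense {x | ‖f x‖ₑ ≤ eLpNormEssSup f volume} := Measure.dense_of_ae h
  have hc : IsClosed {x | ‖f x‖ₑ ≤ eLpNormEssSup f volume} :=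
    isClosed_le hf.enorm continuous_const
  have : x ∈ closure {x | ‖f x‖ₑ ≤ eLpNormEssSup f volume} := hd x
  rwa [hc.closure_eq] at this

end Shift

variable {d : ℕ}

/-- The linear change of variables `(z, w) ↦ (P, Q)` of the covariance formula
`cohenWigner_timeFreqShift`. -/
def covarianceEquiv (T : Matrix (Fin d) (Fin d) ℝ) :
    ((Rd d × Rd d) × (Rd d × Rd d)) ≃L[ℝ] R2d d × R2d d :=
  (LinearEquiv.toContinuousLinearEquiv
    { toFun := fun p => ((p.2.1 + matrixOp T (p.1.1 - p.2.1),
          p.1.2 + (matrixOp T).adjoint (p.2.2 - p.1.2)), (p.2.2 - p.1.2, p.1.1 - p.2.1))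
      map_add' := fun p q => by
        refine Prod.ext (Prod.ext ?_ ?_) (Prod.ext ?_ ?_) <;>
          simp only [Prod.fst_add, Prod.snd_add, map_add, map_sub] <;> abel
      map_smul' := fun r p => by
        refine Prod.ext (Prod.ext ?_ ?_) (Prod.ext ?_ ?_) <;>
          simp [smul_add, smul_sub]
      invFun := fun q => ((q.1.1 - matrixOp T q.2.2 + q.2.2, q.1.2 - (matrixOp T).adjoint q.2.1),
        (q.1.1 - matrixOp T q.2.2, q.1.2 - (matrixOp T).adjoint q.2.1 + q.2.1))
      left_inv := fun p => by
        refine Prod.ext (Prod.ext ?_ ?_) (Prod.ext ?_ ?_) <;> simp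
      right_inv := fun q => by
        refine Prod.ext (Prod.ext ?_ ?_) (Prod.ext ?_ ?_) <;> simp }).trans
    (EuclideanSpace.sumEquivProd.symm.prodCongr EuclideanSpace.sumEquivProd.symm)

theorem covarianceEquiv_apply (T : Matrix (Fin d) (Fin d) ℝ)
    (p : (Rd d × Rd d) × (Rd d × Rd d)) :
    covarianceEquiv T p =
      (pairPoint (p.2.1 + matrixOp T (p.1.1 - p.2.1))
        (p.1.2 + (matrixOp T).adjoint (p.2.2 - p.1.2)),
        pairPoint (p.2.2 - p.1.2) (p.1.1 - p.2.1)) := rfl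

variable (d) in
/-- The symplectic rotation `(b, β) ↦ (β, -b)` of phase space. -/
def symplecticEquiv : (Rd d × Rd d) ≃L[ℝ] R2d d :=
  (((ContinuousLinearEquiv.neg ℝ (M := Rd d)).prodCongr
    (ContinuousLinearEquiv.refl ℝ (Rd d))).trans
    (ContinuousLinearEquiv.prodComm ℝ (Rd d) (Rd d))).trans EuclideanSpace.sumEquivProd.symm

theorem symplecticEquiv_apply (v : Rd d × Rd d) :
    symplecticEquiv d v = pairPoint v.2 (-v.1) := rfl

/-- By the orthogonality relations its squared norm is a positive multiple of `‖f‖² ‖g‖²`. -/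
theorem matrixWigner_ne_zero (A : GL (Fin d ⊕ Fin d) ℝ) {f g : 𝓢(Rd d, ℂ)} (hf : f ≠ 0)
    (hg : g ≠ 0) : matrixWigner A f g ≠ 0 := by
  intro h
  obtain ⟨c, hc, hM⟩ := exists_moyal A
  have h1 := hM f g f g
  simp only [h, zero_apply, zero_mul, integral_zero] at h1
  refine mul_ne_zero (by simpa using hc.ne') (mul_ne_zero (integral_mul_conj_ne_zero hf) ?_) h1.symm
  exact (map_ne_zero _).2 (integral_mul_conj_ne_zero hg)

/-- The phase factor of the covariance formula. -/
def covariancePhase (T : Matrix (Fin d) (Fin d) ℝ) (p : (Rd d × Rd d) × (Rd d × Rd d)) : ℝ :=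
  inner ℝ (p.2.1 - p.1.1) (p.1.2 + (matrixOp T).adjoint (p.2.2 - p.1.2))

/-- The shift of `W(g, g)` by `covarianceEquiv T p` is, up to a phase, `W(π(w)g, π(z)g)` with `p =
(z, w)`; orthogonality against `W(φ, f)` then separates the variables. -/
theorem stftDual_cohenWigner (T : Matrix (Fin d) (Fin d) ℝ) {c : ℝ≥0}
    (hM : ∀ f₁ g₁ f₂ g₂ : 𝓢(Rd d, ℂ),
      ∫ ζ, matrixWigner (cohenMatrix T) f₁ g₁ ζ * conj (matrixWigner (cohenMatrix T) f₂ g₂ ζ) =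
        c * ((∫ t, f₁ t * conj (f₂ t)) * conj (∫ t, g₁ t * conj (g₂ t))))
    (g φ f : 𝓢(Rd d, ℂ)) (p : (Rd d × Rd d) × (Rd d × Rd d)) :
    stftDual (matrixWigner (cohenMatrix T) g g)
        (conjSchwartz (matrixWigner (cohenMatrix T) φ f))
        (covarianceEquiv T p).1 (covarianceEquiv T p).2 =
      c * Complex.exp (-(2 * Real.pi * Complex.I * (covariancePhase T p : ℝ))) *
        (stft g (f : 𝓢'(Rd d, ℂ)) p.1.1 p.1.2 *
          stftDual g (conjSchwartz φ) p.2.1 p.2.2) := by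
  have h := hM (timeFreqShift p.2.1 p.2.2 g) (timeFreqShift p.1.1 p.1.2 g) φ f
  have h1 : (∫ t, timeFreqShift p.2.1 p.2.2 g t * conj (φ t)) =
      stftDual g (conjSchwartz φ) p.2.1 p.2.2 := by
    rw [stftDual]
    simp_rw [conjSchwartz_apply, mul_comm]
  have h2 : conj (∫ t, timeFreqShift p.1.1 p.1.2 g t * conj (f t)) =
      stft g (f : 𝓢'(Rd d, ℂ)) p.1.1 p.1.2 := by
    rw [stft_coe, ← integral_conj]
    simp_rw [map_mul, Complex.conj_conj, mul_comm]
  rw [h1, h2] at h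
  rw [mul_right_comm, mul_comm (stft g _ _ _), ← h, stftDual, ← integral_mul_const]
  refine integral_congr_ae (Filter.Eventually.of_forall fun ζ => ?_)
  simp only [conjSchwartz_apply]
  rw [cohenWigner_timeFreqShift, covarianceEquiv_apply]
  simp only [covariancePhase]
  rw [Complex.exp_neg]
  field_simp

/-- The operator `op_A(σ)` as an integral operator on phase space, for `σ` in `M^{∞,1}`: its
kernel is dominated by an integrable function of the difference of the two variables. -/
theorem exists_phaseSpace_kernel (T : Matrix (Fin d) (Fin d) ℝ) {g : 𝓢(Rd d, ℂ)} (hg : g ≠ 0)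
    {G : 𝓢(R2d d, ℂ)} (hG : G ≠ 0) : ∃ C : ℝ≥0, ∀ σ : 𝓢'(R2d d, ℂ),
      ∃ (k : (Rd d × Rd d) × (Rd d × Rd d) → ℂ) (H : Rd d × Rd d → ℝ≥0∞),
        Measurable k ∧ Measurable H ∧ (∀ p, ‖k p‖ₑ ≤ H (p.2 - p.1)) ∧
        ∫⁻ v, H v ≤ C * modulationNorm G ∞ 1 σ ∧
        ∀ φ f : 𝓢(Rd d, ℂ), bracket σ (matrixWigner (cohenMatrix T) φ f) =
          ∫ p : (Rd d × Rd d) × (Rd d × Rd d), stft g (f : 𝓢'(Rd d, ℂ)) p.1.1 p.1.2 *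
            stftDual g (conjSchwartz φ) p.2.1 p.2.2 * k p := by
  set Φ := matrixWigner (cohenMatrix T) g g with hΦ
  obtain ⟨z₀, hz₀⟩ := exists_integral_timeFreqShift_ne_zero
    (matrixWigner_ne_zero (cohenMatrix T) hg hg) hG
  set c₀ := ∫ s, timeFreqShift z₀.1 z₀.2 Φ s * conj (G s) with hc₀
  obtain ⟨cM, hcM, hM⟩ := exists_moyal (cohenMatrix T)
  have hH : ((volume : Measure (Rd d)).prod (volume : Measure (Rd d))).IsAddHaarMeasure :=
    inferInstance
  have hH2 : ((volume : Measure (R2d d)).prod (volume : Measure (R2d d))).IsAddHaarMeasure :=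
    Measure.prod.instIsAddHaarMeasure _ _
  have hH' := Measure.prod.instIsAddHaarMeasure
    ((volume : Measure (Rd d)).prod (volume : Measure (Rd d)))
    ((volume : Measure (Rd d)).prod (volume : Measure (Rd d)))
  obtain ⟨c₃, hc₃, h₃⟩ := exists_map_eq_smul (covarianceEquiv T)
    (((volume : Measure (Rd d)).prod volume).prod ((volume : Measure (Rd d)).prod volume))
    ((volume : Measure (R2d d)).prod volume)
  obtain ⟨cJ, hcJ, hJ⟩ := exists_map_eq_smul (symplecticEquiv d)
    ((volume : Measure (Rd d)).prod volume) (volume : Measure (R2d d))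
  -- The factors come from the inversion formula, the Jacobian of `covarianceEquiv` and the
  -- orthogonality relations. The factor `cJ` below is the Jacobian of the symplectic rotation.
  set c : ℂ := c₀⁻¹ * (c₃ : ℂ)⁻¹ * cM with hc
  refine ⟨‖c‖₊ * cJ, fun σ => ?_⟩
  have hmh := measurable_inner_norm (continuous_stft_left G σ) (continuous_stft_right G σ) ∞
  -- The `M^{∞,1}` norm of `σ` is exactly the integral of `h`.
  set h : R2d d → ℝ≥0∞ := fun ω => eLpNorm (fun x => stft G σ x ω) ∞ volume with hh
  have hmv : Measurable fun v : Rd d × Rd d => h (symplecticEquiv d v - z₀.2) := by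
    have : Continuous fun v : Rd d × Rd d => symplecticEquiv d v - z₀.2 := by fun_prop
    exact hmh.comp this.measurable
  -- The total phase: one part from the shift of the window by `z₀`, the other from covariance.
  let θ : (Rd d × Rd d) × (Rd d × Rd d) → ℝ := fun p =>
    inner ℝ (covarianceEquiv T p - z₀).1 z₀.2 + covariancePhase T p
  refine ⟨fun p => c * Complex.exp (-(2 * Real.pi * Complex.I * (θ p : ℝ))) *
      stft G σ (covarianceEquiv T p - z₀).1 (covarianceEquiv T p - z₀).2,
    fun v => ‖c‖ₑ * h (symplecticEquiv d v - z₀.2), ?_, ?_, ?_, ?_, ?_⟩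
  · have hθ : Continuous θ := by
      simp only [θ, covariancePhase]
      fun_prop
    have h1 : Measurable fun p : (Rd d × Rd d) × (Rd d × Rd d) => covarianceEquiv T p - z₀ := by
      have : Continuous fun p : (Rd d × Rd d) × (Rd d × Rd d) => covarianceEquiv T p - z₀ := by
        fun_prop
      exact this.measurable
    refine Measurable.mul (Continuous.measurable (by fun_prop)) ?_
    exact (measurable_stft G σ).comp h1
  · exact hmv.const_mul _
  · intro p
    rw [enorm_mul, enorm_mul]
    have h1 : ‖Complex.exp (-(2 * Real.pi * Complex.I * (θ p : ℝ)))‖ₑ = 1 := by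
      rw [← ofReal_norm, Complex.norm_exp]
      simp
    -- The crux: the frequency component depends only on the difference of the two phase-space
    -- points, and `T` has dropped out.
    have h2 : (covarianceEquiv T p - z₀).2 = symplecticEquiv d (p.2 - p.1) - z₀.2 := by
      rw [Prod.snd_sub, covarianceEquiv_apply, symplecticEquiv_apply]
      simp
    beta_reduce
    rw [h1, mul_one, ← h2]
    gcongr
    exact enorm_le_eLpNorm_top (continuous_stft_left G σ _) _
  · rw [lintegral_const_mul _ hmv]
    have h1 := lintegral_comp_equiv hJ fun ζ => h (ζ - z₀.2)
    rw [Measure.volume_eq_prod, h1, lintegral_sub_right_eq_self]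
    rw [ENNReal.coe_mul, mul_assoc]
    refine le_of_eq ?_
    congr 2
    rw [modulationNorm, mixedNorm, eLpNorm_one_eq_lintegral_enorm]
    simp [hh]
  · intro φ f
    -- Inversion with the shifted window. Translating the integration variable by `z₀` undoes the
    -- shift in the second factor and leaves it in `V_G σ`.
    have h1 := integral_stft_mul_stftDual σ G (timeFreqShift z₀.1 z₀.2 Φ)
      (conjSchwartz (matrixWigner (cohenMatrix T) φ f))
    rw [← hc₀, ← integral_sub_right_eq_self _ z₀] at h1
    have h2 := integral_comp_equiv h₃ fun Z : R2d d × R2d d => stft G σ (Z - z₀).1 (Z - z₀).2 *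
      stftDual (timeFreqShift z₀.1 z₀.2 Φ) (conjSchwartz (matrixWigner (cohenMatrix T) φ f))
        (Z - z₀).1 (Z - z₀).2
    rw [← Measure.volume_eq_prod (R2d d), h1] at h2
    have h3 : bracket σ (matrixWigner (cohenMatrix T) φ f) = c₀⁻¹ * (c₃ : ℂ)⁻¹ *
        ((c₃ : ℂ) * (c₀ * σ (conjSchwartz (matrixWigner (cohenMatrix T) φ f)))) := by
      have : (c₃ : ℂ) ≠ 0 := by simpa using hc₃.ne'
      rw [bracket]
      field_simp
    rw [h3]
    refine (congrArg _ h2.symm).trans ?_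
    rw [← integral_const_mul]
    refine integral_congr_ae (Filter.Eventually.of_forall fun p => ?_)
    simp only
    rw [stftDual_timeFreqShift, ← Prod.fst_add, ← Prod.snd_add, sub_add_cancel,
      stftDual_cohenWigner T hM]
    have h4 : Complex.exp (-(2 * Real.pi * Complex.I * (θ p : ℝ))) =
        Complex.exp (-(2 * Real.pi * Complex.I *
          (inner ℝ (covarianceEquiv T p - z₀).1 z₀.2 : ℝ))) *
        Complex.exp (-(2 * Real.pi * Complex.I * (covariancePhase T p : ℝ))) := by
      rw [← Complex.exp_add]
      congr 1
      simp only [θ]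
      push_cast
      ring
    rw [h4, hc]
    ring

end Kernel

/-! ### Minkowski's integral inequality -/

section Minkowski

variable {X Y : Type*} [MeasurableSpace X] [MeasurableSpace Y] {μ : Measure X} {ν : Measure Y}

/-- For `p = ∞`, the sublevel set at `c` consists of the `y` whose slice of `{f > c}` is null, hence
is measurable by Tonelli; otherwise the norm is a power of an integral. -/
theorem measurable_eLpNorm_left [SFinite μ] {f : X → Y → ℝ≥0∞}
    (hf : Measurable (Function.uncurry f)) (p : ℝ≥0∞) :
    Measurable fun y => eLpNorm (fun x => f x y) p μ := by
  by_cases hp0 : p = 0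
  · simp [hp0]
  by_cases hp : p = ∞
  · subst hp
    refine measurable_of_Iic fun c => ?_
    have hs : MeasurableSet {z : Y × X | c < f z.2 z.1} :=
      measurableSet_lt measurable_const (hf.comp measurable_swap)
    have hm := measurable_measure_prodMk_left (ν := μ) hs
    convert! hm (measurableSet_singleton 0) using 1
    ext y
    simp only [Set.mem_preimage, Set.mem_Iic, Set.mem_singleton_iff, eLpNorm_exponent_top]
    constructor
    · intro h
      have h3 : ∀ᵐ x ∂μ, f x y ≤ c :=
        (ae_le_eLpNormEssSup (f := fun x => f x y) (μ := μ)).mono fun x hx => hx.trans h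
      rw [ae_iff] at h3
      simpa using h3
    · intro h
      refine essSup_le_of_ae_le c ?_
      change ∀ᵐ x ∂μ, f x y ≤ c
      rw [ae_iff]
      simpa using h
  · simp_rw [eLpNorm_eq_lintegral_rpow_enorm_toReal hp0 hp]
    refine Measurable.pow_const ?_ _
    exact Measurable.lintegral_prod_right' (f := fun z : Y × X => ‖f z.2 z.1‖ₑ ^ p.toReal)
      ((hf.comp measurable_swap).enorm.pow_const _)

/-- Weighted Hölder instead of duality: split `f` as `f N^{-1/r'}` times `N^{1/r'}`. Hölder gives
`(∫ f)^r ≤ (∫ f^r N^{-(r-1)}) S^{r-1}`, and after Tonelli the inner integral is at most `N^r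
N^{-(r-1)} = N`. -/
theorem lintegral_lintegral_rpow_le [SFinite μ] [SFinite ν] {f : X → Y → ℝ≥0∞}
    (hf : Measurable (Function.uncurry f)) {r : ℝ} (hr : 1 < r) {N : Y → ℝ≥0∞} (hN : Measurable N)
    (hfN : ∀ y, ∫⁻ x, f x y ^ r ∂μ = N y ^ r) (hS : ∫⁻ y, N y ∂ν ≠ ∞) :
    ∫⁻ x, (∫⁻ y, f x y ∂ν) ^ r ∂μ ≤ (∫⁻ y, N y ∂ν) ^ r := by
  have hr0 : 0 < r := by linarith
  have hr1 : 0 < r - 1 := by linarith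
  obtain ⟨r', hrr'⟩ : ∃ r' : ℝ, r.HolderConjugate r' := ⟨_, Real.HolderConjugate.conjExponent hr⟩
  set S := ∫⁻ y, N y ∂ν with hSdef
  have hfr : Measurable fun z : X × Y => f z.1 z.2 ^ r := hf.pow_const _
  -- The splitting could fail only where `N` is `0` or `∞`. In the first case `f(·, y)` vanishes
  -- almost everywhere; the second is negligible because `∫ N` is finite.
  have hgood : ∀ᵐ x ∂μ, ∀ᵐ y ∂ν, f x y ≤ (f x y * N y ^ (-(1 / r'))) * N y ^ (1 / r') := by
    have hms : MeasurableSet {z : X × Y | f z.1 z.2 ≤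
        (f z.1 z.2 * N z.2 ^ (-(1 / r'))) * N z.2 ^ (1 / r')} := by
      have hN2 : Measurable fun z : X × Y => N z.2 := hN.comp measurable_snd
      exact measurableSet_le hf ((hf.mul (hN2.pow_const _)).mul (hN2.pow_const _))
    refine (Measure.ae_ae_comm hms).2 ?_
    filter_upwards [ae_lt_top hN hS] with y hy
    have hfy : Measurable fun x => f x y := hf.comp (measurable_id.prodMk measurable_const)
    by_cases h0 : N y = 0
    · have h1 := hfN y
      rw [h0, ENNReal.zero_rpow_of_pos hr0, lintegral_eq_zero_iff (hfy.pow_const r)] at h1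
      filter_upwards [h1] with x hx
      have : f x y = 0 := by simpa [ENNReal.rpow_eq_zero_iff, hr0, hr0.not_gt] using hx
      simp [this]
    · refine Filter.Eventually.of_forall fun x => ?_
      rw [mul_assoc, ← ENNReal.rpow_add _ _ h0 hy.ne, neg_add_cancel, ENNReal.rpow_zero, mul_one]
  have hHolder : ∀ᵐ x ∂μ, (∫⁻ y, f x y ∂ν) ^ r ≤
      (∫⁻ y, f x y ^ r * N y ^ (-(r - 1)) ∂ν) * S ^ (r - 1) := by
    filter_upwards [hgood] with x hx
    have hfx : Measurable fun y => f x y := hf.comp (measurable_const.prodMk measurable_id)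
    have h1 : ∫⁻ y, f x y ∂ν ≤ (∫⁻ y, (f x y * N y ^ (-(1 / r'))) ^ r ∂ν) ^ (1 / r) *
        (∫⁻ y, (N y ^ (1 / r')) ^ r' ∂ν) ^ (1 / r') :=
      (lintegral_mono_ae hx).trans (ENNReal.lintegral_mul_le_Lp_mul_Lq ν hrr'
        (hfx.mul (hN.pow_const _)).aemeasurable (hN.pow_const _).aemeasurable)
    have h2 : ∀ y, (N y ^ (1 / r')) ^ r' = N y := by
      intro y
      rw [← ENNReal.rpow_mul, one_div, inv_mul_cancel₀ hrr'.symm.ne_zero, ENNReal.rpow_one]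
    have h3 : ∀ y, (f x y * N y ^ (-(1 / r'))) ^ r = f x y ^ r * N y ^ (-(r - 1)) := by
      intro y
      rw [ENNReal.mul_rpow_of_nonneg _ _ hr0.le, ← ENNReal.rpow_mul]
      congr 2
      have := hrr'.sub_one_mul_conj
      have h5 : r' ≠ 0 := hrr'.symm.ne_zero
      field_simp
      linarith
    simp_rw [h2, h3] at h1
    calc (∫⁻ y, f x y ∂ν) ^ r
        ≤ ((∫⁻ y, f x y ^ r * N y ^ (-(r - 1)) ∂ν) ^ (1 / r) * S ^ (1 / r')) ^ r := by gcongr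
      _ = _ := by
        rw [ENNReal.mul_rpow_of_nonneg _ _ hr0.le, ← ENNReal.rpow_mul, ← ENNReal.rpow_mul,
          one_div_mul_cancel hr0.ne', ENNReal.rpow_one]
        congr 2
        have := hrr'.sub_one_mul_conj
        have h5 : r' ≠ 0 := hrr'.symm.ne_zero
        field_simp
        linarith
  calc ∫⁻ x, (∫⁻ y, f x y ∂ν) ^ r ∂μ
      ≤ ∫⁻ x, (∫⁻ y, f x y ^ r * N y ^ (-(r - 1)) ∂ν) * S ^ (r - 1) ∂μ := lintegral_mono_ae hHolder
    _ = (∫⁻ x, ∫⁻ y, f x y ^ r * N y ^ (-(r - 1)) ∂ν ∂μ) * S ^ (r - 1) :=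
        lintegral_mul_const' _ _ (ENNReal.rpow_ne_top_of_nonneg hr1.le hS)
    _ = (∫⁻ y, ∫⁻ x, f x y ^ r * N y ^ (-(r - 1)) ∂μ ∂ν) * S ^ (r - 1) := by
        rw [lintegral_lintegral_swap]
        exact (hfr.mul ((hN.comp measurable_snd).pow_const _)).aemeasurable
    _ ≤ S * S ^ (r - 1) := by
        gcongr
        refine lintegral_mono fun y => ?_
        have hfy : Measurable fun x => f x y ^ r :=
          hfr.comp (measurable_id.prodMk measurable_const)
        rw [lintegral_mul_const _ hfy, hfN]
        rcases eq_or_ne (N y) 0 with h0 | h0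
        · simp [h0, hr0]
        rcases eq_or_ne (N y) ∞ with h1 | h1
        · simp [h1]
        rw [← ENNReal.rpow_add _ _ h0 h1]
        simp
    _ = S ^ r := by
        rcases eq_or_ne S 0 with h0 | h0
        · simp [h0, hr0]
        nth_rewrite 1 [← ENNReal.rpow_one S]
        rw [← ENNReal.rpow_add _ _ h0 hS]
        congr 1
        ring

/-- Minkowski's integral inequality. -/
theorem eLpNorm_lintegral_le [SFinite μ] [SFinite ν] {f : X → Y → ℝ≥0∞}
    (hf : Measurable (Function.uncurry f)) {p : ℝ≥0∞} (hp : 1 ≤ p) :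
    eLpNorm (fun x => ∫⁻ y, f x y ∂ν) p μ ≤ ∫⁻ y, eLpNorm (fun x => f x y) p μ ∂ν := by
  have hN := measurable_eLpNorm_left (μ := μ) hf p
  rcases eq_or_ne (∫⁻ y, eLpNorm (fun x => f x y) p μ ∂ν) ∞ with hS | hS
  · rw [hS]; exact le_top
  rcases eq_or_ne p ∞ with rfl | hpt
  · rw [eLpNorm_exponent_top]
    refine essSup_le_of_ae_le _ ?_
    have hms : MeasurableSet {z : X × Y | f z.1 z.2 ≤ eLpNorm (fun x => f x z.2) ∞ μ} :=
      measurableSet_le hf (hN.comp measurable_snd)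
    have h : ∀ᵐ x ∂μ, ∀ᵐ y ∂ν, f x y ≤ eLpNorm (fun x => f x y) ∞ μ := by
      refine (Measure.ae_ae_comm hms).2 (Filter.Eventually.of_forall fun y => ?_)
      exact ae_le_eLpNormEssSup (f := fun x => f x y) (μ := μ)
    filter_upwards [h] with x hx
    exact lintegral_mono_ae hx
  have hp0 : p ≠ 0 := (one_pos.trans_le hp).ne'
  have hr : 1 ≤ p.toReal := by
    rw [← ENNReal.toReal_one]
    exact (ENNReal.toReal_le_toReal ENNReal.one_ne_top hpt).2 hp
  -- Exponent `1` is Tonelli; the Hölder argument needs an exponent above `1`.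
  rcases eq_or_lt_of_le hr with hr1 | hr1
  · have : p = 1 := by
      rw [← ENNReal.ofReal_toReal hpt, ← hr1, ENNReal.ofReal_one]
    subst this
    simp_rw [eLpNorm_one_eq_lintegral_enorm, enorm_eq_self]
    rw [lintegral_lintegral_swap hf.aemeasurable]
  · have hr0 : 0 < p.toReal := by linarith
    have hfN : ∀ y, ∫⁻ x, f x y ^ p.toReal ∂μ = eLpNorm (fun x => f x y) p μ ^ p.toReal := by
      intro y
      rw [eLpNorm_eq_lintegral_rpow_enorm_toReal hp0 hpt, ← ENNReal.rpow_mul,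
        one_div_mul_cancel hr0.ne', ENNReal.rpow_one]
      rfl
    rw [eLpNorm_eq_lintegral_rpow_enorm_toReal hp0 hpt, one_div, ENNReal.rpow_inv_le_iff hr0]
    exact lintegral_lintegral_rpow_le hf hr1 hN hfN hS

end Minkowski

/-! ### Mixed norms of averaged translates -/

section Translation

variable {V : Type*} [NormedAddCommGroup V] [InnerProductSpace ℝ V]
  [FiniteDimensional ℝ V] [MeasurableSpace V] [BorelSpace V]

theorem eLpNorm_comp_sub_right {f : V → ℝ≥0∞} (hf : Measurable f) (p : ℝ≥0∞) (a : V) :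
    eLpNorm (fun x => f (x - a)) p volume = eLpNorm f p volume :=
  eLpNorm_comp_measurePreserving hf.aestronglyMeasurable (measurePreserving_sub_right volume a)

/-- Mixed norms of averages of translates are controlled by the total mass. -/
theorem eLpNorm_eLpNorm_lintegral_sub_le {Y : Type*} [MeasurableSpace Y] (ν : Measure Y) [SFinite ν]
    {F : V → V → ℝ≥0∞} (hF : Measurable (Function.uncurry F)) {s : Y → V × V} (hs : Measurable s)
    {p q : ℝ≥0∞} (hp : 1 ≤ p) (hq : 1 ≤ q) :
    eLpNorm (fun x => eLpNorm (fun ω => ∫⁻ c, F (x - (s c).1) (ω - (s c).2) ∂ν) p volume) q volume ≤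
      ν Set.univ * eLpNorm (fun x => eLpNorm (fun ω => F x ω) p volume) q volume := by
  have hFx : ∀ x, Measurable (F x) := fun x => hF.comp (measurable_const.prodMk measurable_id)
  have hN : Measurable fun x => eLpNorm (fun ω => F x ω) p volume :=
    measurable_eLpNorm_left (f := fun ω x => F x ω) (hF.comp measurable_swap) p
  have hs1 : Measurable fun c => (s c).1 := hs.fst
  have hs2 : Measurable fun c => (s c).2 := hs.snd
  -- Minkowski is used once for each variable. Translation in `ω` is absorbed by the inner norm,
  -- translation in `x` by the outer one.
  calc eLpNorm (fun x => eLpNorm (fun ω => ∫⁻ c, F (x - (s c).1) (ω - (s c).2) ∂ν) p volume)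
        q volume
      ≤ eLpNorm (fun x => ∫⁻ c, eLpNorm (fun ω => F (x - (s c).1) ω) p volume ∂ν) q volume := by
        refine eLpNorm_mono_enorm fun x => ?_
        simp only [enorm_eq_self]
        refine (eLpNorm_lintegral_le (f := fun ω c => F (x - (s c).1) (ω - (s c).2)) ?_ hp).trans ?_
        · exact hF.comp ((measurable_const.sub (hs1.comp measurable_snd)).prodMk
            (measurable_fst.sub (hs2.comp measurable_snd)))
        · exact lintegral_mono fun c => (eLpNorm_comp_sub_right (hFx _) p (s c).2).le
    _ ≤ ∫⁻ c, eLpNorm (fun x => eLpNorm (fun ω => F (x - (s c).1) ω) p volume) q volume ∂ν := by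
        refine eLpNorm_lintegral_le (f := fun x c => eLpNorm (fun ω => F (x - (s c).1) ω) p volume)
          ?_ hq
        exact hN.comp (measurable_fst.sub (hs1.comp measurable_snd))
    _ = _ := by
        simp_rw [eLpNorm_comp_sub_right hN q]
        rw [lintegral_const, mul_comm]

end Translation

/-! ### Boundedness of the transform on the Wiener spaces, and membership of Schwartz functions -/

section WeightedBounds

variable {V : Type*} [NormedAddCommGroup V] [InnerProductSpace ℝ V]
  [FiniteDimensional ℝ V] [MeasurableSpace V] [BorelSpace V]

/-- The weight `(1 + ‖x‖) ^ (-N)` as an extended nonnegative function, with integrable `N`. -/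
def enormWeight (x : V) : ℝ≥0∞ := ENNReal.ofReal ((1 + ‖x‖) ^ decayExponent V)⁻¹

theorem measurable_enormWeight : Measurable (enormWeight : V → ℝ≥0∞) := by
  unfold enormWeight
  fun_prop

theorem enormWeight_le_one (x : V) : enormWeight x ≤ 1 := by
  rw [enormWeight, ENNReal.ofReal_le_one]
  exact inv_le_one_of_one_le₀ (one_le_pow₀ (by linarith [norm_nonneg x]))

theorem lintegral_enormWeight_ne_top : ∫⁻ x : V, enormWeight x ≠ ∞ := by
  have h := (integrable_weight (V := V)).lintegral_lt_top
  exact h.ne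

/-- The translated weight defines a finite measure below Lebesgue measure, on which the `L^1` norm
is controlled by the `L^p` norm. Its mass does not depend on `a`, so neither does the constant. -/
theorem exists_lintegral_mul_enormWeight_le {p : ℝ≥0∞} (hp : 1 ≤ p) :
    ∃ K : ℝ≥0∞, K ≠ ∞ ∧ ∀ F : V → ℝ≥0∞, Measurable F → ∀ a : V,
      ∫⁻ x, F x * enormWeight (x - a) ≤ K * eLpNorm F p volume := by
  refine ⟨(∫⁻ x : V, enormWeight x) ^ (1 / (1 : ℝ≥0∞).toReal - 1 / p.toReal), ?_, ?_⟩
  · refine ENNReal.rpow_ne_top_of_nonneg ?_ lintegral_enormWeight_ne_top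
    rcases eq_or_ne p ∞ with rfl | hpt
    · simp
    · have : 1 ≤ p.toReal := by
        rw [← ENNReal.toReal_one]
        exact (ENNReal.toReal_le_toReal ENNReal.one_ne_top hpt).2 hp
      simpa using inv_le_one_of_one_le₀ this
  intro F hF a
  have hw : Measurable fun x : V => enormWeight (x - a) :=
    measurable_enormWeight.comp (measurable_id.sub_const a)
  set W : Measure V := volume.withDensity fun x => enormWeight (x - a) with hW
  have hWu : W Set.univ = ∫⁻ x : V, enormWeight x := by
    rw [hW, withDensity_apply _ MeasurableSet.univ, Measure.restrict_univ]
    exact lintegral_sub_right_eq_self enormWeight a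
  have hWle : W ≤ volume := by
    have := withDensity_mono (μ := (volume : Measure V)) (f := fun x => enormWeight (x - a))
      (g := 1) (Filter.Eventually.of_forall fun x => enormWeight_le_one _)
    rwa [withDensity_one] at this
  have h := eLpNorm_le_eLpNorm_mul_rpow_measure_univ (μ := W) hp hF.aestronglyMeasurable
  rw [hWu, eLpNorm_one_eq_lintegral_enorm, hW,
    lintegral_withDensity_eq_lintegral_mul _ hw hF.enorm, ← hW] at h
  calc ∫⁻ x, F x * enormWeight (x - a) = ∫⁻ x, ((fun x => enormWeight (x - a)) * (‖F ·‖ₑ)) x := by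
        simp [mul_comm]
    _ ≤ _ := h
    _ ≤ _ := by
        rw [mul_comm]
        gcongr

/-- Testing against a shifted function translates the transform up to a unimodular factor, which
gives the reproducing formula its convolution form. -/
theorem enorm_stftDual_conjSchwartz_timeFreqShift (g φ : 𝓢(V, ℂ)) (z z₀ : V × V) :
    ‖stftDual g (conjSchwartz (timeFreqShift z₀.1 z₀.2 φ)) z.1 z.2‖ₑ =
      ‖stftDual g (conjSchwartz φ) (z.1 - z₀.1) (z.2 - z₀.2)‖ₑ := by
  have h : stftDual g (conjSchwartz (timeFreqShift z₀.1 z₀.2 φ)) z.1 z.2 =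
      Complex.exp (2 * Real.pi * Complex.I * (inner ℝ z₀.1 (z.2 - z₀.2) : ℝ)) *
        stftDual g (conjSchwartz φ) (z.1 - z₀.1) (z.2 - z₀.2) := by
    rw [stftDual, stftDual, ← integral_add_right_eq_self _ z₀.1, ← integral_const_mul]
    refine integral_congr_ae (Filter.Eventually.of_forall fun t => ?_)
    simp only
    rw [conjSchwartz_timeFreqShift, timeFreqShift_apply, timeFreqShift_apply, timeFreqShift_apply,
      add_sub_cancel_right, show t + z₀.1 - z.1 = t - (z.1 - z₀.1) by abel]
    have : Complex.exp (2 * Real.pi * Complex.I * (inner ℝ (t + z₀.1) (-z₀.2) : ℝ)) *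
        Complex.exp (2 * Real.pi * Complex.I * (inner ℝ (t + z₀.1) z.2 : ℝ)) =
        Complex.exp (2 * Real.pi * Complex.I * (inner ℝ z₀.1 (z.2 - z₀.2) : ℝ)) *
        Complex.exp (2 * Real.pi * Complex.I * (inner ℝ t (z.2 - z₀.2) : ℝ)) := by
      rw [← Complex.exp_add, ← Complex.exp_add]
      congr 1
      simp only [inner_add_left, inner_sub_right, inner_neg_right]
      push_cast
      ring
    linear_combination (conjSchwartz φ t * g (t - (z.1 - z₀.1))) * this
  rw [h, enorm_mul]
  have : ‖Complex.exp (2 * Real.pi * Complex.I * (inner ℝ z₀.1 (z.2 - z₀.2) : ℝ))‖ₑ = 1 := by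
    rw [← ofReal_norm, Complex.norm_exp]
    simp
  rw [this, one_mul]

theorem measurable_enorm_stft (g : 𝓢(V, ℂ)) (u : 𝓢'(V, ℂ)) :
    Measurable (Function.uncurry fun x ω => ‖stft g u x ω‖ₑ) := (measurable_stft g u).enorm

theorem wienerNorm_eq (g : 𝓢(V, ℂ)) (p q : ℝ≥0∞) (u : 𝓢'(V, ℂ)) : wienerNorm g p q u =
    eLpNorm (fun x => eLpNorm (fun ω => ‖stft g u x ω‖ₑ) p volume) q volume := by
  simp_rw [eLpNorm_enorm]
  rfl

theorem enorm_phaseWeight (z : V × V) : ENNReal.ofReal (phaseWeight (decayExponent V) z) =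
    enormWeight z.1 * enormWeight z.2 := by
  rw [phaseWeight, ENNReal.ofReal_mul (by positivity)]
  rfl

theorem exists_lintegral_mul_enormWeight_mul_le {p q : ℝ≥0∞} (hp : 1 ≤ p) (hq : 1 ≤ q) :
    ∃ K : ℝ≥0∞, K ≠ ∞ ∧ ∀ F : V → V → ℝ≥0∞, Measurable (Function.uncurry F) → ∀ z₀ : V × V,
      ∫⁻ z : V × V, F z.1 z.2 * enormWeight (z.2 - z₀.2) * enormWeight (z.1 - z₀.1) ≤
        K * eLpNorm (fun x => eLpNorm (fun ω => F x ω) p volume) q volume := by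
  obtain ⟨Kp, hKp, hp'⟩ := exists_lintegral_mul_enormWeight_le (V := V) hp
  obtain ⟨Kq, hKq, hq'⟩ := exists_lintegral_mul_enormWeight_le (V := V) hq
  refine ⟨Kp * Kq, by finiteness, fun F hF z₀ => ?_⟩
  have hFs : Measurable (Function.uncurry fun ω x => F x ω) := hF.comp measurable_swap
  have hNm : Measurable fun x => eLpNorm (fun ω => F x ω) p volume := measurable_eLpNorm_left hFs p
  have hw := measurable_enormWeight (V := V)
  have hm1 : Measurable fun z : V × V => F z.1 z.2 * enormWeight (z.2 - z₀.2) :=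
    hF.mul (hw.comp (measurable_snd.sub_const _))
  have hm2 : Measurable fun z : V × V => F z.1 z.2 * enormWeight (z.2 - z₀.2) *
      enormWeight (z.1 - z₀.1) := hm1.mul (hw.comp (measurable_fst.sub_const _))
  calc ∫⁻ z : V × V, F z.1 z.2 * enormWeight (z.2 - z₀.2) * enormWeight (z.1 - z₀.1)
      = ∫⁻ x : V, (∫⁻ ω : V, F x ω * enormWeight (ω - z₀.2)) * enormWeight (x - z₀.1) := by
        rw [Measure.volume_eq_prod, lintegral_prod _ hm2.aemeasurable]
        refine lintegral_congr fun x => ?_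
        have hm3 : Measurable fun ω : V => F x ω * enormWeight (ω - z₀.2) :=
          hm1.comp (measurable_const.prodMk measurable_id)
        exact lintegral_mul_const (μ := volume) (enormWeight (x - z₀.1)) hm3
    _ ≤ ∫⁻ x : V, (Kp * eLpNorm (fun ω => F x ω) p volume) * enormWeight (x - z₀.1) := by
        gcongr with x
        exact hp' _ (hF.comp (measurable_const.prodMk measurable_id)) _
    _ = Kp * ∫⁻ x : V, eLpNorm (fun ω => F x ω) p volume * enormWeight (x - z₀.1) := by
        rw [← lintegral_const_mul' _ _ hKp]
        simp_rw [mul_assoc]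
    _ ≤ Kp * (Kq * eLpNorm (fun x => eLpNorm (fun ω => F x ω) p volume) q volume) := by
        gcongr
        exact hq' _ hNm _
    _ = _ := by ring

/-- The short-time Fourier transform of an element of `W(FL^p, L^q)` is bounded. -/
theorem exists_enorm_stft_le_wienerNorm {g : 𝓢(V, ℂ)} (hg : g ≠ 0) {p q : ℝ≥0∞} (hp : 1 ≤ p)
    (hq : 1 ≤ q) : ∃ K : ℝ≥0∞, K ≠ ∞ ∧ ∀ (u : 𝓢'(V, ℂ)) (z : V × V),
      ‖stft g u z.1 z.2‖ₑ ≤ K * wienerNorm g p q u := by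
  obtain ⟨K, hK, hK'⟩ := exists_lintegral_mul_enormWeight_mul_le (V := V) hp hq
  obtain ⟨r, -, -, hr⟩ := norm_stftDual_le_phaseWeight g (decayExponent V)
  set C : ℝ≥0∞ := ENNReal.ofReal (r (conjSchwartz g)) with hC
  have hD : ∀ z : V × V, ‖stftDual g (conjSchwartz g) z.1 z.2‖ₑ ≤
      C * (enormWeight z.1 * enormWeight z.2) := by
    intro z
    have h0 : 0 ≤ r (conjSchwartz g) :=
      nonneg_of_mul_nonneg_left ((norm_nonneg _).trans (hr _ 0)) (phaseWeight_pos _ 0)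
    rw [← enorm_phaseWeight, hC, ← ENNReal.ofReal_mul h0, ← ofReal_norm]
    exact ENNReal.ofReal_le_ofReal (hr _ z)
  set c : ℝ≥0∞ := ‖∫ s, g s * conj (g s)‖ₑ with hc
  have hc0 : c ≠ 0 := by simpa [hc] using integral_mul_conj_ne_zero hg
  have hct : c ≠ ∞ := enorm_ne_top
  have hCt : C ≠ ∞ := ENNReal.ofReal_ne_top
  refine ⟨c⁻¹ * (C * K), by finiteness, fun u z₀ => ?_⟩
  -- The inversion formula with test function `conj (π(z₀)g)` reproduces `V_g u(z₀)`; the second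
  -- factor of its integrand lies below a translate of the integrable weight.
  have key : c * ‖stft g u z₀.1 z₀.2‖ₑ ≤ C * (K * wienerNorm g p q u) := by
    have h := integral_stft_mul_stftDual u g g (conjSchwartz (timeFreqShift z₀.1 z₀.2 g))
    have h2 := congrArg (fun z : ℂ => ‖z‖ₑ) h
    simp only [enorm_mul] at h2
    rw [stft, bracket, hc, ← h2]
    calc _ ≤ ∫⁻ z : V × V, ‖stft g u z.1 z.2 *
          stftDual g (conjSchwartz (timeFreqShift z₀.1 z₀.2 g)) z.1 z.2‖ₑ :=
          enorm_integral_le_lintegral_enorm _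
      _ ≤ ∫⁻ z : V × V, C * (‖stft g u z.1 z.2‖ₑ * enormWeight (z.2 - z₀.2) *
            enormWeight (z.1 - z₀.1)) := by
          refine lintegral_mono fun z => ?_
          rw [enorm_mul, enorm_stftDual_conjSchwartz_timeFreqShift]
          calc _ ≤ ‖stft g u z.1 z.2‖ₑ *
                (C * (enormWeight (z.1 - z₀.1) * enormWeight (z.2 - z₀.2))) := by
                gcongr
                exact hD (z.1 - z₀.1, z.2 - z₀.2)
            _ = _ := by ring
      _ = C * ∫⁻ z : V × V, (‖stft g u z.1 z.2‖ₑ * enormWeight (z.2 - z₀.2) *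
            enormWeight (z.1 - z₀.1)) := lintegral_const_mul' _ _ hCt
      _ ≤ _ := by
          rw [wienerNorm_eq]
          gcongr
          exact hK' (fun x ω => ‖stft g u x ω‖ₑ) (measurable_enorm_stft g u) z₀
  calc ‖stft g u z₀.1 z₀.2‖ₑ = c⁻¹ * (c * ‖stft g u z₀.1 z₀.2‖ₑ) := by
        rw [← mul_assoc, ENNReal.inv_mul_cancel hc0 hct, one_mul]
    _ ≤ c⁻¹ * (C * (K * wienerNorm g p q u)) := by gcongr
    _ = _ := by ring

/-- A weight with values in `[0, 1]` dominates its powers of exponent at least `1`, so integrability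
suffices for every finite `p`. -/
theorem eLpNorm_enormWeight_ne_top {p : ℝ≥0∞} (hp : 1 ≤ p) :
    eLpNorm (enormWeight : V → ℝ≥0∞) p volume ≠ ∞ := by
  rcases eq_or_ne p ∞ with rfl | hpt
  · rw [eLpNorm_exponent_top]
    refine ne_top_of_le_ne_top ENNReal.one_ne_top (essSup_le_of_ae_le _ ?_)
    exact Filter.Eventually.of_forall enormWeight_le_one
  · have hr : 1 ≤ p.toReal := by
      rw [← ENNReal.toReal_one]
      exact (ENNReal.toReal_le_toReal ENNReal.one_ne_top hpt).2 hp
    rw [eLpNorm_eq_lintegral_rpow_enorm_toReal (one_pos.trans_le hp).ne' hpt]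
    refine ENNReal.rpow_ne_top_of_nonneg (by positivity)
      (ne_top_of_le_ne_top lintegral_enormWeight_ne_top (lintegral_mono fun x : V => ?_))
    simpa using ENNReal.rpow_le_rpow_of_exponent_ge (enormWeight_le_one x) hr

/-- Schwartz functions belong to `W(FL^p, L^q)`. -/
theorem coe_mem_wienerSpace (g f : 𝓢(V, ℂ)) (p q : ℝ≥0∞) [hp : Fact (1 ≤ p)] [hq : Fact (1 ≤ q)] :
    (f : 𝓢'(V, ℂ)) ∈ wienerSpace g p q := by
  obtain ⟨C, hC0, hC⟩ := norm_stft_coe_le_phaseWeight g f (decayExponent V)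
  have hC' : ∀ x ω : V, ‖stft g (f : 𝓢'(V, ℂ)) x ω‖ₑ ≤
      ENNReal.ofReal C * (enormWeight x * enormWeight ω) := by
    intro x ω
    rw [← enorm_phaseWeight (x, ω), ← ENNReal.ofReal_mul hC0, ← ofReal_norm]
    exact ENNReal.ofReal_le_ofReal (hC (x, ω))
  have hw := (measurable_enormWeight (V := V)).aestronglyMeasurable (μ := volume)
  have h1 : ∀ x : V, eLpNorm (fun ω => ‖stft g (f : 𝓢'(V, ℂ)) x ω‖ₑ) p volume ≤
      (ENNReal.ofReal C * enormWeight x) * eLpNorm (enormWeight : V → ℝ≥0∞) p volume := by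
    intro x
    refine eLpNorm_le_mul_eLpNorm_of_ae_le_mul'' p hw (Filter.Eventually.of_forall fun ω => ?_)
    rw [enorm_eq_self, enorm_eq_self, mul_assoc]
    exact hC' x ω
  have h2 : wienerNorm g p q f ≤
      (ENNReal.ofReal C * eLpNorm (enormWeight : V → ℝ≥0∞) p volume) *
        eLpNorm (enormWeight : V → ℝ≥0∞) q volume := by
    rw [wienerNorm_eq]
    refine eLpNorm_le_mul_eLpNorm_of_ae_le_mul'' q hw (Filter.Eventually.of_forall fun x => ?_)
    rw [enorm_eq_self, enorm_eq_self]
    exact (h1 x).trans_eq (by ring)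
  exact h2.trans_lt (ENNReal.mul_lt_top (ENNReal.mul_lt_top ENNReal.ofReal_lt_top
    (eLpNorm_enormWeight_ne_top hp.out).lt_top) (eLpNorm_enormWeight_ne_top hq.out).lt_top)

end WeightedBounds

/-! ### Operators given by kernels dominated by convolutions -/

section KernelOperator

variable {V : Type*} [NormedAddCommGroup V] [InnerProductSpace ℝ V]
  [FiniteDimensional ℝ V] [MeasurableSpace V] [BorelSpace V]

theorem stftDual_add (g φ ψ : 𝓢(V, ℂ)) (x ω : V) :
    stftDual g (φ + ψ) x ω = stftDual g φ x ω + stftDual g ψ x ω := by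
  simp only [stftDual_eq_apply, map_add]
  rfl

theorem stftDual_smul (g : 𝓢(V, ℂ)) (c : ℂ) (φ : 𝓢(V, ℂ)) (x ω : V) :
    stftDual g (c • φ) x ω = c * stftDual g φ x ω := by
  simp only [stftDual_eq_apply, map_smul]
  rfl

/-- After domination by `H`, the substitution `a ↦ b - a` moves the difference of variables from `H`
to `F`, so that `F` appears only through translates. -/
theorem lintegral_mul_enorm_kernel_le {k : (V × V) × (V × V) → ℂ} {H : V × V → ℝ≥0∞}
    (hH : Measurable H) (hkH : ∀ p, ‖k p‖ₑ ≤ H (p.2 - p.1)) {F D : V × V → ℝ≥0∞}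
    (hF : Measurable F) (hD : Measurable D) :
    ∫⁻ p : (V × V) × (V × V), F p.1 * D p.2 * ‖k p‖ₑ ≤
      ∫⁻ c : (V × V) × (V × V), H c.1 * D c.2 * F (c.2 - c.1) := by
  have hm : Measurable fun p : (V × V) × (V × V) => F p.1 * D p.2 * H (p.2 - p.1) :=
    ((hF.comp measurable_fst).mul (hD.comp measurable_snd)).mul
      (hH.comp (measurable_snd.sub measurable_fst))
  have hm2 : Measurable fun c : (V × V) × (V × V) => H c.1 * D c.2 * F (c.2 - c.1) :=
    ((hH.comp measurable_fst).mul (hD.comp measurable_snd)).mul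
      (hF.comp (measurable_snd.sub measurable_fst))
  calc ∫⁻ p : (V × V) × (V × V), F p.1 * D p.2 * ‖k p‖ₑ
      ≤ ∫⁻ p : (V × V) × (V × V), F p.1 * D p.2 * H (p.2 - p.1) := by
        gcongr with p
        exact hkH p
    _ = ∫⁻ b : V × V, ∫⁻ a : V × V, F a * D b * H (b - a) := by
        rw [Measure.volume_eq_prod (V × V), lintegral_prod_symm _ hm.aemeasurable]
    _ = ∫⁻ b : V × V, ∫⁻ a : V × V, H a * D b * F (b - a) := by
        have : (volume : Measure (V × V)).IsAddHaarMeasure := Measure.prod.instIsAddHaarMeasure _ _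
        refine lintegral_congr fun b => ?_
        rw [← lintegral_sub_left_eq_self _ b]
        refine lintegral_congr fun a => ?_
        rw [sub_sub_cancel]
        ring
    _ = _ := by
        rw [Measure.volume_eq_prod (V × V), lintegral_prod_symm _ hm2.aemeasurable]

theorem lintegral_mul_kernel_le {k : (V × V) × (V × V) → ℂ} {H : V × V → ℝ≥0∞}
    (hH : Measurable H) (hkH : ∀ p, ‖k p‖ₑ ≤ H (p.2 - p.1)) {D : V × V → ℝ≥0∞}
    (hD : Measurable D) :
    ∫⁻ p : (V × V) × (V × V), D p.2 * ‖k p‖ₑ ≤ (∫⁻ a, H a) * ∫⁻ b, D b := by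
  have h := lintegral_mul_enorm_kernel_le hH hkH (F := fun _ => 1) measurable_const hD
  simp only [one_mul, mul_one] at h
  rwa [Measure.volume_eq_prod (V × V), lintegral_prod_mul hH.aemeasurable hD.aemeasurable] at h

/-- The pairing `∫∫ V_g u(z) k(z, w) ⟨φ, π(w) g⟩ dz dw`. -/
def kernelPairing (g : 𝓢(V, ℂ)) (k : (V × V) × (V × V) → ℂ) (u : 𝓢'(V, ℂ)) (φ : 𝓢(V, ℂ)) : ℂ :=
  ∫ p : (V × V) × (V × V), stft g u p.1.1 p.1.2 * stftDual g φ p.2.1 p.2.2 * k p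

variable {k : (V × V) × (V × V) → ℂ} {H : V × V → ℝ≥0∞}

theorem integrable_stftDual_mul_kernel (g φ : 𝓢(V, ℂ)) (hk : Measurable k) (hH : Measurable H)
    (hkH : ∀ p, ‖k p‖ₑ ≤ H (p.2 - p.1)) (hHt : ∫⁻ a, H a ≠ ∞) :
    Integrable fun p : (V × V) × (V × V) => stftDual g φ p.2.1 p.2.2 * k p := by
  have hD := measurable_stftDual g φ
  refine ⟨((hD.comp measurable_snd).mul hk).aestronglyMeasurable, ?_⟩
  have h := lintegral_mul_kernel_le hH hkH hD.enorm
  rw [HasFiniteIntegral]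
  simp_rw [enorm_mul]
  exact h.trans_lt (ENNReal.mul_lt_top hHt.lt_top (integrable_stftDual g φ).2)

theorem integrable_kernelPairing (g φ : 𝓢(V, ℂ)) {u : 𝓢'(V, ℂ)} (hk : Measurable k)
    (hH : Measurable H) (hkH : ∀ p, ‖k p‖ₑ ≤ H (p.2 - p.1)) (hHt : ∫⁻ a, H a ≠ ∞) {B : ℝ}
    (hB : ∀ z : V × V, ‖stft g u z.1 z.2‖ ≤ B) :
    Integrable fun p : (V × V) × (V × V) =>
      stft g u p.1.1 p.1.2 * stftDual g φ p.2.1 p.2.2 * k p := by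
  simp_rw [mul_assoc]
  exact (integrable_stftDual_mul_kernel g φ hk hH hkH hHt).bdd_mul
    ((measurable_stft g u).comp measurable_fst).aestronglyMeasurable
    (Filter.Eventually.of_forall fun p => hB p.1)

theorem enorm_kernelPairing_le (g φ : 𝓢(V, ℂ)) {u : 𝓢'(V, ℂ)}
    (hH : Measurable H) (hkH : ∀ p, ‖k p‖ₑ ≤ H (p.2 - p.1)) {B : ℝ}
    (hB : ∀ z : V × V, ‖stft g u z.1 z.2‖ ≤ B) :
    ‖kernelPairing g k u φ‖ₑ ≤ ENNReal.ofReal B *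
      ((∫⁻ a, H a) * ∫⁻ z : V × V, ‖stftDual g φ z.1 z.2‖ₑ) := by
  refine (enorm_integral_le_lintegral_enorm _).trans ?_
  refine le_trans ?_ (mul_le_mul_right
    (lintegral_mul_kernel_le hH hkH (measurable_stftDual g φ).enorm) _)
  rw [← lintegral_const_mul' _ _ ENNReal.ofReal_ne_top]
  refine lintegral_mono fun p => ?_
  rw [mul_assoc, enorm_mul, enorm_mul]
  gcongr
  rw [← ofReal_norm]
  exact ENNReal.ofReal_le_ofReal (hB p.1)

/-- This makes the kernel pairing continuous at zero in `φ`, hence a tempered distribution. -/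
theorem tendsto_lintegral_stftDual (g : 𝓢(V, ℂ)) : Filter.Tendsto
    (fun φ => ∫⁻ z : V × V, ‖stftDual g φ z.1 z.2‖ₑ) (nhds 0) (nhds 0) := by
  obtain ⟨r, hr, hr0, h⟩ := norm_stftDual_le_phaseWeight g (decayExponent V)
  set M := ∫⁻ z : V × V, ENNReal.ofReal (phaseWeight (decayExponent V) z) with hM
  have hMt : M ≠ ∞ := (integrable_phaseWeight (V := V)).lintegral_lt_top.ne
  have hlim : Filter.Tendsto (fun φ => ENNReal.ofReal (r φ) * M) (nhds 0) (nhds 0) := by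
    have h1 : Filter.Tendsto (fun φ => ENNReal.ofReal (r φ)) (nhds 0) (nhds 0) := by
      have := (ENNReal.continuous_ofReal.comp hr).tendsto 0
      simpa [hr0, Function.comp_def] using this
    have := ENNReal.Tendsto.mul_const h1 (Or.inr hMt)
    simpa using this
  refine tendsto_of_tendsto_of_tendsto_of_le_of_le tendsto_const_nhds hlim (fun _ => zero_le)
    fun φ => ?_
  simp only
  have h0 : 0 ≤ r φ :=
    nonneg_of_mul_nonneg_left ((norm_nonneg _).trans (h φ 0)) (phaseWeight_pos _ 0)
  rw [hM, ← lintegral_const_mul' _ _ ENNReal.ofReal_ne_top]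
  refine lintegral_mono fun z => ?_
  rw [← ENNReal.ofReal_mul h0, ← ofReal_norm]
  exact ENNReal.ofReal_le_ofReal (h φ z)

theorem exists_distribution_eq_kernelPairing (g : 𝓢(V, ℂ)) (u : 𝓢'(V, ℂ)) (hk : Measurable k)
    (hH : Measurable H) (hkH : ∀ p, ‖k p‖ₑ ≤ H (p.2 - p.1)) (hHt : ∫⁻ a, H a ≠ ∞) {B : ℝ}
    (hB : ∀ z : V × V, ‖stft g u z.1 z.2‖ ≤ B) :
    ∃ v : 𝓢'(V, ℂ), ∀ φ, v φ = kernelPairing g k u φ := by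
  have hi := fun φ => integrable_kernelPairing g φ hk hH hkH hHt hB
  let ℓ : 𝓢(V, ℂ) →ₗ[ℂ] ℂ :=
    { toFun := kernelPairing g k u
      map_add' := fun φ ψ => by
        rw [kernelPairing, kernelPairing, kernelPairing, ← integral_add (hi φ) (hi ψ)]
        refine integral_congr_ae (Filter.Eventually.of_forall fun p => ?_)
        simp only [stftDual_add]
        ring
      map_smul' := fun c φ => by
        rw [kernelPairing, kernelPairing, RingHom.id_apply, smul_eq_mul, ← integral_const_mul]
        refine integral_congr_ae (Filter.Eventually.of_forall fun p => ?_)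
        simp only [stftDual_smul]
        ring }
  have hc : Continuous ℓ := by
    refine continuous_of_continuousAt_zero ℓ ?_
    rw [ContinuousAt, map_zero, tendsto_zero_iff_enorm_tendsto_zero]
    have h1 := ENNReal.Tendsto.const_mul (tendsto_lintegral_stftDual g) (a := ∫⁻ a, H a)
      (Or.inr hHt)
    have h2 := ENNReal.Tendsto.const_mul h1 (a := ENNReal.ofReal B) (Or.inr ENNReal.ofReal_ne_top)
    simp only [mul_zero] at h2
    exact tendsto_of_tendsto_of_tendsto_of_le_of_le tendsto_const_nhds h2 (fun _ => zero_le)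
      fun φ => enorm_kernelPairing_le g φ hH hkH hB
  exact ⟨ContinuousLinearMap.toPointwiseConvergenceCLM _ _ _ _ (⟨ℓ, hc⟩ : 𝓢(V, ℂ) →L[ℂ] ℂ),
    fun φ => rfl⟩

/-- Absorbing `w` into the variable of `D` leaves an average of translates of `F` against a measure
that no longer depends on `w`. -/
theorem lintegral_withDensity_translate {D F : V × V → ℝ≥0∞} (hH : Measurable H)
    (hD : Measurable D) (hF : Measurable F) (w : V × V) :
    ∫⁻ c : (V × V) × (V × V), H c.1 * D (c.2 - w) * F (c.2 - c.1) =
      ∫⁻ c, F (w - (c.1 - c.2)) ∂(volume : Measure ((V × V) × (V × V))).withDensity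
        fun c => H c.1 * D c.2 := by
  have : (volume : Measure (V × V)).IsAddHaarMeasure := Measure.prod.instIsAddHaarMeasure _ _
  have : (volume : Measure ((V × V) × (V × V))).IsAddHaarMeasure :=
    Measure.prod.instIsAddHaarMeasure _ _
  have hρ : Measurable fun c : (V × V) × (V × V) => H c.1 * D c.2 :=
    (hH.comp measurable_fst).mul (hD.comp measurable_snd)
  have hG : Measurable fun c : (V × V) × (V × V) => F (w - (c.1 - c.2)) :=
    hF.comp ((measurable_fst.sub measurable_snd).const_sub w)
  rw [lintegral_withDensity_eq_lintegral_mul _ hρ hG,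
    ← lintegral_add_right_eq_self _ ((0 : V × V), w)]
  refine lintegral_congr fun c => ?_
  simp only [Prod.fst_add, Prod.snd_add, add_zero, add_sub_cancel_right, Pi.mul_apply]
  rw [show c.2 + w - c.1 = w - (c.1 - c.2) by abel]

theorem wienerNorm_le_of_eq_kernelPairing {g : 𝓢(V, ℂ)} {p q : ℝ≥0∞} (hp : 1 ≤ p) (hq : 1 ≤ q)
    {u v : 𝓢'(V, ℂ)} (hH : Measurable H) (hkH : ∀ p, ‖k p‖ₑ ≤ H (p.2 - p.1))
    (hv : ∀ φ, v φ = kernelPairing g k u φ) :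
    wienerNorm g p q v ≤ (∫⁻ a, H a) * (∫⁻ z : V × V, ‖stftDual g (conjSchwartz g) z.1 z.2‖ₑ) *
      wienerNorm g p q u := by
  obtain ⟨D, hD⟩ : ∃ D : V × V → ℝ≥0∞, D = fun z => ‖stftDual g (conjSchwartz g) z.1 z.2‖ₑ :=
    ⟨_, rfl⟩
  obtain ⟨F, hF⟩ : ∃ F : V × V → ℝ≥0∞, F = fun z => ‖stft g u z.1 z.2‖ₑ := ⟨_, rfl⟩
  have hDm : Measurable D := hD ▸ (measurable_stftDual g (conjSchwartz g)).enorm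
  have hFm : Measurable F := hF ▸ (measurable_stft g u).enorm
  set ν : Measure ((V × V) × (V × V)) := volume.withDensity fun c => H c.1 * D c.2 with hν
  have hs : Measurable fun c : (V × V) × (V × V) => c.1 - c.2 := measurable_fst.sub measurable_snd
  -- Test `v` on `conj (π(w)g)`: its transform has modulus `D` translated by `w`, so `|V_g v|` is
  -- bounded by translates of `|V_g u|` averaged against `ν`.
  have hpt : ∀ w : V × V, ‖stft g v w.1 w.2‖ₑ ≤ ∫⁻ c, F (w - (c.1 - c.2)) ∂ν := by
    intro w
    rw [stft, bracket, hv, kernelPairing, ← lintegral_withDensity_translate hH hDm hFm]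
    refine (enorm_integral_le_lintegral_enorm _).trans ?_
    refine le_trans (lintegral_mono fun c => ?_) (lintegral_mul_enorm_kernel_le hH hkH hFm
      (hDm.comp (measurable_id.sub_const w)))
    rw [enorm_mul, enorm_mul, enorm_stftDual_conjSchwartz_timeFreqShift g g _ w, hF, hD]
    rfl
  have hνu : ν Set.univ = (∫⁻ a, H a) * ∫⁻ z, D z := by
    rw [hν, withDensity_apply _ MeasurableSet.univ, Measure.restrict_univ,
      Measure.volume_eq_prod (V × V), lintegral_prod_mul hH.aemeasurable hDm.aemeasurable]
  have hu : wienerNorm g p q u =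
      eLpNorm (fun x => eLpNorm (fun ω => F (x, ω)) p volume) q volume := by
    rw [wienerNorm_eq, hF]
  rw [← hD, ← hνu, hu]
  refine le_trans ?_ (eLpNorm_eLpNorm_lintegral_sub_le ν (F := fun x ω => F (x, ω)) hFm hs hp hq)
  rw [wienerNorm_eq]
  refine eLpNorm_mono_enorm fun x => ?_
  rw [enorm_eq_self, enorm_eq_self]
  refine eLpNorm_mono_enorm fun ω => ?_
  rw [enorm_eq_self, enorm_eq_self]
  exact hpt (x, ω)

end KernelOperator

/-! ### Continuity for pointwise convergence, and construction of the operator -/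

section WeakContinuity

variable {V : Type*} [NormedAddCommGroup V] [InnerProductSpace ℝ V]
  [FiniteDimensional ℝ V] [MeasurableSpace V] [BorelSpace V]

/-- On a bounded region of the first variable the polynomial growth of the shifts is harmless. The
superposition is then one Schwartz function, and the truncated pairing is weakly continuous in `u`.
-/
theorem exists_apply_eq_setIntegral_stft (g : 𝓢(V, ℂ)) {m : (V × V) × (V × V) → ℂ}
    (hm : Integrable m) (R : ℝ) : ∃ S : 𝓢(V, ℂ), ∀ u : 𝓢'(V, ℂ),
      u S = ∫ p in {p : (V × V) × (V × V) | ‖p.1‖ ≤ R}, stft g u p.1.1 p.1.2 * m p := by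
  have hs : MeasurableSet {p : (V × V) × (V × V) | ‖p.1‖ ≤ R} :=
    measurableSet_le measurable_fst.norm measurable_const
  obtain ⟨h1, h2⟩ := integrable_seminorm_timeFreqShift (ζ := Prod.fst)
    (μ := volume.restrict {p : (V × V) × (V × V) | ‖p.1‖ ≤ R}) g
    hm.aestronglyMeasurable.restrict measurable_fst fun k n => by
      refine hm.norm.restrict.mul_bdd (c := (1 + R) ^ k * (1 + R) ^ n) (by fun_prop) ?_
      filter_upwards [ae_restrict_mem hs] with p hp
      have hp1 : ‖p.1.1‖ ≤ R := (norm_fst_le p.1).trans hp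
      have hp2 : ‖p.1.2‖ ≤ R := (norm_snd_le p.1).trans hp
      rw [Real.norm_of_nonneg (by positivity)]
      have : 0 ≤ R := (norm_nonneg _).trans hp
      gcongr
  refine ⟨schwartzIntegral h1 h2, fun u => ?_⟩
  rw [apply_schwartzIntegral]
  refine integral_congr_ae (Filter.Eventually.of_forall fun p => ?_)
  simp only [map_smul, smul_eq_mul, stft, bracket]
  ring

theorem tendsto_setIntegral_norm_fst {W : Type*} [NormedAddCommGroup W] [MeasurableSpace W]
    [OpensMeasurableSpace W] {Y : Type*} [MeasurableSpace Y] {μ : Measure (W × Y)}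
    {f : W × Y → ℝ} (hf : Integrable f μ) :
    Filter.Tendsto (fun n : ℕ => ∫ p in {p : W × Y | ‖p.1‖ ≤ n}ᶜ, f p ∂μ) Filter.atTop (nhds 0) := by
  have hs : ∀ n : ℕ, MeasurableSet {p : W × Y | ‖p.1‖ ≤ n}ᶜ := fun n =>
    (measurableSet_le measurable_fst.norm measurable_const).compl
  have h := tendsto_setIntegral_of_antitone (f := f) (μ := μ) hs (fun a b hab p hp => by
    simp only [Set.mem_compl_iff, Set.mem_ofPred_eq, not_le] at hp ⊢
    exact lt_of_le_of_lt (by exact_mod_cast hab) hp) ⟨0, hf.integrableOn⟩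
  have h0 : ⋂ n : ℕ, {p : W × Y | ‖p.1‖ ≤ n}ᶜ = ∅ := by
    refine Set.eq_empty_of_forall_notMem fun p hp => ?_
    obtain ⟨n, hn⟩ := exists_nat_ge ‖p.1‖
    exact (Set.mem_iInter.1 hp n) hn
  simpa [h0] using h

variable {k : (V × V) × (V × V) → ℂ} {H : V × V → ℝ≥0∞}

/-- The pairing is a uniform limit on `s` of evaluations at fixed Schwartz functions: the discarded
tail is at most `B` times the tail of one integrable function independent of `u`. -/
theorem continuousOn_kernelPairing (g φ : 𝓢(V, ℂ)) (hk : Measurable k)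
    (hH : Measurable H) (hkH : ∀ p, ‖k p‖ₑ ≤ H (p.2 - p.1)) (hHt : ∫⁻ a, H a ≠ ∞) {B : ℝ}
    {s : Set 𝓢'(V, ℂ)} (hs : ∀ u ∈ s, ∀ z : V × V, ‖stft g u z.1 z.2‖ ≤ B) :
    ContinuousOn (fun u => kernelPairing g k u φ) s := by
  have hm := integrable_stftDual_mul_kernel g φ hk hH hkH hHt
  choose S hS using fun n : ℕ => exists_apply_eq_setIntegral_stft g hm n
  have hA : ∀ n : ℕ, MeasurableSet {p : (V × V) × (V × V) | ‖p.1‖ ≤ n} := fun n =>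
    measurableSet_le measurable_fst.norm measurable_const
  refine TendstoUniformlyOn.continuousOn (F := fun (n : ℕ) (u : 𝓢'(V, ℂ)) => u (S n))
    (p := Filter.atTop) ?_ (Filter.Frequently.of_forall fun n => ?_)
  · rw [Metric.tendstoUniformlyOn_iff]
    intro ε hε
    have hlim := (tendsto_setIntegral_norm_fst hm.norm).const_mul B
    rw [mul_zero] at hlim
    filter_upwards [hlim.eventually_lt_const hε] with n hn u hu
    refine lt_of_le_of_lt ?_ hn
    have hi := integrable_kernelPairing g φ hk hH hkH hHt (hs u hu)
    have h1 := integral_add_compl (hA n) hi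
    have h2 : kernelPairing g k u φ - u (S n) = ∫ p in {p : (V × V) × (V × V) | ‖p.1‖ ≤ n}ᶜ,
        stft g u p.1.1 p.1.2 * stftDual g φ p.2.1 p.2.2 * k p := by
      rw [kernelPairing, ← h1, hS]
      simp_rw [mul_assoc]
      rw [add_sub_cancel_left]
    rw [dist_eq_norm, h2, ← integral_const_mul]
    refine norm_integral_le_of_norm_le (hm.norm.const_mul B).integrableOn
      (Filter.Eventually.of_forall fun p => ?_)
    rw [mul_assoc, norm_mul]
    gcongr
    exact hs u hu p.1
  · exact Continuous.continuousOn (by fun_prop)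

/-- A phase space kernel dominated by an integrable convolution kernel defines an operator
on `W(FL^p, L^q)`. -/
theorem exists_kernelOperator {g : 𝓢(V, ℂ)} (hg : g ≠ 0) (hk : Measurable k)
    (hH : Measurable H) (hkH : ∀ p, ‖k p‖ₑ ≤ H (p.2 - p.1)) (hHt : ∫⁻ a, H a ≠ ∞)
    (p q : ℝ≥0∞) [hp : Fact (1 ≤ p)] [hq : Fact (1 ≤ q)] :
    ∃ L : wienerSpace g p q →ₗ[ℂ] wienerSpace g p q,
      (∀ u φ, (L u : 𝓢'(V, ℂ)) φ = kernelPairing g k u φ) ∧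
      (∀ R : ℝ≥0, ContinuousOn L {u | wienerNorm g p q (u : 𝓢'(V, ℂ)) ≤ R}) ∧
      ∀ u : wienerSpace g p q, wienerNorm g p q (L u : 𝓢'(V, ℂ)) ≤
        (∫⁻ a, H a) * (∫⁻ z : V × V, ‖stftDual g (conjSchwartz g) z.1 z.2‖ₑ) *
          wienerNorm g p q (u : 𝓢'(V, ℂ)) := by
  obtain ⟨K, hK, hKb⟩ := exists_enorm_stft_le_wienerNorm hg hp.out hq.out
  -- A norm bound gives a uniform bound on the transform. It makes the pairing converge, and it is
  -- what weak continuity on norm-bounded sets requires.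
  have hbdd : ∀ {M : ℝ≥0∞}, M ≠ ∞ → ∀ u : 𝓢'(V, ℂ), wienerNorm g p q u ≤ M →
      ∀ z : V × V, ‖stft g u z.1 z.2‖ ≤ (K * M).toReal := by
    intro M hM u hu z
    rw [← toReal_enorm]
    exact ENNReal.toReal_mono (ENNReal.mul_ne_top hK hM) ((hKb u z).trans (by gcongr))
  have hu : ∀ u : wienerSpace g p q, wienerNorm g p q (u : 𝓢'(V, ℂ)) ≠ ∞ := fun u =>
    (show wienerNorm g p q (u : 𝓢'(V, ℂ)) < ∞ from u.2).ne
  have hub := fun u => hbdd (hu u) u le_rfl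
  choose v hv using fun u : wienerSpace g p q =>
    exists_distribution_eq_kernelPairing g (u : 𝓢'(V, ℂ)) hk hH hkH hHt (hub u)
  have hnorm := fun u => wienerNorm_le_of_eq_kernelPairing hp.out hq.out hH hkH (hv u)
  have hmem : ∀ u, v u ∈ wienerSpace g p q := fun u =>
    (hnorm u).trans_lt (ENNReal.mul_lt_top (ENNReal.mul_lt_top hHt.lt_top
      (integrable_stftDual g (conjSchwartz g)).2) (hu u).lt_top)
  have hi := fun (u : wienerSpace g p q) φ => integrable_kernelPairing g φ hk hH hkH hHt (hub u)
  refine ⟨{ toFun := fun u => ⟨v u, hmem u⟩, map_add' := fun u w => ?_, map_smul' := fun c u => ?_ },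
    hv, fun R => ?_, hnorm⟩
  · refine Subtype.ext (DFunLike.ext _ _ fun φ => ?_)
    change v (u + w) φ = v u φ + v w φ
    rw [hv, hv, hv, kernelPairing, kernelPairing, kernelPairing, ← integral_add (hi u φ) (hi w φ)]
    refine integral_congr_ae (Filter.Eventually.of_forall fun p => ?_)
    simp only [Submodule.coe_add, stft_add]
    ring
  · refine Subtype.ext (DFunLike.ext _ _ fun φ => ?_)
    change v (c • u) φ = c * v u φ
    rw [hv, hv, kernelPairing, kernelPairing, ← integral_const_mul]
    refine integral_congr_ae (Filter.Eventually.of_forall fun p => ?_)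
    simp only [Submodule.coe_smul, stft_smul]
    ring
  · rw [continuousOn_iff_continuous_domRestrict]
    refine Continuous.subtype_mk (PointwiseConvergenceCLM.continuous_of_continuous_eval
      fun φ => ?_) _
    have hc := continuousOn_kernelPairing g φ hk hH hkH hHt
      (s := {u : 𝓢'(V, ℂ) | wienerNorm g p q u ≤ R}) (hbdd ENNReal.coe_ne_top)
    have hc2 := hc.comp_continuous (f := fun u : {u : wienerSpace g p q |
      wienerNorm g p q (u : 𝓢'(V, ℂ)) ≤ R} => ((u : wienerSpace g p q) : 𝓢'(V, ℂ)))
      (continuous_subtype_val.comp continuous_subtype_val) fun u => u.2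
    exact hc2.congr fun u => (hv u φ).symm

end WeakContinuity

end MatrixWigner

end

/-! ### Assembly of the theorem -/

theorem mainTheorem10 (d : ℕ) (T : Matrix (Fin d) (Fin d) ℝ)
    (g : 𝓢(MatrixWigner.Rd d, ℂ)) (hg : g ≠ 0)
    (G : 𝓢(MatrixWigner.R2d d, ℂ)) (hG : G ≠ 0) :
    ∃ C : ℝ≥0, 0 < C ∧
      ∀ (σ : 𝓢'(MatrixWigner.R2d d, ℂ)), σ ∈ MatrixWigner.modulationSpace G ∞ 1 →
      ∀ (p q : ℝ≥0∞) [Fact (1 ≤ p)] [Fact (1 ≤ q)],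
        ∃ L : MatrixWigner.wienerSpace g p q →ₗ[ℂ] MatrixWigner.wienerSpace g p q,
          (∀ f : 𝓢(MatrixWigner.Rd d, ℂ),
            ∃ hf : (f : 𝓢'(MatrixWigner.Rd d, ℂ)) ∈ MatrixWigner.wienerSpace g p q,
              MatrixWigner.IsPseudoDiff (MatrixWigner.cohenMatrix T) σ f (L ⟨f, hf⟩)) ∧
          (∀ R : ℝ≥0, ContinuousOn L
            {u | MatrixWigner.wienerNorm g p q (u : 𝓢'(MatrixWigner.Rd d, ℂ)) ≤ R}) ∧
          ∀ u : MatrixWigner.wienerSpace g p q,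
            MatrixWigner.wienerNorm g p q (L u : 𝓢'(MatrixWigner.Rd d, ℂ)) ≤
              C * MatrixWigner.modulationNorm G ∞ 1 σ *
                MatrixWigner.wienerNorm g p q (u : 𝓢'(MatrixWigner.Rd d, ℂ)) := by
  obtain ⟨C, hC⟩ := MatrixWigner.exists_phaseSpace_kernel T hg hG
  set M : ℝ≥0∞ := ∫⁻ z : MatrixWigner.Rd d × MatrixWigner.Rd d,
    ‖MatrixWigner.stftDual g (MatrixWigner.conjSchwartz g) z.1 z.2‖ₑ
  have hM : M ≠ ∞ := (MatrixWigner.integrable_stftDual g (MatrixWigner.conjSchwartz g)).2.ne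
  -- The added `1` only ensures that the constant is positive.
  refine ⟨C * M.toNNReal + 1, by positivity, fun σ hσ p q _ _ => ?_⟩
  obtain ⟨k, H, hk, hH, hkH, hHC, hpair⟩ := hC σ
  have hσt : MatrixWigner.modulationNorm G ∞ 1 σ < ∞ := hσ
  have hHt : ∫⁻ v, H v ≠ ∞ := (hHC.trans_lt (ENNReal.mul_lt_top ENNReal.coe_lt_top hσt)).ne
  obtain ⟨L, hL, hLc, hLn⟩ := MatrixWigner.exists_kernelOperator hg hk hH hkH hHt p q
  refine ⟨L, fun f => ⟨MatrixWigner.coe_mem_wienerSpace g f p q, fun φ => ?_⟩, hLc, fun u => ?_⟩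
  -- Both sides are the kernel pairing of `f` with the conjugate of `φ`.
  · rw [hpair, MatrixWigner.bracket, hL]
    rfl
  · refine (hLn u).trans (mul_le_mul' ?_ le_rfl)
    calc (∫⁻ v, H v) * M ≤ C * MatrixWigner.modulationNorm G ∞ 1 σ * M := by gcongr
      _ = (C * M.toNNReal : ℝ≥0) * MatrixWigner.modulationNorm G ∞ 1 σ := by
        rw [ENNReal.coe_mul, ENNReal.coe_toNNReal hM]
        ring
      _ ≤ _ := by
        gcongr
        simp
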